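/- Let $k$ be an algebraically closed field of characteristic zero, and let $\mathcal C$ be an essentially small $k$-linear abelian category. Notation. For a $k$-algebra $B$ and a $k$-linear category $\mathfrak a$, let $\mathfrak a_B$ be the category of $B$-objects in $\mathfrak a$, i.e. of pairs $(M,\rho)$ with $M\in\mathfrak a$ and $\rho:B\to\operatorname{End}_{\mathfrak a}(M)$ a morphism of $k$-algebras, with the morphisms of $\mathfrak a$ compatible with $\rho$. For a field extension $L/k$ put $\mathcal C_{[L]}=\operatorname{Fp}((\operatorname{Ind}\mathcal C)_L)$, the full subcategory of finitely presented objects of $(\operatorname{Ind}\mathcal C)_L$. Assume: (E1) for every field extension $L/k$ the category $\mathcal C_{[L]}$ is abelian; (E2) for every field extension $L/k$ every object of $\mathcal C_{[L]}$ is a (finite) direct sum of indecomposable objects; and assume that $\operatorname{Ind}\mathcal C$ is hereditary, i.e. of global dimension at most one. We say that $\mathcal C$ has essential dimension $\le d$ if for every algebraically closed extension field $L$ of $k$ and every indecomposable object $V$ of $\mathcal C_{[L]}$ there are an intermediate field $k\subseteq L_0\subseteq L$, finitely generated over $k$ with $\operatorname{trdeg}_k L_0\le d$, and an object $V_0\in\mathcal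 C_{[L_0]}$ such that $V\cong L\otimes_{L_0}V_0$. The essential dimension of $\mathcal C$ is the smallest such integer $d\ge 0$ (and $\infty$ if there is none). Let $L/k$ be an arbitrary field extension. Let $D^b(\mathcal C)_{[L]}$ be the full subcategory of $D^b(\operatorname{Ind}\mathcal C)_L$ of those objects all of whose cohomology objects, with the induced $L$-action, lie in $\mathcal C_{[L]}$, and let $$[F]:D^b(\mathcal C_{[L]})\longrightarrow D^b(\mathcal C)_{[L]}$$ be the forgetful functor: it sends a complex of objects of $\mathcal C_{[L]}$ to the underlying complex over $\operatorname{Ind}\mathcal C$, equipped with the $L$-action induced by the $L$-actions on the terms. Then: 1. if $\mathcal C$ has essential dimension $\le 2$, then $[F]$ is essentially surjective; 2. if $\mathcal C$ has essential dimension $\le 1$, then $[F]$ is essentially surjective and full; 3. if $\mathcal C$ has essential dimension $0$, then $[F]$ is an equivalence of categories. -/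

import Mathlib

universe w v v' u u'

open CategoryTheory CategoryTheory.Limits

/-- A `B`-object of the `k`-linear category `D`: an object of `D` together with a morphism of
`k`-algebras from `B` to its endomorphism algebra. -/
structure BObj (k : Type*) [CommRing k] (B : Type*) [Ring B] [Algebra k B]
    (D : Type u) [Category.{v} D] [Preadditive D] [Linear k D] where
  /-- the underlying object -/
  obj : D
  /-- the action of `B` -/
  ρ : B →ₐ[k] End obj

namespace BObj

section Basic

variable {k : Type*} [CommRing k] {B : Type*} [Ring B] [Algebra k B]
  {D : Type u} [Category.{v} D] [Preadditive D] [Linear k D]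

/-- The action of an element of `B`, as a morphism of `D`. -/
def act (M : BObj k B D) (b : B) : M.obj ⟶ M.obj := M.ρ b

lemma act_one (M : BObj k B D) : M.act 1 = 𝟙 M.obj := M.ρ.map_one

lemma act_mul (M : BObj k B D) (a b : B) : M.act (a * b) = M.act b ≫ M.act a := M.ρ.map_mul a b

lemma act_add (M : BObj k B D) (a b : B) : M.act (a + b) = M.act a + M.act b := M.ρ.map_add a b

lemma act_zero (M : BObj k B D) : M.act 0 = 0 := M.ρ.map_zero

lemma act_smul (M : BObj k B D) (c : k) (b : B) : M.act (c • b) = c • M.act b := map_smul M.ρ c b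

lemma act_algebraMap (M : BObj k B D) (c : k) : M.act (algebraMap k B c) = c • 𝟙 M.obj := by
  rw [Algebra.algebraMap_eq_smul_one, act_smul, act_one]

/-- Constructor for `B`-objects in terms of morphisms of `D`. -/
def mk' (X : D) (a : B → (X ⟶ X)) (h1 : a 1 = 𝟙 X) (hmul : ∀ b c, a (b * c) = a c ≫ a b)
    (hadd : ∀ b c, a (b + c) = a b + a c) (hsmul : ∀ (c : k) b, a (c • b) = c • a b) :
    BObj k B D where
  obj := X
  ρ := AlgHom.ofLinearMap { toFun := a, map_add' := hadd, map_smul' := hsmul } h1 hmul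

/-- A morphism of `B`-objects is a morphism of `D` commuting with the actions. -/
@[ext]
structure Hom (M N : BObj k B D) where
  /-- the underlying morphism -/
  hom : M.obj ⟶ N.obj
  comm : ∀ b : B, M.act b ≫ hom = hom ≫ N.act b

instance : Category.{v} (BObj k B D) where
  Hom M N := Hom M N
  id M := ⟨𝟙 M.obj, fun b => by rw [Category.comp_id, Category.id_comp]⟩
  comp f g := ⟨f.hom ≫ g.hom, fun b => by
    rw [← Category.assoc, f.comm, Category.assoc, g.comm, Category.assoc]⟩
  id_comp f := Hom.ext (Category.id_comp _)
  comp_id f := Hom.ext (Category.comp_id _)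
  assoc f g h := Hom.ext (Category.assoc _ _ _)

@[ext]
lemma hom_ext {M N : BObj k B D} {f g : M ⟶ N} (h : f.hom = g.hom) : f = g := Hom.ext h

@[simp] lemma id_hom (M : BObj k B D) : (𝟙 M : M ⟶ M).hom = 𝟙 M.obj := rfl

@[simp] lemma comp_hom {M N P : BObj k B D} (f : M ⟶ N) (g : N ⟶ P) :
    (f ≫ g).hom = f.hom ≫ g.hom := rfl

instance (M N : BObj k B D) : Zero (M ⟶ N) :=
  ⟨⟨0, fun b => by rw [comp_zero, zero_comp]⟩⟩

instance (M N : BObj k B D) : Add (M ⟶ N) :=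
  ⟨fun f g => ⟨f.hom + g.hom, fun b => by
    rw [Preadditive.comp_add, Preadditive.add_comp, f.comm, g.comm]⟩⟩

instance (M N : BObj k B D) : Neg (M ⟶ N) :=
  ⟨fun f => ⟨-f.hom, fun b => by rw [Preadditive.comp_neg, Preadditive.neg_comp, f.comm]⟩⟩

instance (M N : BObj k B D) : Sub (M ⟶ N) :=
  ⟨fun f g => ⟨f.hom - g.hom, fun b => by
    rw [Preadditive.comp_sub, Preadditive.sub_comp, f.comm, g.comm]⟩⟩

instance (M N : BObj k B D) : SMul k (M ⟶ N) :=
  ⟨fun c f => ⟨c • f.hom, fun b => by rw [Linear.comp_smul, Linear.smul_comp, f.comm]⟩⟩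

instance (M N : BObj k B D) : SMul ℕ (M ⟶ N) :=
  ⟨fun c f => ⟨c • f.hom, fun b => by rw [Preadditive.comp_nsmul, Preadditive.nsmul_comp, f.comm]⟩⟩

instance (M N : BObj k B D) : SMul ℤ (M ⟶ N) :=
  ⟨fun c f => ⟨c • f.hom, fun b => by rw [Preadditive.comp_zsmul, Preadditive.zsmul_comp, f.comm]⟩⟩

instance (M N : BObj k B D) : AddCommGroup (M ⟶ N) :=
  Function.Injective.addCommGroup (fun f : M ⟶ N => f.hom) (fun _ _ h => Hom.ext h) rfl
    (fun _ _ => rfl) (fun _ => rfl) (fun _ _ => rfl) (fun _ _ => rfl) (fun _ _ => rfl)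

@[simp] lemma zero_hom (M N : BObj k B D) : (0 : M ⟶ N).hom = 0 := rfl

@[simp] lemma add_hom {M N : BObj k B D} (f g : M ⟶ N) : (f + g).hom = f.hom + g.hom := rfl

instance : Preadditive (BObj k B D) where
  add_comp _ _ _ _ _ _ := Hom.ext (Preadditive.add_comp _ _ _ _ _ _)
  comp_add _ _ _ _ _ _ := Hom.ext (Preadditive.comp_add _ _ _ _ _ _)

/-- The functor which forgets the action. -/
@[simps]
def forget (k : Type*) [CommRing k] (B : Type*) [Ring B] [Algebra k B]
    (D : Type u) [Category.{v} D] [Preadditive D] [Linear k D] : BObj k B D ⥤ D where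
  obj M := M.obj
  map f := f.hom

instance : (forget k B D).Additive where
  map_add := rfl

instance : (forget k B D).Faithful where
  map_injective h := Hom.ext h

instance (M N : BObj k B D) : Module k (M ⟶ N) :=
  Function.Injective.module k
    (AddMonoidHom.mk' (fun f : M ⟶ N => f.hom) (fun _ _ => rfl)) (fun _ _ h => Hom.ext h)
    (fun _ _ => rfl)

/-- The category of `B`-objects is again `k`-linear. -/
instance instLinearBase : Linear k (BObj k B D) where
  smul_comp _ _ _ _ _ _ := Hom.ext (Linear.smul_comp _ _ _ _ _ _)
  comp_smul _ _ _ _ _ _ := Hom.ext (Linear.comp_smul _ _ _ _ _ _)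

@[simp] lemma smul_hom {M N : BObj k B D} (c : k) (f : M ⟶ N) : (c • f).hom = c • f.hom := rfl

instance : (forget k B D).Linear k where
  map_smul _ _ := rfl

/-- An isomorphism of `B`-objects from an isomorphism of `D` commuting with the actions. -/
@[simps]
def isoMk {M N : BObj k B D} (e : M.obj ≅ N.obj)
    (h : ∀ b : B, M.act b ≫ e.hom = e.hom ≫ N.act b) : M ≅ N where
  hom := ⟨e.hom, h⟩
  inv := ⟨e.inv, fun b => by rw [Iso.comp_inv_eq, Category.assoc, h, Iso.inv_hom_id_assoc]⟩

instance : (forget k B D).ReflectsIsomorphisms where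
  reflects {M N} f hf := by
    have : IsIso f.hom := hf
    exact (isoMk (asIso f.hom) f.comm).isIso_hom

/-! ### Limits and colimits of `B`-objects are created by the forgetful functor -/

section Limits

variable {J : Type*} [Category* J] (K : J ⥤ BObj k B D)

/-- The action of an element of `B`, as a natural transformation. -/
@[simps]
def actNat (b : B) : forget k B D ⟶ forget k B D where
  app M := M.act b
  naturality _ _ f := (f.comm b).symm

/-- The action of `B` on a limit of underlying objects. -/
def limitObj (c : Cone (K ⋙ forget k B D)) (hc : IsLimit c) : BObj k B D :=
  mk' c.pt
    (fun b => hc.map c (Functor.whiskerLeft K (actNat b)))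
    (hc.hom_ext fun j => (hc.map_π _ _ j).trans
      ((congrArg (fun t => c.π.app j ≫ t) (K.obj j).act_one).trans
        ((Category.comp_id (c.π.app j)).trans (Category.id_comp (c.π.app j)).symm)))
    (fun a b => hc.hom_ext fun j => by
      rw [IsLimit.map_π, Category.assoc, IsLimit.map_π, IsLimit.map_π_assoc]
      exact congrArg (fun t => c.π.app j ≫ t) ((K.obj j).act_mul a b))
    (fun a b => hc.hom_ext fun j => by
      rw [IsLimit.map_π, Preadditive.add_comp, IsLimit.map_π, IsLimit.map_π,
        ← Preadditive.comp_add]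
      exact congrArg (fun t => c.π.app j ≫ t) ((K.obj j).act_add a b))
    (fun a b => hc.hom_ext fun j => by
      rw [IsLimit.map_π, Linear.smul_comp, IsLimit.map_π, ← Linear.comp_smul]
      exact congrArg (fun t => c.π.app j ≫ t) ((K.obj j).act_smul a b))

lemma limitObj_act (c : Cone (K ⋙ forget k B D)) (hc : IsLimit c) (b : B) :
    (limitObj K c hc).act b = hc.map c (Functor.whiskerLeft K (actNat b)) := rfl

/-- The action of `B` on a colimit of underlying objects. -/
def colimitObj (c : Cocone (K ⋙ forget k B D)) (hc : IsColimit c) : BObj k B D :=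
  mk' c.pt
    (fun b => hc.map c (Functor.whiskerLeft K (actNat b)))
    (hc.hom_ext fun j => (hc.ι_map _ _ j).trans
      ((congrArg (fun t => t ≫ c.ι.app j) (K.obj j).act_one).trans
        ((Category.id_comp (c.ι.app j)).trans (Category.comp_id (c.ι.app j)).symm)))
    (fun a b => hc.hom_ext fun j => by
      rw [IsColimit.ι_map, IsColimit.ι_map_assoc, IsColimit.ι_map, ← Category.assoc]
      exact congrArg (fun t => t ≫ c.ι.app j) ((K.obj j).act_mul a b))
    (fun a b => hc.hom_ext fun j => by
      rw [IsColimit.ι_map, Preadditive.comp_add, IsColimit.ι_map, IsColimit.ι_map,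
        ← Preadditive.add_comp]
      exact congrArg (fun t => t ≫ c.ι.app j) ((K.obj j).act_add a b))
    (fun a b => hc.hom_ext fun j => by
      rw [IsColimit.ι_map, Linear.comp_smul, IsColimit.ι_map, ← Linear.smul_comp]
      exact congrArg (fun t => t ≫ c.ι.app j) ((K.obj j).act_smul a b))

lemma colimitObj_act (c : Cocone (K ⋙ forget k B D)) (hc : IsColimit c) (b : B) :
    (colimitObj K c hc).act b = hc.map c (Functor.whiskerLeft K (actNat b)) := rfl

/-- The lifted limit cone. -/
def limitCone (c : Cone (K ⋙ forget k B D)) (hc : IsLimit c) : Cone K where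
  pt := limitObj K c hc
  π := { app := fun j => ⟨c.π.app j, fun _ => hc.map_π _ _ j⟩
         naturality := fun _ _ f => Hom.ext (c.π.naturality f) }

/-- The lifted colimit cocone. -/
def colimitCocone (c : Cocone (K ⋙ forget k B D)) (hc : IsColimit c) : Cocone K where
  pt := colimitObj K c hc
  ι := { app := fun j => ⟨c.ι.app j, fun b =>
           (hc.ι_map c (Functor.whiskerLeft K (actNat b)) j).symm⟩
         naturality := fun _ _ f => Hom.ext (c.ι.naturality f) }

lemma limit_lift_comm (c : Cone (K ⋙ forget k B D)) (hc : IsLimit c) (s : Cone K) (b : B) :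
    (actNat b).app s.pt ≫ hc.lift ((forget k B D).mapCone s) =
      hc.lift ((forget k B D).mapCone s) ≫ hc.map c (Functor.whiskerLeft K (actNat b)) :=
  hc.hom_ext fun j => by
    rw [Category.assoc, Category.assoc, hc.fac, IsLimit.map_π, hc.fac_assoc]
    exact (s.π.app j).comm b

lemma colimit_desc_comm (c : Cocone (K ⋙ forget k B D)) (hc : IsColimit c) (s : Cocone K) (b : B) :
    hc.map c (Functor.whiskerLeft K (actNat b)) ≫ hc.desc ((forget k B D).mapCocone s) =
      hc.desc ((forget k B D).mapCocone s) ≫ (actNat b).app s.pt :=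
  hc.hom_ext fun j => by
    rw [IsColimit.ι_map_assoc, hc.fac, hc.fac_assoc]
    exact (s.ι.app j).comm b

/-- The lifted cone is a limit cone. -/
def isLimitLimitCone (c : Cone (K ⋙ forget k B D)) (hc : IsLimit c) :
    IsLimit (limitCone K c hc) where
  lift s := ⟨hc.lift ((forget k B D).mapCone s), limit_lift_comm K c hc s⟩
  fac s j := Hom.ext (hc.fac ((forget k B D).mapCone s) j)
  uniq s m h := Hom.ext (hc.uniq ((forget k B D).mapCone s) m.hom
    fun j => congrArg Hom.hom (h j))

/-- The lifted cocone is a colimit cocone. -/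
def isColimitColimitCocone (c : Cocone (K ⋙ forget k B D)) (hc : IsColimit c) :
    IsColimit (colimitCocone K c hc) where
  desc s := ⟨hc.desc ((forget k B D).mapCocone s), colimit_desc_comm K c hc s⟩
  fac s j := Hom.ext (hc.fac ((forget k B D).mapCocone s) j)
  uniq s m h := Hom.ext (hc.uniq ((forget k B D).mapCocone s) m.hom
    fun j => congrArg Hom.hom (h j))

noncomputable instance : CreatesLimit K (forget k B D) :=
  createsLimitOfReflectsIso fun c hc =>
    { liftedCone := limitCone K c hc
      validLift := Cone.ext (Iso.refl _) (fun _ => (Category.id_comp _).symm)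
      makesLimit := isLimitLimitCone K c hc }

noncomputable instance : CreatesColimit K (forget k B D) :=
  createsColimitOfReflectsIso fun c hc =>
    { liftedCocone := colimitCocone K c hc
      validLift := Cocone.ext (Iso.refl _) (fun _ => Category.comp_id _)
      makesColimit := isColimitColimitCocone K c hc }

end Limits

noncomputable instance (J : Type*) [Category* J] : CreatesLimitsOfShape J (forget k B D) where

noncomputable instance (J : Type*) [Category* J] : CreatesColimitsOfShape J (forget k B D) where

instance (J : Type*) [Category* J] [HasLimitsOfShape J D] : HasLimitsOfShape J (BObj k B D) :=
  hasLimitsOfShape_of_hasLimitsOfShape_createsLimitsOfShape (forget k B D)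

instance (J : Type*) [Category* J] [HasColimitsOfShape J D] : HasColimitsOfShape J (BObj k B D) :=
  hasColimitsOfShape_of_hasColimitsOfShape_createsColimitsOfShape (forget k B D)

end Basic

/-! ### The category of `B`-objects of an abelian category is abelian -/

section Abelian

variable {k : Type*} [CommRing k] {B : Type*} [Ring B] [Algebra k B]
  {D : Type u} [Category.{v} D] [Abelian D] [Linear k D]

instance : HasFiniteProducts (BObj k B D) := ⟨fun _ => inferInstance⟩

instance : HasKernels (BObj k B D) where
  has_limit _ := inferInstance

instance : HasCokernels (BObj k B D) where
  has_colimit _ := inferInstance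

instance : PreservesFiniteLimits (forget k B D) where
  preservesFiniteLimits _ := inferInstance

instance : PreservesFiniteColimits (forget k B D) where
  preservesFiniteColimits _ := inferInstance

instance {M N : BObj k B D} (f : M ⟶ N) : IsIso (Abelian.coimageImageComparison f) := by
  have h : IsIso ((forget k B D).map (Abelian.coimageImageComparison f)) := by
    rw [Arrow.isIso_iff_isIso_of_isIso
      (Abelian.PreservesCoimageImageComparison.iso (forget k B D) f).hom]
    infer_instance
  exact isIso_of_reflects_iso _ (forget k B D)

noncomputable instance instAbelian : Abelian (BObj k B D) :=
  Abelian.ofCoimageImageComparisonIsIso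

end Abelian

/-! ### Linearity over a commutative `B` -/

section Linear

variable {k : Type*} [CommRing k] {B : Type*} [CommRing B] [Algebra k B]
  {D : Type u} [Category.{v} D] [Preadditive D] [Linear k D]

lemma act_comm (M : BObj k B D) (a b : B) : M.act a ≫ M.act b = M.act b ≫ M.act a := by
  rw [← act_mul, ← act_mul, mul_comm]

instance (M N : BObj k B D) : SMul B (M ⟶ N) :=
  ⟨fun b f => ⟨f.hom ≫ N.act b, fun a => by
    rw [← Category.assoc, f.comm, Category.assoc, Category.assoc, act_comm]⟩⟩

lemma bsmul_hom {M N : BObj k B D} (b : B) (f : M ⟶ N) : (b • f).hom = f.hom ≫ N.act b := rfl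

instance (M N : BObj k B D) : Module B (M ⟶ N) where
  one_smul f := Hom.ext (by rw [bsmul_hom, act_one, Category.comp_id])
  mul_smul a b f := Hom.ext (by
    rw [bsmul_hom, bsmul_hom, bsmul_hom, act_mul, Category.assoc])
  smul_zero a := Hom.ext (by rw [bsmul_hom, zero_hom, zero_comp])
  smul_add a f g := Hom.ext (by
    rw [bsmul_hom, add_hom, add_hom, Preadditive.add_comp, bsmul_hom, bsmul_hom])
  add_smul a b f := Hom.ext (by
    rw [bsmul_hom, add_hom, act_add, Preadditive.comp_add, bsmul_hom, bsmul_hom])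
  zero_smul f := Hom.ext (by rw [bsmul_hom, act_zero, comp_zero, zero_hom])

/-- If `B` is commutative, then the category of `B`-objects is `B`-linear. -/
instance instLinear : Linear B (BObj k B D) where
  smul_comp X Y Z b f g := Hom.ext (by
    rw [comp_hom, bsmul_hom, bsmul_hom, comp_hom, Category.assoc, Category.assoc, g.comm])
  comp_smul X Y Z f b g := Hom.ext (by
    rw [comp_hom, bsmul_hom, bsmul_hom, comp_hom, Category.assoc])

instance (M N : BObj k B D) : IsScalarTower k B (M ⟶ N) where
  smul_assoc c b f := Hom.ext (by
    rw [bsmul_hom, act_smul, Linear.comp_smul, smul_hom, bsmul_hom])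

end Linear

/-! ### Functoriality -/

section Functoriality

variable {k : Type*} [CommRing k] (B : Type*) [Ring B] [Algebra k B]
  {D : Type u} [Category.{v} D] [Preadditive D] [Linear k D]
  {D' : Type u'} [Category.{v'} D'] [Preadditive D'] [Linear k D']

/-- A `k`-linear functor `D ⥤ D'` sends `B`-objects to `B`-objects. -/
@[simps!]
def map (T : D ⥤ D') [T.Additive] [T.Linear k] : BObj k B D ⥤ BObj k B D' where
  obj M := mk' (T.obj M.obj) (fun b => T.map (M.act b))
    (by rw [act_one, T.map_id]) (fun a b => by rw [act_mul, T.map_comp])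
    (fun a b => by rw [act_add, T.map_add]) (fun c b => by rw [act_smul, T.map_smul])
  map {M N} f := ⟨T.map f.hom, fun b =>
    (T.map_comp _ _).symm.trans ((congrArg T.map (f.comm b)).trans (T.map_comp _ _))⟩

lemma map_obj_act (T : D ⥤ D') [T.Additive] [T.Linear k] (M : BObj k B D) (b : B) :
    ((map B T).obj M).act b = T.map (M.act b) := rfl

end Functoriality

/-- In a `B`-linear category every object carries a tautological action of `B`. -/
def tautological (k : Type*) [CommRing k] (B : Type*) [CommRing B] [Algebra k B]
    (D : Type u) [Category.{v} D] [Preadditive D] [Linear k D] [Linear B D]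
    [∀ X Y : D, IsScalarTower k B (X ⟶ Y)] : D ⥤ BObj k B D where
  obj X := mk' X (fun b => b • 𝟙 X) (one_smul _ _)
    (fun a b => by rw [Linear.smul_comp, Category.id_comp, smul_smul, mul_comm])
    (fun a b => add_smul _ _ _) (fun c b => smul_assoc _ _ _)
  map {X Y} f := ⟨f, fun b => (Linear.smul_comp _ _ _ b (𝟙 X) f).trans
    ((congrArg (b • ·) ((Category.id_comp f).trans (Category.comp_id f).symm)).trans
      (Linear.comp_smul _ _ _ f b (𝟙 Y)).symm)⟩

/-- Regard a `B`-object in the `A`-linear category of `A`-objects of `D` as a `B`-object of `D`. -/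
def flatten (k : Type*) [CommRing k] (A : Type*) [CommRing A] [Algebra k A]
    (B : Type*) [Ring B] [Algebra k B] [Algebra A B] [IsScalarTower k A B]
    (D : Type u) [Category.{v} D] [Preadditive D] [Linear k D] :
    BObj A B (BObj k A D) ⥤ BObj k B D where
  obj M := mk' M.obj.obj (fun b => (M.act b).hom) (congrArg Hom.hom M.act_one)
    (fun a b => congrArg Hom.hom (M.act_mul a b)) (fun a b => congrArg Hom.hom (M.act_add a b))
    (fun c b => by
      rw [← algebraMap_smul A c b, act_smul, algebraMap_smul, smul_hom])
  map f := ⟨f.hom.hom, fun b => congrArg Hom.hom (f.comm b)⟩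

/-! ### The free `B`-object `B ⊗ X` -/

section Free

variable {k : Type*} [CommRing k] (B : Type*) [Ring B] [Algebra k B] [Module.Free k B]
  {D : Type u} [Category.{v} D] [Preadditive D] [Linear k D]
  [HasCoproductsOfShape (Module.Free.ChooseBasisIndex k B) D]

/-- The underlying object of `B ⊗ X`: a coproduct of copies of `X` indexed by a basis of `B`. -/
noncomputable abbrev tensorObj (k : Type*) [CommRing k] (B : Type*) [Ring B] [Algebra k B]
    [Module.Free k B] {D : Type u} [Category.{v} D] [Preadditive D] [Linear k D]
    [HasCoproductsOfShape (Module.Free.ChooseBasisIndex k B) D] (X : D) : D :=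
  ∐ fun _ : Module.Free.ChooseBasisIndex k B => X

/-- The `k`-linear map `b ↦ (x ↦ b ⊗ x)`. -/
noncomputable def tmul (X : D) : B →ₗ[k] (X ⟶ tensorObj k B X) :=
  (Module.Free.chooseBasis k B).constr k
    (fun i => Sigma.ι (fun _ : Module.Free.ChooseBasisIndex k B => X) i)

/-- The morphism out of `B ⊗ X` determined by a `k`-linear family of morphisms out of `X`. -/
noncomputable def tensorDesc {X Y : D} (φ : B →ₗ[k] (X ⟶ Y)) : tensorObj k B X ⟶ Y :=
  Sigma.desc fun i => φ (Module.Free.chooseBasis k B i)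

lemma tmul_tensorDesc {X Y : D} (φ : B →ₗ[k] (X ⟶ Y)) (b : B) :
    tmul (k := k) B X b ≫ tensorDesc B φ = φ b := by
  have : (Linear.rightComp k X (tensorDesc B φ)).comp (tmul (k := k) B X) = φ :=
    (Module.Free.chooseBasis k B).ext fun i => by
      simp [tmul, tensorDesc]
  exact LinearMap.congr_fun this b

lemma tensor_hom_ext {X Y : D} {f g : tensorObj k B X ⟶ Y}
    (h : ∀ b : B, tmul (k := k) B X b ≫ f = tmul (k := k) B X b ≫ g) : f = g :=
  Sigma.hom_ext _ _ fun i => by simpa [tmul] using h (Module.Free.chooseBasis k B i)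

/-- The free `B`-object `B ⊗ X`, on which `a` acts by `b ⊗ x ↦ ab ⊗ x`. -/
noncomputable def freeObj (k : Type*) [CommRing k] (B : Type*) [Ring B] [Algebra k B]
    [Module.Free k B] {D : Type u} [Category.{v} D] [Preadditive D] [Linear k D]
    [HasCoproductsOfShape (Module.Free.ChooseBasisIndex k B) D] (X : D) : BObj k B D :=
  mk' (tensorObj k B X) (fun a => tensorDesc B ((tmul B X).comp (LinearMap.mulLeft k a)))
    (tensor_hom_ext B fun b => by rw [tmul_tensorDesc]; simp)
    (fun a c => tensor_hom_ext B fun b => by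
      rw [tmul_tensorDesc, ← Category.assoc, tmul_tensorDesc, LinearMap.comp_apply,
        LinearMap.comp_apply, tmul_tensorDesc]
      simp)
    (fun a c => tensor_hom_ext B fun b => by
      rw [Preadditive.comp_add, tmul_tensorDesc, tmul_tensorDesc, tmul_tensorDesc]
      simp [add_mul])
    (fun a c => tensor_hom_ext B fun b => by
      rw [Linear.comp_smul, tmul_tensorDesc, tmul_tensorDesc]
      simp)

/-- The morphism `x ↦ b ⊗ x` from `X` to the underlying object of the free `B`-object. -/
noncomputable def freeι (k : Type*) [CommRing k] (B : Type*) [Ring B] [Algebra k B]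
    [Module.Free k B] {D : Type u} [Category.{v} D] [Preadditive D] [Linear k D]
    [HasCoproductsOfShape (Module.Free.ChooseBasisIndex k B) D] (X : D) (b : B) :
    X ⟶ (freeObj k B X).obj :=
  tmul B X b

lemma freeι_act (X : D) (a b : B) : freeι k B X b ≫ (freeObj k B X).act a = freeι k B X (a * b) :=
  tmul_tensorDesc B _ b

lemma freeι_hom_ext {X Y : D} {f g : (freeObj k B X).obj ⟶ Y}
    (h : ∀ b : B, freeι k B X b ≫ f = freeι k B X b ≫ g) : f = g :=
  tensor_hom_ext (k := k) B h

/-- The morphism out of `B ⊗ X` determined by a morphism from `X` to a `B`-object. -/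
noncomputable def freeDesc {X : D} (M : BObj k B D) (g : X ⟶ M.obj) :
    (freeObj k B X).obj ⟶ M.obj :=
  tensorDesc (k := k) B
      { toFun := fun b => g ≫ M.act b
        map_add' := fun a b => by rw [act_add, Preadditive.comp_add]
        map_smul' := fun c b => by rw [act_smul, Linear.comp_smul, RingHom.id_apply] }

lemma freeι_freeDesc {X : D} (M : BObj k B D) (g : X ⟶ M.obj) (b : B) :
    freeι k B X b ≫ freeDesc B M g = g ≫ M.act b :=
  tmul_tensorDesc B _ b

/-- Morphisms of `B`-objects out of `B ⊗ X` are morphisms of `D` out of `X`. -/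
noncomputable def freeHomEquiv (X : D) (M : BObj k B D) : (freeObj k B X ⟶ M) ≃ (X ⟶ M.obj) where
  toFun f := freeι k B X 1 ≫ f.hom
  invFun g := ⟨freeDesc B M g, fun a => freeι_hom_ext B fun b => by
      rw [← Category.assoc, freeι_act, freeι_freeDesc, ← Category.assoc, freeι_freeDesc,
        act_mul, Category.assoc]⟩
  left_inv f := Hom.ext (freeι_hom_ext B fun b => by
    rw [freeι_freeDesc, Category.assoc, ← f.comm, ← Category.assoc, freeι_act, mul_one])
  right_inv g := (freeι_freeDesc B M g 1).trans (by rw [act_one, Category.comp_id])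

lemma freeHomEquiv_naturality (X : D) (M N : BObj k B D) (g : M ⟶ N) (h : freeObj k B X ⟶ M) :
    freeHomEquiv B X N (h ≫ g) = freeHomEquiv B X M h ≫ g.hom :=
  (Category.assoc (freeι k B X 1) h.hom g.hom).symm

/-- The functor `X ↦ B ⊗ X`, left adjoint to the forgetful functor. -/
noncomputable def free (k : Type*) [CommRing k] (B : Type*) [Ring B] [Algebra k B]
    [Module.Free k B] (D : Type u) [Category.{v} D] [Preadditive D] [Linear k D]
    [HasCoproductsOfShape (Module.Free.ChooseBasisIndex k B) D] : D ⥤ BObj k B D :=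
  Adjunction.leftAdjointOfEquiv (G := forget k B D) (freeHomEquiv B)
    (freeHomEquiv_naturality B)

/-- The adjunction between `X ↦ B ⊗ X` and the forgetful functor. -/
noncomputable def freeAdjunction (k : Type*) [CommRing k] (B : Type*) [Ring B] [Algebra k B]
    [Module.Free k B] (D : Type u) [Category.{v} D] [Preadditive D] [Linear k D]
    [HasCoproductsOfShape (Module.Free.ChooseBasisIndex k B) D] :
    free k B D ⊣ forget k B D :=
  Adjunction.adjunctionOfEquivLeft (G := forget k B D) (freeHomEquiv B)
    (freeHomEquiv_naturality B)

end Free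

/-- The extension of scalars `V ↦ B ⊗_A V` from `A`-objects to `B`-objects. -/
noncomputable def extendScalars (k : Type*) [CommRing k] (A : Type*) [CommRing A] [Algebra k A]
    (B : Type*) [Ring B] [Algebra k B] [Algebra A B] [IsScalarTower k A B] [Module.Free A B]
    (D : Type u) [Category.{v} D] [Preadditive D] [Linear k D]
    [HasCoproductsOfShape (Module.Free.ChooseBasisIndex A B) D] : BObj k A D ⥤ BObj k B D :=
  free A B (BObj k A D) ⋙ flatten k A B D

end BObj

/-! ### The `k`-linear structure of the category of ind-objects -/

namespace IndLinear

section

variable (C : Type w) [SmallCategory C] [Abelian C]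

instance : HasFiniteBiproducts Cᵒᵖ := HasFiniteBiproducts.of_hasFiniteCoproducts

/-- An ind-object, regarded as a left exact functor to abelian groups. -/
noncomputable def toLex : Ind C ⥤ (Cᵒᵖ ⥤ₗ AddCommGrpCat.{w}) :=
  ((Ind.leftExactFunctorEquivalence C).trans
    (AddCommGrpCat.leftExactFunctorForgetEquivalence Cᵒᵖ).symm).functor

/-- An ind-object, regarded as a functor to abelian groups. -/
noncomputable def toAb : Ind C ⥤ Cᵒᵖ ⥤ AddCommGrpCat.{w} :=
  toLex C ⋙ ObjectProperty.ι _

/-- `toAb` is fully faithful. -/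
noncomputable def toAbFullyFaithful : (toAb C).FullyFaithful :=
  (((Ind.leftExactFunctorEquivalence C).trans
    (AddCommGrpCat.leftExactFunctorForgetEquivalence Cᵒᵖ).symm).fullyFaithfulFunctor.comp
      (ObjectProperty.fullyFaithfulι _))

instance : (toAb C).Additive := (toAbFullyFaithful C).additive_ofFullyFaithful

instance (X : Ind C) : ((toAb C).obj X).Additive := by
  have : PreservesFiniteLimits ((toAb C).obj X) := ((toLex C).obj X).property
  exact Functor.additive_of_preserves_binary_products _

end

variable (k : Type*) [CommRing k] {C : Type w} [SmallCategory C] [Abelian C] [Linear k C]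

/-- The action of a scalar `a` on an ind-object `X`, regarded as a functor: on `X(c)` it is
the map `X(a • 𝟙 c)`. -/
@[simps]
noncomputable def smulNat (X : Ind C) (a : k) : (toAb C).obj X ⟶ (toAb C).obj X where
  app c := ((toAb C).obj X).map (a • 𝟙 c.unop).op
  naturality c d f := by
    rw [← Functor.map_comp, ← Functor.map_comp]
    congr 1
    apply Quiver.Hom.unop_inj
    simp

/-- The action of a scalar on an ind-object. -/
noncomputable def smulHom (X : Ind C) (a : k) : X ⟶ X :=
  (toAbFullyFaithful C).preimage (smulNat k X a)

lemma map_smulHom (X : Ind C) (a : k) : (toAb C).map (smulHom k X a) = smulNat k X a :=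
  (toAbFullyFaithful C).map_preimage _

lemma smulHom_naturality {X Y : Ind C} (f : X ⟶ Y) (a : k) :
    f ≫ smulHom k Y a = smulHom k X a ≫ f :=
  (toAbFullyFaithful C).map_injective (by
    rw [Functor.map_comp, Functor.map_comp, map_smulHom, map_smulHom]
    ext1; ext1 c
    exact (((toAb C).map f).naturality (a • 𝟙 c.unop).op).symm)

lemma smulHom_mul (X : Ind C) (a b : k) : smulHom k X (a * b) = smulHom k X b ≫ smulHom k X a :=
  (toAbFullyFaithful C).map_injective (by
    rw [Functor.map_comp, map_smulHom, map_smulHom, map_smulHom]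
    ext1; ext1 c
    simp only [smulNat_app, NatTrans.comp_app]
    rw [← Functor.map_comp, ← op_comp, Linear.smul_comp, Category.id_comp, smul_smul])

lemma smulHom_add (X : Ind C) (a b : k) : smulHom k X (a + b) = smulHom k X a + smulHom k X b :=
  (toAbFullyFaithful C).map_injective (by
    rw [Functor.map_add, map_smulHom, map_smulHom, map_smulHom]
    ext1; ext1 c
    simp only [smulNat_app, add_smul]
    exact ((toAb C).obj X).map_add)

/-- The action of `k` on ind-objects. -/
noncomputable def toCenter : k →+* CatCenter (Ind C) where
  toFun a :=
    { app := fun X => smulHom k X a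
      naturality := fun _ _ f => smulHom_naturality k f a }
  map_one' := by
    apply NatTrans.ext; funext X
    apply (toAbFullyFaithful C).map_injective
    refine (map_smulHom k X 1).trans (Eq.trans ?_ ((toAb C).map_id X).symm)
    ext1; ext1 c
    simp only [smulNat_app, one_smul]
    exact ((toAb C).obj X).map_id c
  map_mul' a b := NatTrans.ext (funext fun X => smulHom_mul k X a b)
  map_zero' := by
    apply NatTrans.ext; funext X
    apply (toAbFullyFaithful C).map_injective
    refine (map_smulHom k X _).trans (Eq.trans ?_ ((toAb C).map_zero _ _).symm)
    ext1; ext1 c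
    simp only [smulNat_app, zero_smul]
    exact ((toAb C).obj X).map_zero _ _
  map_add' a b := NatTrans.ext (funext fun X => smulHom_add k X a b)

/-- The category of ind-objects of a `k`-linear abelian category is `k`-linear. -/
noncomputable instance : Linear k (Ind C) := Linear.ofRingMorphism (toCenter k)

end IndLinear

/-! ### Essentially small categories -/

section SmallModel

variable (C : Type u) [Category.{v} C] [EssentiallySmall.{w} C]

noncomputable instance [Preadditive C] : Preadditive (SmallModel.{w} C) :=
  .ofFullyFaithful (equivSmallModel.{w} C).fullyFaithfulInverse

instance [Preadditive C] : (equivSmallModel.{w} C).inverse.Additive :=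
  (equivSmallModel.{w} C).fullyFaithfulInverse.additive_ofFullyFaithful

noncomputable instance [Abelian C] : Abelian (SmallModel.{w} C) :=
  have : HasFiniteProducts (SmallModel.{w} C) :=
    ⟨fun _ => Adjunction.hasLimitsOfShape_of_equivalence (equivSmallModel.{w} C).inverse⟩
  abelianOfEquivalence (equivSmallModel.{w} C).inverse

noncomputable instance (k : Type*) [CommRing k] [Abelian C] [Linear k C] :
    Linear k (SmallModel.{w} C) where
  homModule X Y :=
    ((equivSmallModel.{w} C).fullyFaithfulInverse.homEquiv (X := X) (Y := Y)).module k
  smul_comp X Y Z r f g := (equivSmallModel.{w} C).inverse.map_injective (by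
    simp [Equiv.smul_def])
  comp_smul X Y Z f r g := (equivSmallModel.{w} C).inverse.map_injective (by
    simp [Equiv.smul_def])

/-- The category of ind-objects of an essentially small category. -/
abbrev IndCat : Type (w + 1) := Ind (SmallModel.{w} C)

end SmallModel

/-! ### Finitely presented objects -/

section FinitelyPresented

lemma isFinitelyPresentable_indYoneda {C : Type w} [SmallCategory C] (c : C) :
    IsFinitelyPresentable.{w} (Ind.yoneda.obj c) := by
  let e : Ind.inclusion C ⋙ (evaluation Cᵒᵖ (Type w)).obj (Opposite.op c) ≅
      coyoneda.obj (Opposite.op (Ind.yoneda.obj c)) :=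
    (NatIso.ofComponents (fun X =>
      ((Ind.inclusion.fullyFaithful (C := C)).homEquiv.trans
        (((Ind.yonedaCompInclusion (C := C)).app c).homFromEquiv.trans
          CategoryTheory.yonedaEquiv)).toIso) (fun f => by
            ext g
            simp [yonedaEquiv, Functor.FullyFaithful.homEquiv])).symm
  rw [isFinitelyPresentable_iff_preservesFilteredColimits]
  constructor
  intro J _ _
  exact preservesColimitsOfShape_of_natIso e

variable {A : Type u} [Category.{w} A]

lemma isFinitelyPresentable_isClosedUnderColimitsOfShape (J : Type) [SmallCategory J]
    [FinCategory J] :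
    (ObjectProperty.isFinitelyPresentable.{w} A).IsClosedUnderColimitsOfShape J :=
  have := Cardinal.fact_isRegular_aleph0.{w}
  have : Finite (Arrow J) := Finite.of_equiv _ (Arrow.equivSigma J).symm
  isClosedUnderColimitsOfShape_isCardinalPresentable.{w} A
    ((hasCardinalLT_aleph0_iff.{w, 0} _).2 inferInstance)

instance : (ObjectProperty.isFinitelyPresentable.{w} A).IsClosedUnderIsomorphisms :=
  have := Cardinal.fact_isRegular_aleph0.{w}
  inferInstanceAs (isCardinalPresentable.{w} A Cardinal.aleph0).IsClosedUnderIsomorphisms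

variable [Abelian A]

instance : (ObjectProperty.isFinitelyPresentable.{w} A).IsClosedUnderCokernels where
  cokernels_le := by
    rintro _ ⟨f, c, hc, hf⟩
    have := isFinitelyPresentable_isClosedUnderColimitsOfShape (A := A) WalkingParallelPair
    exact ObjectProperty.prop_of_isColimit _ hc (by rintro (_ | _); exacts [hf.1, hf.2])

instance : (ObjectProperty.isFinitelyPresentable.{w} A).IsClosedUnderFiniteProducts where
  isClosedUnderLimitsOfShape J _ :=
    { limitsOfShape_le := by
        rintro X ⟨p⟩
        have := Fintype.ofFinite J
        have : HasFiniteBiproducts A := Abelian.hasFiniteBiproducts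
        classical
        have := isFinitelyPresentable_isClosedUnderColimitsOfShape (A := A) (Discrete J)
        have h : ObjectProperty.isFinitelyPresentable.{w} A (⨁ fun j => p.diag.obj ⟨j⟩) :=
          ObjectProperty.prop_of_isColimit _ (biproduct.isColimit (fun j => p.diag.obj ⟨j⟩))
            (by rintro ⟨j⟩; exact p.prop_diag_obj ⟨j⟩)
        refine ObjectProperty.prop_of_iso _ (IsLimit.conePointsIsoOfNatIso
          (biproduct.isLimit (fun j => p.diag.obj ⟨j⟩)) p.isLimit
          (Discrete.natIso fun ⟨j⟩ => Iso.refl _)) h }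

instance : (ObjectProperty.isFinitelyPresentable.{w} A).ContainsZero where
  exists_zero := by
    have := isFinitelyPresentable_isClosedUnderColimitsOfShape (A := A) (Discrete PEmpty)
    refine ⟨_, initialIsInitial.isZero, ObjectProperty.prop_of_isColimit _
      (colimit.isColimit (Functor.empty.{0} A)) (by rintro ⟨⟨⟩⟩)⟩

/-- The zero morphisms of a category are unique, so kernels do not depend on them. -/
lemma hasKernels_of_nonempty_abelian {E : Type*} [Category* E] [HasZeroMorphisms E]
    (h : Nonempty (Abelian E)) : HasKernels E := by
  obtain ⟨a⟩ := h
  have e : (inferInstance : HasZeroMorphisms E) = Preadditive.preadditiveHasZeroMorphisms :=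
    Subsingleton.elim _ _
  convert (inferInstance : @HasKernels E _ Preadditive.preadditiveHasZeroMorphisms)

/-- If the finitely presented objects are a separating family and form an abelian category, then
they are closed under kernels. -/
lemma isClosedUnderKernels_of_abelian {S : ObjectProperty A} (hS : S.IsSeparating)
    (hSP : S ≤ ObjectProperty.isFinitelyPresentable.{w} A)
    (h : Nonempty (Abelian (ObjectProperty.isFinitelyPresentable.{w} A).FullSubcategory)) :
    (ObjectProperty.isFinitelyPresentable.{w} A).IsClosedUnderKernels where
  kernels_le := by
    rintro _ ⟨f, c, hc, hf⟩
    rename_i X Y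
    have := hasKernels_of_nonempty_abelian h
    let P := ObjectProperty.isFinitelyPresentable.{w} A
    let X' : P.FullSubcategory := ⟨X, hf.1⟩
    let Y' : P.FullSubcategory := ⟨Y, hf.2⟩
    let f' : X' ⟶ Y' := P.homMk f
    have hw : (kernel.ι f').hom ≫ f = 0 :=
      congrArg (fun t => t.hom) (kernel.condition f')
    let κ : (kernel f').obj ⟶ c.pt := hc.lift (KernelFork.ofι (kernel.ι f').hom hw)
    have hκ : κ ≫ c.ι = (kernel.ι f').hom := hc.fac _ WalkingParallelPair.zero
    have hmono : Mono c.ι := Fork.IsLimit.mono hc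
    have h1 : Mono κ := Preadditive.mono_of_cancel_zero _ fun {T} g hg => hS _ _ fun G hG t => by
      let a : (⟨G, hSP _ hG⟩ : P.FullSubcategory) ⟶ kernel f' := P.homMk (t ≫ g)
      have ha : a ≫ kernel.ι f' = 0 := by
        ext1
        change (t ≫ g) ≫ (kernel.ι f').hom = 0
        rw [← hκ, Category.assoc, ← Category.assoc g, hg, zero_comp, comp_zero]
      have ha' : a = 0 := (cancel_mono (kernel.ι f')).1 (by rw [ha, zero_comp])
      rw [comp_zero]
      exact congrArg (fun t => t.hom) ha'
    have h2 : Epi κ := Preadditive.epi_of_cancel_zero _ fun {T} g hg => hS _ _ fun G hG t => by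
      let a : (⟨G, hSP _ hG⟩ : P.FullSubcategory) ⟶ X' := P.homMk (t ≫ c.ι)
      have ha : a ≫ f' = 0 := by
        ext1
        change (t ≫ c.ι) ≫ f = 0
        rw [Category.assoc, KernelFork.condition, comp_zero]
      have hb : (kernel.lift f' a ha).hom ≫ (kernel.ι f').hom = t ≫ c.ι :=
        congrArg (fun t => t.hom) (kernel.lift_ι f' a ha)
      have hb' : (kernel.lift f' a ha).hom ≫ κ = t := by
        rw [← cancel_mono c.ι, Category.assoc, hκ, hb]
      rw [comp_zero, ← hb', Category.assoc, hg, comp_zero]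
    have : IsIso κ := isIso_of_mono_of_epi κ
    exact P.prop_of_iso (asIso κ) (kernel f').property

instance preservesFiniteLimits_fp
    [(ObjectProperty.isFinitelyPresentable.{w} A).IsClosedUnderKernels] :
    PreservesFiniteLimits (ObjectProperty.isFinitelyPresentable.{w} A).ι := by
  have := fun {X Y} f => ObjectProperty.preservesKernels_ι
    (ObjectProperty.isFinitelyPresentable.{w} A) (X := X) (Y := Y) f
  exact Functor.preservesFiniteLimits_of_preservesKernels _

instance preservesFiniteColimits_fp
    [(ObjectProperty.isFinitelyPresentable.{w} A).IsClosedUnderKernels] :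
    PreservesFiniteColimits (ObjectProperty.isFinitelyPresentable.{w} A).ι := by
  have := fun {X Y} f => ObjectProperty.preservesCokernels_ι
    (ObjectProperty.isFinitelyPresentable.{w} A) (X := X) (Y := Y) f
  exact Functor.preservesFiniteColimits_of_preservesCokernels _

end FinitelyPresented

/-! ### Base extension of an essentially small category -/

section BaseExtension

variable (k : Type w) [Field k] (L : Type w) [Field L] [Algebra k L]
  (C : Type u) [Category.{v} C] [EssentiallySmall.{w} C] [Abelian C] [Linear k C]

/-- The category `(Ind C)_L` of `L`-objects of `Ind C`. -/
abbrev IndBase : Type (w + 1) := BObj k L (IndCat.{w} C)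

/-- The base extension `C_[L]`: the category of finitely presented objects of `(Ind C)_L`. -/
abbrev BaseExt : Type (w + 1) :=
  (ObjectProperty.isFinitelyPresentable.{w} (IndBase k L C)).FullSubcategory

/-- The finitely presented `L`-objects `L ⊗ c` for `c` in `C`. -/
def freeFamily : ObjectProperty (IndBase k L C) :=
  ObjectProperty.ofObj fun c : SmallModel.{w} C => (BObj.free k L (IndCat.{w} C)).obj (Ind.yoneda.obj c)

lemma freeFamily_isSeparating : (freeFamily k L C).IsSeparating := by
  intro X Y f g h
  apply BObj.hom_ext
  refine Ind.isSeparating_range_yoneda _ _ ?_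
  rintro _ ⟨c⟩ t
  let adj := BObj.freeAdjunction k L (IndCat.{w} C)
  let t' : Ind.yoneda.obj c ⟶ (BObj.forget k L (IndCat.{w} C)).obj X := t
  have h1 := congrArg (adj.homEquiv _ _) (h _ ⟨c⟩ ((adj.homEquiv _ _).symm t'))
  rw [adj.homEquiv_naturality_right, adj.homEquiv_naturality_right, Equiv.apply_symm_apply] at h1
  exact h1

lemma freeFamily_le :
    freeFamily k L C ≤ ObjectProperty.isFinitelyPresentable.{w} (IndBase k L C) := by
  rintro _ ⟨c⟩
  have := Cardinal.fact_isRegular_aleph0.{w}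
  have := isFinitelyPresentable_indYoneda c
  have : (BObj.forget k L (IndCat.{w} C)).IsCardinalAccessible Cardinal.aleph0.{w} :=
    Functor.isFinitelyAccessible_iff_preservesFilteredColimits.2
      ⟨fun J _ _ => inferInstance⟩
  exact (BObj.freeAdjunction k L (IndCat.{w} C)).isCardinalPresentable_leftAdjoint_obj
    Cardinal.aleph0.{w} (Ind.yoneda.obj c)

/-- Condition (E1): the category `C_[L]` is abelian for every field extension `L` of `k`. -/
class SatisfiesE1 : Prop where
  nonempty_abelian : ∀ (L : Type w) [Field L] [Algebra k L], Nonempty (Abelian (BaseExt k L C))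

instance [SatisfiesE1.{w} k C] :
    (ObjectProperty.isFinitelyPresentable.{w} (IndBase k L C)).IsClosedUnderKernels :=
  isClosedUnderKernels_of_abelian (freeFamily_isSeparating k L C) (freeFamily_le k L C)
    (SatisfiesE1.nonempty_abelian L)

instance : HasFiniteBiproducts (BaseExt k L C) := HasFiniteBiproducts.of_hasFiniteProducts

instance : HasBinaryBiproducts (BaseExt k L C) := hasBinaryBiproducts_of_finite_biproducts _

/-- Condition (E2): for every field extension `L` of `k`, every object of `C_[L]` is a direct sum
of indecomposable objects. -/
def SatisfiesE2 : Prop :=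
  ∀ (L : Type w) [Field L] [Algebra k L] (V : BaseExt k L C),
    ∃ (n : ℕ) (U : Fin n → BaseExt k L C),
      (∀ i, Indecomposable (U i)) ∧ Nonempty (V ≅ ⨁ U)

/-- `C` is of essential dimension `≤ d`: for every algebraically closed extension `L` of `k`, every
indecomposable object of `C_[L]` is isomorphic to `L ⊗_{L₀} V₀` for some intermediate field `L₀`
which is finitely generated and of transcendence degree `≤ d` over `k`, and some object `V₀` of
`C_[L₀]`. -/
def HasEssDimLE (d : ℕ) : Prop :=
  ∀ (L : Type w) [Field L] [Algebra k L] [IsAlgClosed L] (V : BaseExt k L C), Indecomposable V →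
    ∃ (L₀ : IntermediateField k L) (V₀ : BaseExt k L₀ C),
      L₀.FG ∧ Algebra.trdeg k L₀ ≤ d ∧
        Nonempty (V.obj ≅ (BObj.extendScalars k L₀ L (IndCat.{w} C)).obj V₀.obj)

/-- The essential dimension of `C`. -/
noncomputable def essDim : ℕ∞ := ⨅ (d : ℕ) (_ : HasEssDimLE.{w} k C d), (d : ℕ∞)

end BaseExtension

/-! ### Bounded derived categories -/

attribute [local instance] HasDerivedCategory.standard

section Derived

open DerivedCategory

section

variable (k : Type*) [CommRing k] (A : Type u) [Category.{v} A] [Abelian A] [Linear k A]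

instance (n : ℤ) : (HomologicalComplex.homologyFunctor A (ComplexShape.up ℤ) n).Linear k where
  map_smul f a := ShortComplex.homologyMap_smul
    (φ := (HomologicalComplex.shortComplexFunctor A (ComplexShape.up ℤ) n).map f) (a := a)

instance homologyFunctor_linear (n : ℤ) : (homologyFunctor A n).Linear k := by
  have : Localization.Lifting Q (HomologicalComplex.quasiIso A (ComplexShape.up ℤ))
      (HomologicalComplex.homologyFunctor A (ComplexShape.up ℤ) n) (homologyFunctor A n) :=
    ⟨homologyFunctorFactors A n⟩
  exact (Localization.functor_linear_iff Q (HomologicalComplex.quasiIso A (ComplexShape.up ℤ)) k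
    (HomologicalComplex.homologyFunctor A (ComplexShape.up ℤ) n) (homologyFunctor A n)).1
    inferInstance

variable (L : Type*) [CommRing L] [Algebra k L] [Linear L A] [∀ X Y : A, IsScalarTower k L (X ⟶ Y)]

lemma derivedCategory_algebraMap_smul_id (X : DerivedCategory A) (c : k) :
    algebraMap k L c • 𝟙 X = c • 𝟙 X := by
  let e := Q.objObjPreimageIso X
  have h1 : algebraMap k L c • 𝟙 (Q.objPreimage X) = c • 𝟙 (Q.objPreimage X) := by
    ext n
    exact algebraMap_smul L c (𝟙 _ : (Q.objPreimage X).X n ⟶ _)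
  have h2 : algebraMap k L c • 𝟙 (Q.obj (Q.objPreimage X)) =
      c • 𝟙 (Q.obj (Q.objPreimage X)) := by
    rw [← Q.map_id, ← Q.map_smul, ← Q.map_smul, h1]
  calc algebraMap k L c • 𝟙 X = e.inv ≫ (algebraMap k L c • 𝟙 _) ≫ e.hom := by simp
    _ = e.inv ≫ (c • 𝟙 _) ≫ e.hom := by rw [h2]
    _ = c • 𝟙 X := by simp

instance (X Y : DerivedCategory A) : IsScalarTower k L (X ⟶ Y) :=
  IsScalarTower.of_algebraMap_smul fun c f => by
    rw [← Category.id_comp f, ← Linear.smul_comp, derivedCategory_algebraMap_smul_id,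
      Linear.smul_comp]

instance (X Y : Bounded A) : IsScalarTower k L (X ⟶ Y) :=
  IsScalarTower.of_algebraMap_smul fun c f => ObjectProperty.hom_ext _ (algebraMap_smul L c f.hom)

end

section

variable {A : Type u} [Category.{v} A] [Abelian A] {A' : Type u'} [Category.{v'} A'] [Abelian A']
  (G : A ⥤ A') [G.Additive] [PreservesFiniteLimits G] [PreservesFiniteColimits G]

/-- An exact functor commutes with the homology of complexes. -/
noncomputable def mapComplexHomologyIso (n : ℤ) :
    G.mapHomologicalComplex (ComplexShape.up ℤ) ⋙
      HomologicalComplex.homologyFunctor A' (ComplexShape.up ℤ) n ≅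
    HomologicalComplex.homologyFunctor A (ComplexShape.up ℤ) n ⋙ G :=
  NatIso.ofComponents (fun K => (K.sc n).mapHomologyIso G)
    (fun f => ShortComplex.mapHomologyIso_hom_naturality
      ((HomologicalComplex.shortComplexFunctor A (ComplexShape.up ℤ) n).map f) G)

/-- The functor induced by an exact functor on derived categories commutes with cohomology. -/
noncomputable def mapDerivedHomologyIso (n : ℤ) :
    G.mapDerivedCategory ⋙ homologyFunctor A' n ≅ homologyFunctor A n ⋙ G :=
  letI : Localization.Lifting Q (HomologicalComplex.quasiIso A (ComplexShape.up ℤ))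
      (G.mapHomologicalComplex (ComplexShape.up ℤ) ⋙
        HomologicalComplex.homologyFunctor A' (ComplexShape.up ℤ) n)
      (G.mapDerivedCategory ⋙ homologyFunctor A' n) :=
    ⟨Functor.isoWhiskerRight G.mapDerivedCategoryFactors (homologyFunctor A' n) ≪≫
      Functor.isoWhiskerLeft (G.mapHomologicalComplex (ComplexShape.up ℤ))
        (homologyFunctorFactors A' n)⟩
  letI : Localization.Lifting Q (HomologicalComplex.quasiIso A (ComplexShape.up ℤ))
      (HomologicalComplex.homologyFunctor A (ComplexShape.up ℤ) n ⋙ G)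
      (homologyFunctor A n ⋙ G) :=
    ⟨Functor.isoWhiskerRight (homologyFunctorFactors A n) G⟩
  Localization.liftNatIso Q (HomologicalComplex.quasiIso A (ComplexShape.up ℤ)) _ _ _ _
    (mapComplexHomologyIso G n)

lemma bounded_mapDerivedCategory (X : Bounded A) :
    TStructure.t.bounded (G.mapDerivedCategory.obj X.obj) := by
  obtain ⟨⟨a, ha⟩, ⟨b, hb⟩⟩ := X.property
  exact ⟨⟨a, (isGE_iff _ _).2 fun i hi => ((G.map_isZero ((isGE_iff _ _).1 ha i hi))).of_iso
      ((mapDerivedHomologyIso G i).app X.obj)⟩,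
    ⟨b, (isLE_iff _ _).2 fun i hi => ((G.map_isZero ((isLE_iff _ _).1 hb i hi))).of_iso
      ((mapDerivedHomologyIso G i).app X.obj)⟩⟩

/-- The functor induced by an exact functor on bounded derived categories. -/
noncomputable def mapBounded : Bounded A ⥤ Bounded A' :=
  TStructure.t.bounded.lift (Bounded.ι ⋙ G.mapDerivedCategory) (bounded_mapDerivedCategory G)

instance : (mapBounded G).Additive where
  map_add {X Y f g} := ObjectProperty.hom_ext _ (by
    exact (Bounded.ι ⋙ G.mapDerivedCategory).map_add (f := f) (g := g))

instance (k : Type*) [CommRing k] [Linear k A] [Linear k A'] [G.Linear k] :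
    (mapBounded G).Linear k where
  map_smul {X Y} f c := ObjectProperty.hom_ext _ (by
    exact (Bounded.ι ⋙ G.mapDerivedCategory).map_smul (f := f) c)

end

end Derived

/-! ### The forgetful functor `[F]` -/

section Forgetful

open DerivedCategory

variable (k : Type w) [Field k] (L : Type w) [Field L] [Algebra k L]
  (C : Type u) [Category.{v} C] [EssentiallySmall.{w} C] [Abelian C] [Linear k C]

/-- The functor `C_[L] ⥤ Ind C` forgetting the action of `L`. -/
noncomputable abbrev forgetBase : BaseExt k L C ⥤ IndCat.{w} C :=
  ObjectProperty.ι _ ⋙ BObj.forget k L (IndCat.{w} C)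

/-- The objects of `D^b(Ind C)_L` all of whose cohomology objects, with the induced action of `L`,
lie in `C_[L]`. -/
def cohomologyInBase : ObjectProperty (BObj k L (Bounded (IndCat.{w} C))) := fun Z =>
  ∀ n : ℤ, ObjectProperty.isFinitelyPresentable.{w} (IndBase k L C)
    ((BObj.map L (Bounded.ι ⋙ homologyFunctor (IndCat.{w} C) n)).obj Z)

/-- The category `D^b(C)_[L]`. -/
abbrev DerivedBaseExt : Type _ := (cohomologyInBase k L C).FullSubcategory

variable [SatisfiesE1.{w} k C]

instance (X Y : BaseExt k L C) : IsScalarTower k L (X ⟶ Y) :=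
  IsScalarTower.of_algebraMap_smul fun c f => ObjectProperty.hom_ext _ (algebraMap_smul L c f.hom)

/-- The forgetful functor `D^b(C_[L]) ⥤ D^b(Ind C)_L`: the underlying functor
`D^b(C_[L]) ⥤ D^b(Ind C)` is induced by the exact forgetful functor `C_[L] ⥤ Ind C`, and
`L` acts through the `L`-linear structure of `D^b(C_[L])`. -/
noncomputable def derivedForget : Bounded (BaseExt k L C) ⥤ BObj k L (Bounded (IndCat.{w} C)) :=
  BObj.tautological k L (Bounded (BaseExt k L C)) ⋙ BObj.map L (mapBounded (forgetBase k L C))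

/-- The cohomology of the image of `Z` is the cohomology of `Z`. -/
noncomputable def derivedForgetHomologyIso (Z : Bounded (BaseExt k L C)) (n : ℤ) :
    (BObj.map L (Bounded.ι ⋙ homologyFunctor (IndCat.{w} C) n)).obj
      ((derivedForget k L C).obj Z) ≅ ((homologyFunctor (BaseExt k L C) n).obj Z.obj).obj :=
  BObj.isoMk ((mapDerivedHomologyIso (forgetBase k L C) n).app Z.obj) (fun b => by
    have h1 := (mapDerivedHomologyIso (forgetBase k L C) n).hom.naturality (b • 𝟙 Z.obj)
    refine h1.trans (congrArg (fun t => _ ≫ t) ?_)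
    have h2 : (homologyFunctor (BaseExt k L C) n).map (b • 𝟙 Z.obj) = b • 𝟙 _ := by
      rw [Functor.map_smul, CategoryTheory.Functor.map_id]
    refine (congrArg (forgetBase k L C).map h2).trans ?_
    exact Category.id_comp _)

/-- The forgetful functor `[F] : D^b(C_[L]) ⥤ D^b(C)_[L]`. -/
noncomputable def bracketF : Bounded (BaseExt k L C) ⥤ DerivedBaseExt k L C :=
  (cohomologyInBase k L C).lift (derivedForget k L C) fun Z n =>
    ObjectProperty.prop_of_iso _ (derivedForgetHomologyIso k L C Z n).symm
      ((homologyFunctor (BaseExt k L C) n).obj Z.obj).property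

end Forgetful

/-- An abelian category is hereditary if it has global dimension at most one, that is, if all
groups `Ext^i` with `i ≥ 2` vanish. -/
def IsHereditary (A : Type u) [Category.{v} A] [Abelian A] : Prop :=
  ∀ X : A, HasProjectiveDimensionLE X 1

/-! The proof is relative homological algebra for the adjunction between `L ⊗ -` and the functor
forgetting the action of `L`. An `L`-object `V` is relatively projective if the action map `L ⊗ V ⟶
V` has an `L`-linear section. The kernel of the action map is the relative syzygy of `V`, and
iterating it defines the relative projective dimension; the sequences that occur split once the
action is forgotten.

Essential dimension bounds this dimension. Let `V = L ⊗_K V₀` with `K` finitely generated over `k`.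
An object `L ⊗_k V₀` is relatively projective. Adjoining an algebraic generator to `K` costs
nothing: in characteristic zero the extension is separable, so `L ⊗_{K(x)} V₀` is a retract of `L
⊗_K V₀`. A transcendental generator `t` costs one, through the resolution of `L ⊗_{K(t)} V₀` by two
copies of `L ⊗_K V₀` with differential `1 ⊗ t - t ⊗ 1`. Hence the dimension is at most the
transcendence degree (`relPD_of_isExtension`). A general `L` is treated by passing to its algebraic
closure and restricting back (`relPD_of_hasEssDimLE`).

The functor `[F]` factors through the derived category of `(Ind C)_L`. On the first factor, every
epimorphism onto a finitely presented object is refined by one with finitely presented source, so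
`Ext`-groups agree, and `D^b(C_[L])` is identified with the bounded complexes whose cohomology is
finitely presented (`RefinesEpis.mapBijective`, `RefinesEpis.exists_iso`).

The second factor is `dLift`, from `D((Ind C)_L)` to `L`-objects of `D(Ind C)`. Coproducts being
exact, the underlying object of `L ⊗ W` is a coproduct of copies of `W` in the derived category as
well, so `L ⊗ W` is sent to the free `L`-object on `W`. Therefore `dLift` is bijective on morphisms
out of relatively projective objects. Heredity realizes each cohomology object by a morphism from a
complex in one degree; consequently bounded `L`-objects with relatively projective cohomology lift
(`exists_relProj_dLift_iso`), and a bounded complex with relatively projective cohomology is itself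
relatively projective.

From there each property allows one more dimension. Faithfulness holds when the source has
cohomology of dimension `0`. If that dimension is at most `1`, the fibre of `L ⊗ X ⟶ X` is
relatively projective: a morphism out of `X` is lifted on `L ⊗ X`, its lift vanishes on the fibre by
faithfulness, and so it descends to `X`; this is fullness (`exists_dLift_map_of_relPD_one`). If `Z`
has cohomology of dimension at most `2`, the kernel of `L ⊗ Z ⟶ Z` lifts by induction and its
inclusion lifts by fullness; the cone of the lifted inclusion is a lift of `Z`
(`exists_dLift_iso_of_relPD`). -/

/-! ### Relative projective dimension with respect to an adjunction -/

namespace CategoryTheory.Adjunction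

section

variable {A : Type u} [Category.{v} A] {B : Type u'} [Category.{v'} B]
  {G : B ⥤ A} {F : A ⥤ B} (adj : G ⊣ F)

/-- An object `V` is relatively projective with respect to `G ⊣ F` if the counit
`G (F V) ⟶ V` is a split epimorphism. -/
def RelProj (V : A) : Prop := ∃ s : V ⟶ G.obj (F.obj V), s ≫ adj.counit.app V = 𝟙 V

lemma relProj_obj (W : B) : adj.RelProj (G.obj W) :=
  ⟨G.map (adj.unit.app W), adj.left_triangle_components W⟩

lemma RelProj.of_retract {adj : G ⊣ F} {V V' : A} (h : adj.RelProj V') (a : V ⟶ V') (b : V' ⟶ V)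
    (hab : a ≫ b = 𝟙 V) : adj.RelProj V := by
  obtain ⟨s, hs⟩ := h
  refine ⟨a ≫ s ≫ G.map (F.map b), ?_⟩
  have := adj.counit.naturality b
  dsimp at this
  rw [Category.assoc, Category.assoc, this, reassoc_of% hs, hab]

/-- Naturality of the counit turns sections for the `U i` into the section `∑ a i ≫ s i ≫ G (F (b
i))`. Only a decomposition of the identity is required, without orthogonality, so retracts and
finite direct sums are both covered. -/
lemma RelProj.of_sum [Preadditive A] {adj : G ⊣ F} {V : A} {ι : Type*} [Fintype ι] {U : ι → A}
    (h : ∀ i, adj.RelProj (U i)) (a : ∀ i, V ⟶ U i) (b : ∀ i, U i ⟶ V)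
    (hab : ∑ i, a i ≫ b i = 𝟙 V) : adj.RelProj V := by
  choose s hs using h
  refine ⟨∑ i, a i ≫ s i ≫ G.map (F.map (b i)), ?_⟩
  rw [Preadditive.sum_comp, ← hab]
  refine Finset.sum_congr rfl fun i _ => ?_
  have := adj.counit.naturality (b i)
  dsimp at this
  rw [Category.assoc, Category.assoc, this, reassoc_of% (hs i)]

end

section

variable {A : Type u} [Category.{v} A] [Preadditive A] {B : Type u'} [Category.{v'} B]
  [Preadditive B]

/-- A composable pair of morphisms of `A`, with zero composition, which becomes a split short exact
sequence after applying `F`. -/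
structure RelSplitting (F : A ⥤ B) {K P V : A} (f : K ⟶ P) (g : P ⟶ V) where
  /-- the retraction of the first morphism -/
  r : F.obj P ⟶ F.obj K
  /-- the section of the second morphism -/
  s : F.obj V ⟶ F.obj P
  w : f ≫ g = 0
  f_r : F.map f ≫ r = 𝟙 _
  s_g : s ≫ F.map g = 𝟙 _
  id : r ≫ F.map f + F.map g ≫ s = 𝟙 _

end

section

variable {A : Type u} [Category.{v} A] [Abelian A] {B : Type u'} [Category.{v'} B] [Abelian B]
  {G : B ⥤ A} {F : A ⥤ B} (adj : G ⊣ F)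

set_option linter.unusedSectionVars false

/-- The relative syzygy of `V`: the kernel of the counit `G (F V) ⟶ V`. -/
noncomputable def syzygy (V : A) : A := kernel (adj.counit.app V)

/-- The inclusion of the relative syzygy. -/
noncomputable def syzygyι (V : A) : adj.syzygy V ⟶ G.obj (F.obj V) := kernel.ι _

instance (V : A) : Mono (adj.syzygyι V) := inferInstanceAs (Mono (kernel.ι _))

@[simp]
lemma syzygyι_counit (V : A) : adj.syzygyι V ≫ adj.counit.app V = 0 := kernel.condition _

/-- Morphisms to the relative syzygy. -/
noncomputable def syzygyLift {V X : A} (f : X ⟶ G.obj (F.obj V)) (hf : f ≫ adj.counit.app V = 0) :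
    X ⟶ adj.syzygy V := kernel.lift _ f hf

@[simp]
lemma syzygyLift_ι {V X : A} (f : X ⟶ G.obj (F.obj V)) (hf : f ≫ adj.counit.app V = 0) :
    adj.syzygyLift f hf ≫ adj.syzygyι V = f := kernel.lift_ι _ f hf

/-- The functoriality of the relative syzygy. -/
noncomputable def syzygyMap {V V' : A} (f : V ⟶ V') : adj.syzygy V ⟶ adj.syzygy V' :=
  adj.syzygyLift (adj.syzygyι V ≫ G.map (F.map f)) (by
    have := adj.counit.naturality f
    dsimp at this
    rw [Category.assoc, this, reassoc_of% adj.syzygyι_counit V, zero_comp])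

@[simp]
lemma syzygyMap_ι {V V' : A} (f : V ⟶ V') :
    adj.syzygyMap f ≫ adj.syzygyι V' = adj.syzygyι V ≫ G.map (F.map f) :=
  adj.syzygyLift_ι _ _

lemma syzygyMap_id (V : A) : adj.syzygyMap (𝟙 V) = 𝟙 _ := by
  rw [← cancel_mono (adj.syzygyι V)]; simp

lemma syzygyMap_comp {V V' V'' : A} (f : V ⟶ V') (g : V' ⟶ V'') :
    adj.syzygyMap (f ≫ g) = adj.syzygyMap f ≫ adj.syzygyMap g := by
  rw [← cancel_mono (adj.syzygyι V'')]; simp [reassoc_of% adj.syzygyMap_ι f]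

lemma syzygyMap_sum [F.Additive] [G.Additive] {V V' : A} {ι : Type*} [Fintype ι]
    (f : ι → (V ⟶ V')) : adj.syzygyMap (∑ i, f i) = ∑ i, adj.syzygyMap (f i) := by
  rw [← cancel_mono (adj.syzygyι V')]
  simp [Preadditive.sum_comp, Preadditive.comp_sum, Functor.map_sum]

lemma syzygyMap_zero [F.Additive] [G.Additive] (V V' : A) :
    adj.syzygyMap (0 : V ⟶ V') = 0 := by
  rw [← cancel_mono (adj.syzygyι V')]
  simp

/-- The relative projective dimension is at most `n`. -/
def RelPD : ℕ → A → Prop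
  | 0, V => adj.RelProj V
  | n + 1, V => RelPD n (adj.syzygy V)

variable {adj}

/-- The relative syzygy is an additive functor, so a decomposition of `𝟙 V` through the `U i`
induces one of the identity of the syzygy. -/
lemma RelPD.of_sum [F.Additive] [G.Additive] {n : ℕ} {V : A} {ι : Type*} [Fintype ι] {U : ι → A}
    (h : ∀ i, adj.RelPD n (U i)) (a : ∀ i, V ⟶ U i) (b : ∀ i, U i ⟶ V)
    (hab : ∑ i, a i ≫ b i = 𝟙 V) : adj.RelPD n V := by
  induction n generalizing V U with
  | zero => exact RelProj.of_sum h a b hab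
  | succ n ih =>
    refine ih (U := fun i => adj.syzygy (U i)) h (fun i => adj.syzygyMap (a i))
      (fun i => adj.syzygyMap (b i)) ?_
    simp only [← syzygyMap_comp, ← syzygyMap_sum, hab, syzygyMap_id]

lemma RelPD.of_retract [F.Additive] [G.Additive] {n : ℕ} {V V' : A} (h : adj.RelPD n V')
    (a : V ⟶ V') (b : V' ⟶ V) (hab : a ≫ b = 𝟙 V) : adj.RelPD n V :=
  .of_sum (ι := Unit) (fun _ => h) (fun _ => a) (fun _ => b) (by simpa using hab)

lemma RelPD.of_iso [F.Additive] [G.Additive] {n : ℕ} {V V' : A} (h : adj.RelPD n V')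
    (e : V ≅ V') : adj.RelPD n V :=
  h.of_retract e.hom e.inv e.hom_inv_id

/-- If `s` splits the counit, the projector `𝟙 - counit ≫ s` exhibits the syzygy as a retract of `G
(F V)`. -/
lemma RelProj.syzygy {V : A} (h : adj.RelProj V) : adj.RelProj (adj.syzygy V) := by
  obtain ⟨s, hs⟩ := h
  refine RelProj.of_retract (adj.relProj_obj (F.obj V)) (adj.syzygyι V)
    (adj.syzygyLift (𝟙 _ - adj.counit.app V ≫ s) (by simp [hs])) ?_
  rw [← cancel_mono (adj.syzygyι V)]
  simp [Preadditive.comp_sub, reassoc_of% adj.syzygyι_counit V]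

lemma RelPD.succ {n : ℕ} {V : A} (h : adj.RelPD n V) : adj.RelPD (n + 1) V := by
  induction n generalizing V with
  | zero => exact RelProj.syzygy h
  | succ n ih => exact ih (V := adj.syzygy V) h

lemma RelPD.mono {m n : ℕ} (hmn : m ≤ n) {V : A} (h : adj.RelPD m V) : adj.RelPD n V := by
  induction hmn with
  | refl => exact h
  | step _ ih => exact ih.succ

lemma RelPD.of_relProj {n : ℕ} {V : A} (h : adj.RelProj V) : adj.RelPD n V :=
  RelPD.mono (Nat.zero_le n) h

variable (adj)

/-- The retraction of `F (syzygyι V)`. -/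
noncomputable def syzygyRetraction [PreservesFiniteLimits F] [F.Additive] (V : A) :
    F.obj (G.obj (F.obj V)) ⟶ F.obj (adj.syzygy V) :=
  (KernelFork.mapIsLimit _ (kernelIsKernel (adj.counit.app V)) F).lift
    -- The unit splits `F (counit)`; the complementary idempotent factors through `F` of the kernel
    -- because `F` preserves that kernel.
    (KernelFork.ofι (𝟙 _ - F.map (adj.counit.app V) ≫ adj.unit.app (F.obj V)) (by
      simp [Preadditive.sub_comp]))

section

variable [PreservesFiniteLimits F] [F.Additive]

@[simp]
lemma syzygyRetraction_ι (V : A) : adj.syzygyRetraction V ≫ F.map (adj.syzygyι V) =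
    𝟙 _ - F.map (adj.counit.app V) ≫ adj.unit.app (F.obj V) :=
  (KernelFork.mapIsLimit _ (kernelIsKernel (adj.counit.app V)) F).fac _
    WalkingParallelPair.zero

@[simp]
lemma syzygyι_retraction (V : A) :
    F.map (adj.syzygyι V) ≫ adj.syzygyRetraction V = 𝟙 _ := by
  rw [← cancel_mono (F.map (adj.syzygyι V))]
  simp [Preadditive.comp_sub, ← Functor.map_comp_assoc]

/-- The splittings of the syzygy sequences after `F` are natural in `V`, since they are built from
the unit and the counit only. -/
lemma syzygyRetraction_naturality {V V' : A} (f : V ⟶ V') :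
    adj.syzygyRetraction V ≫ F.map (adj.syzygyMap f) =
      F.map (G.map (F.map f)) ≫ adj.syzygyRetraction V' := by
  rw [← cancel_mono (F.map (adj.syzygyι V'))]
  have h1 := adj.counit.naturality f
  have h2 := adj.unit.naturality (F.map f)
  dsimp at h1 h2
  rw [Category.assoc, Category.assoc, ← F.map_comp, syzygyMap_ι, syzygyRetraction_ι, F.map_comp,
    reassoc_of% adj.syzygyRetraction_ι V, Preadditive.sub_comp, Preadditive.comp_sub,
    Category.assoc, ← h2, ← F.map_comp_assoc, ← F.map_comp_assoc, h1]
  simp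

end

namespace RelSplitting

variable {K P V : A} {f : K ⟶ P} {g : P ⟶ V}

/-- The relative syzygies of a sequence which splits after applying `F` have the same property. -/
noncomputable def syzygy {adj : G ⊣ F} [PreservesFiniteLimits F] [F.Additive] [G.Additive]
    (σ : RelSplitting F f g) :
    RelSplitting F (adj.syzygyMap f) (adj.syzygyMap g) where
  -- `G σ.r` need not be compatible with the counits, so it does not restrict to the syzygies; it is
  -- compressed to them by the inclusion and the retraction that exist after applying `F`.
  r := F.map (adj.syzygyι _) ≫ F.map (G.map σ.r) ≫ adj.syzygyRetraction _
  s := F.map (adj.syzygyι _) ≫ F.map (G.map σ.s) ≫ adj.syzygyRetraction _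
  w := by rw [← syzygyMap_comp, σ.w, syzygyMap_zero]
  f_r := by
    rw [← F.map_comp_assoc, syzygyMap_ι, F.map_comp_assoc, ← F.map_comp_assoc (G.map (F.map f)),
      ← G.map_comp, σ.f_r]
    simp
  s_g := by
    rw [Category.assoc, Category.assoc, syzygyRetraction_naturality, ← F.map_comp_assoc (G.map σ.s),
      ← G.map_comp, σ.s_g]
    simp
  id := by
    have h : F.map (G.map σ.r) ≫ F.map (G.map (F.map f)) +
        F.map (G.map (F.map g)) ≫ F.map (G.map σ.s) = 𝟙 _ := by
      simp only [← F.map_comp, ← G.map_comp, ← F.map_add, ← G.map_add, σ.id, G.map_id, F.map_id]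
    rw [Category.assoc, Category.assoc, syzygyRetraction_naturality, ← F.map_comp_assoc
      (adj.syzygyMap g), syzygyMap_ι, F.map_comp_assoc, ← Preadditive.comp_add,
      ← Category.assoc (F.map (G.map σ.r)), ← Category.assoc (F.map (G.map (F.map g))),
      ← Preadditive.add_comp, h]
    simp

variable [PreservesFiniteLimits F] [PreservesFiniteColimits F] [F.Additive] [F.Faithful]

/-- A split sequence is exact, and a faithful exact functor reflects exactness, monomorphisms and
epimorphisms. -/
lemma shortExact (σ : RelSplitting F f g) : (ShortComplex.mk f g σ.w).ShortExact := by
  let τ : ((ShortComplex.mk f g σ.w).map F).Splitting :=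
    { r := σ.r, s := σ.s, f_r := σ.f_r, s_g := σ.s_g, id := σ.id }
  have h := τ.shortExact
  have h1 : Mono (F.map f) := h.mono_f
  have h2 : Epi (F.map g) := h.epi_g
  exact { exact := (ShortComplex.exact_map_iff_of_faithful _ F).1 h.exact
          mono_f := F.mono_of_mono_map h1
          epi_g := F.epi_of_epi_map h2 }

/-- A relative version of Schanuel's lemma. -/
lemma exists_schanuel {adj : G ⊣ F} (σ : RelSplitting F f g) (h₂ : adj.RelProj P) :
    ∃ (a : adj.syzygy V ⟶ K) (b : K ⟶ adj.syzygy V) (c : G.obj (F.obj V) ⟶ adj.syzygy V),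
      a ≫ b + adj.syzygyι V ≫ c = 𝟙 _ := by
  have hS := σ.shortExact
  obtain ⟨s, hs⟩ := h₂
  have hmono : Mono f := hS.mono_f
  -- Relative projectivity of `P` lifts `g` along the counit. Conversely, `G (F V)` being free, the
  -- section `σ.s` of `F g` transposes to a lift `h` of the counit along `g`.
  obtain ⟨g', hg'⟩ : ∃ g' : P ⟶ G.obj (F.obj V), g' ≫ adj.counit.app V = g := by
    refine ⟨s ≫ G.map (F.map g), ?_⟩
    have := adj.counit.naturality g
    dsimp at this
    rw [Category.assoc, this, reassoc_of% hs]
  obtain ⟨h, hh⟩ : ∃ h : G.obj (F.obj V) ⟶ P, h ≫ g = adj.counit.app V := by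
    refine ⟨G.map σ.s ≫ adj.counit.app P, ?_⟩
    have h1 := adj.counit.naturality g
    dsimp at h1
    rw [Category.assoc, ← h1, ← G.map_comp_assoc, σ.s_g, G.map_id, Category.id_comp]
  obtain ⟨a, ha⟩ : ∃ a : adj.syzygy V ⟶ K, a ≫ f = adj.syzygyι V ≫ h :=
    ⟨_, hS.exact.lift_f (adj.syzygyι V ≫ h) (by simp [hh])⟩
  -- Instead of the isomorphism of the usual Schanuel lemma, only a retraction is produced: after
  -- inclusion into `G (F V)`, the path through `K` contributes `h ≫ g'` and the path through `G (F
  -- V)` contributes `𝟙 - h ≫ g'`.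
  refine ⟨a, adj.syzygyLift (f ≫ g') (by simp [hg', σ.w]), adj.syzygyLift (𝟙 _ - h ≫ g') (by
    simp [Preadditive.sub_comp, hg', hh]), ?_⟩
  rw [← cancel_mono (adj.syzygyι _)]
  simp [Preadditive.add_comp, Preadditive.comp_sub, reassoc_of% ha]

end RelSplitting

variable {adj} [PreservesFiniteLimits F] [PreservesFiniteColimits F] [F.Additive] [G.Additive]
  [F.Faithful] {K P V : A} {f : K ⟶ P} {g : P ⟶ V}

/-- By the relative Schanuel lemma the syzygy of `V` is a retract of the sum of `K` and the
relatively projective `G (F V)`. -/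
lemma RelPD.of_relProj_of_splitting {n : ℕ} (σ : RelSplitting F f g)
    (h₁ : adj.RelPD n K) (h₂ : adj.RelProj P) : adj.RelPD (n + 1) V := by
  obtain ⟨a, b, c, h⟩ := σ.exists_schanuel h₂
  refine RelPD.of_sum (n := n) (V := adj.syzygy V) (ι := Bool)
    (U := fun i => match i with | true => K | false => G.obj (F.obj V)) ?_
    (fun i => match i with | true => a | false => adj.syzygyι V)
    (fun i => match i with | true => b | false => c) ?_
  · rintro (_ | _)
    · exact .of_relProj (adj.relProj_obj _)
    · exact h₁
  · simpa using h

/-- Dimension shifting: the syzygies of the three terms again form a sequence that splits after `F`,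
which lowers `n` until `P` is relatively projective. -/
lemma RelPD.of_splitting {n : ℕ} (σ : RelSplitting F f g)
    (h₁ : adj.RelPD n K) (h₂ : adj.RelPD n P) : adj.RelPD (n + 1) V := by
  induction n generalizing K P V with
  | zero => exact .of_relProj_of_splitting σ h₁ h₂
  | succ n ih => exact ih σ.syzygy h₁ h₂

end

end CategoryTheory.Adjunction

/-! ### Tensor products of fields -/

section FieldTensor

open TensorProduct Polynomial

variable {K K' L : Type*} [Field K] [Field K'] [Field L] [Algebra K K'] [Algebra K L]

lemma one_tmul_aeval (t : K') (q : K[X]) : (1 : L) ⊗ₜ[K] (aeval t q) =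
    aeval ((1 : L) ⊗ₜ[K] t) (q.map (algebraMap K L)) := by
  rw [aeval_map_algebraMap]
  exact (Polynomial.aeval_algHom_apply
    (Algebra.TensorProduct.includeRight : K' →ₐ[K] L ⊗[K] K') t q).symm

/-- Every element of `L ⊗ K(t)` becomes a polynomial in `1 ⊗ t` after clearing denominators. -/
lemma exists_tmul_mul_eq_aeval {t : K'} (ht : IntermediateField.adjoin K {t} = ⊤)
    (z : L ⊗[K] K') :
    ∃ (q : K[X]) (p : L[X]), aeval t q ≠ 0 ∧
      ((1 : L) ⊗ₜ[K] aeval t q) * z = aeval ((1 : L) ⊗ₜ[K] t) p := by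
  induction z using TensorProduct.induction_on with
  | zero => exact ⟨1, 0, by simp, by simp⟩
  | tmul l x =>
    have hx : x ∈ IntermediateField.adjoin K {t} := ht ▸ IntermediateField.mem_top
    obtain ⟨r, s, rfl⟩ := (IntermediateField.mem_adjoin_simple_iff K x).1 hx
    -- A vanishing denominator means `x = 0`, by the convention on division by zero.
    by_cases hs : aeval t s = 0
    · exact ⟨1, 0, by simp, by simp [hs]⟩
    · refine ⟨s, C l * r.map (algebraMap K L), hs, ?_⟩
      rw [Algebra.TensorProduct.tmul_mul_tmul, one_mul, mul_div_cancel₀ _ hs, map_mul,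
        ← one_tmul_aeval, aeval_C, Algebra.TensorProduct.algebraMap_apply,
        Algebra.TensorProduct.tmul_mul_tmul, one_mul, Algebra.algebraMap_self_apply, mul_one]
  | add a b ha hb =>
    obtain ⟨q, p, hq, h⟩ := ha
    obtain ⟨q', p', hq', h'⟩ := hb
    refine ⟨q * q', q'.map (algebraMap K L) * p + q.map (algebraMap K L) * p', ?_, ?_⟩
    · rw [map_mul]; exact mul_ne_zero hq hq'
    · rw [one_tmul_aeval] at h h' ⊢
      rw [map_add, map_mul, map_mul, ← h, ← h', Polynomial.map_mul, map_mul]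
      ring

/-- The powers of `t` are linearly independent over `K`, and stay so over `L` after base change. -/
lemma aeval_one_tmul_injective {t : K'} (ht : Transcendental K t) :
    Function.Injective (aeval (R := L) ((1 : L) ⊗ₜ[K] t)) := by
  have h1 : LinearIndependent K (fun n : ℕ => t ^ n) := by
    have := (Polynomial.basisMonomials K).linearIndependent.map'
      (aeval t : K[X] →ₐ[K] K').toLinearMap
      (LinearMap.ker_eq_bot.2 (transcendental_iff_injective.1 ht))
    simpa [Function.comp_def, Polynomial.aeval_monomial] using this
  have h2 := Module.Flat.linearIndependent_one_tmul (S := L) h1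
  rw [injective_iff_map_eq_zero]
  intro p hp
  rw [aeval_eq_sum_range] at hp
  ext n
  by_cases hn : n ∈ Finset.range (p.natDegree + 1)
  · refine linearIndependent_iff'.1 h2 _ p.coeff ?_ n hn
    simpa using hp
  · exact coeff_eq_zero_of_natDegree_lt (by simpa using hn)

/-- If `t` is transcendental, then `t ⊗ 1 - 1 ⊗ t` is a non zero divisor in `L ⊗ K(t)`. -/
lemma eq_zero_of_tmul_sub_mul_eq_zero {t : K'} (ht : Transcendental K t)
    (ht' : IntermediateField.adjoin K {t} = ⊤) (l : L) (z : L ⊗[K] K')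
    (hz : (l ⊗ₜ[K] (1 : K') - (1 : L) ⊗ₜ[K] t) * z = 0) : z = 0 := by
  obtain ⟨q, p, hq, h⟩ := exists_tmul_mul_eq_aeval ht' z
  have hu : IsUnit ((1 : L) ⊗ₜ[K] aeval t q) :=
    (IsUnit.mk0 _ hq).map (Algebra.TensorProduct.includeRight : K' →ₐ[K] L ⊗[K] K')
  -- After clearing denominators the relation comes from `L[X]`, a domain in which `l - X` is
  -- nonzero.
  have h1 : aeval ((1 : L) ⊗ₜ[K] t) ((C l - X) * p) = 0 := by
    rw [map_mul, ← h, mul_left_comm, map_sub, aeval_C, aeval_X,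
      Algebra.TensorProduct.algebraMap_apply, Algebra.algebraMap_self_apply, hz, mul_zero]
  have h2 := (map_eq_zero_iff _ (aeval_one_tmul_injective ht)).1 h1
  have h3 : (C l - X : L[X]) ≠ 0 := fun h => Polynomial.X_sub_C_ne_zero l (by
    rw [← neg_sub, h, neg_zero])
  have h4 : p = 0 := (mul_eq_zero.1 h2).resolve_left h3
  rw [h4, map_zero] at h
  exact (hu.mul_right_eq_zero).1 h

end FieldTensor

/-! ### The Koszul resolution of `L` over `K(t) ⊗ L` -/

section Koszul

open TensorProduct

set_option linter.unusedSectionVars false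

variable (K : Type*) {K' : Type*} (L : Type*) [Field K] [Field K'] [Field L] [Algebra K K']
  [Algebra K L] [Algebra K' L] [IsScalarTower K K' L]

/-- The multiplication `K' ⊗ L ⟶ L`, as a `K'`-linear map. -/
noncomputable def tensorMul (K' : Type*) [Field K'] [Algebra K K'] [Algebra K' L]
    [IsScalarTower K K' L] : K' ⊗[K] L →ₗ[K'] L :=
  (Algebra.TensorProduct.lift (Algebra.ofId K' L) (IsScalarTower.toAlgHom K L L)
    (fun _ _ => mul_comm _ _)).toLinearMap

@[simp] lemma tensorMul_tmul (x : K') (l : L) :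
    tensorMul K L K' (x ⊗ₜ l) = algebraMap K' L x * l := by
  exact (Algebra.TensorProduct.lift_tmul (Algebra.ofId K' L) (IsScalarTower.toAlgHom K L L)
    (fun _ _ => mul_comm _ _) x l).trans rfl

/-- The element `1 ⊗ t - t ⊗ 1` of `K' ⊗ L`. -/
noncomputable def koszulElt (t : K') : K' ⊗[K] L := 1 ⊗ₜ algebraMap K' L t - t ⊗ₜ 1

variable {K L}

/-- The elements `x` for which `1 ⊗ x - x ⊗ 1` is divisible by `1 ⊗ t - t ⊗ 1` form a subfield of
`K'` that contains `K` and `t`. -/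
lemma exists_koszulElt_mul {t : K'} (ht : IntermediateField.adjoin K {t} = ⊤) (x : K') :
    ∃ z : K' ⊗[K] L, koszulElt K L t * z = 1 ⊗ₜ algebraMap K' L x - x ⊗ₜ 1 := by
  have hx : x ∈ IntermediateField.adjoin K {t} := ht ▸ IntermediateField.mem_top
  induction hx using IntermediateField.adjoin_induction with
  | mem y hy =>
    obtain rfl : y = t := hy
    exact ⟨1, mul_one _⟩
  | algebraMap c =>
    refine ⟨0, ?_⟩
    rw [mul_zero, ← IsScalarTower.algebraMap_apply, Algebra.algebraMap_eq_smul_one,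
      Algebra.algebraMap_eq_smul_one, TensorProduct.smul_tmul, sub_self]
  | add a b _ _ ha hb =>
    obtain ⟨z, hz⟩ := ha
    obtain ⟨z', hz'⟩ := hb
    exact ⟨z + z', by rw [mul_add, hz, hz', map_add, tmul_add, add_tmul]; ring⟩
  | mul a b _ _ ha hb =>
    obtain ⟨z, hz⟩ := ha
    obtain ⟨z', hz'⟩ := hb
    refine ⟨z * (1 ⊗ₜ algebraMap K' L b) + (a ⊗ₜ 1) * z', ?_⟩
    rw [mul_add, ← mul_assoc, hz, mul_left_comm, hz', sub_mul, mul_sub]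
    simp
  | inv a _ ha =>
    obtain ⟨z, hz⟩ := ha
    by_cases h0 : a = 0
    · exact ⟨0, by simp [h0]⟩
    -- This is the identity `1 ⊗ a⁻¹ - a⁻¹ ⊗ 1 = -(a⁻¹ ⊗ a⁻¹)(1 ⊗ a - a ⊗ 1)`.
    · refine ⟨-(a⁻¹ ⊗ₜ algebraMap K' L a⁻¹) * z, ?_⟩
      have h0' : algebraMap K' L a ≠ 0 := by simpa using h0
      rw [mul_left_comm, hz, neg_mul, mul_sub]
      simp [h0, h0']

/-- Modulo the ideal generated by `1 ⊗ t - t ⊗ 1`, every `z` is congruent to `1 ⊗ μ(z)` with `μ` the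
multiplication; hence this ideal contains the kernel of `μ`. -/
lemma exists_koszulElt_mul_of_tensorMul_eq_zero {t : K'}
    (ht : IntermediateField.adjoin K {t} = ⊤) (z : K' ⊗[K] L) (hz : tensorMul K L K' z = 0) :
    ∃ z', koszulElt K L t * z' = z := by
  have h : ∀ z : K' ⊗[K] L, ∃ z', koszulElt K L t * z' = 1 ⊗ₜ tensorMul K L K' z - z := by
    intro z
    induction z using TensorProduct.induction_on with
    | zero => exact ⟨0, by simp⟩
    | tmul x l =>
      obtain ⟨z', hz'⟩ := exists_koszulElt_mul (L := L) ht x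
      exact ⟨z' * (1 ⊗ₜ l), by rw [← mul_assoc, hz', sub_mul]; simp⟩
    | add a b ha hb =>
      obtain ⟨z, hz⟩ := ha
      obtain ⟨z', hz'⟩ := hb
      exact ⟨z + z', by rw [mul_add, hz, hz', map_add, tmul_add]; ring⟩
  obtain ⟨z', hz'⟩ := h z
  exact ⟨-z', by rw [mul_neg, hz', hz]; simp⟩

/-- Exchanging the two factors reduces this to the non zero divisor `t ⊗ 1 - 1 ⊗ t` of `L ⊗ K(t)`.
-/
lemma koszulElt_mul_injective {t : K'} (ht : Transcendental K t)
    (ht' : IntermediateField.adjoin K {t} = ⊤) :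
    Function.Injective (LinearMap.mulLeft K' (koszulElt K L t)) := by
  rw [← LinearMap.ker_eq_bot, LinearMap.ker_eq_bot']
  intro z hz
  let e := Algebra.TensorProduct.comm K K' L
  have h1 : e (koszulElt K L t * z) = 0 := by
    rw [show koszulElt K L t * z = 0 from hz, map_zero]
  rw [map_mul] at h1
  have h2 : e (koszulElt K L t) = algebraMap K' L t ⊗ₜ 1 - 1 ⊗ₜ t := by
    simp [koszulElt, e]
  rw [h2] at h1
  exact (map_eq_zero_iff e e.injective).1 (eq_zero_of_tmul_sub_mul_eq_zero ht ht' _ _ h1)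

/-- The sequence `0 ⟶ K' ⊗ L ⟶ K' ⊗ L ⟶ L ⟶ 0` is `K'`-linearly split for `K' = K(t)`. -/
lemma exists_koszul_splitting {t : K'} (ht : Transcendental K t)
    (ht' : IntermediateField.adjoin K {t} = ⊤) :
    ∃ (ρ : K' ⊗[K] L →ₗ[K'] K' ⊗[K] L) (σ : L →ₗ[K'] K' ⊗[K] L),
      (∀ z, ρ (koszulElt K L t * z) = z) ∧ (∀ l, tensorMul K L K' (σ l) = l) ∧
      ∀ z, koszulElt K L t * ρ z + σ (tensorMul K L K' z) = z := by
  have hsurj : Function.Surjective (tensorMul K L K') := fun l => ⟨1 ⊗ₜ l, by simp⟩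
  obtain ⟨σ, hσ⟩ := (tensorMul K L K').exists_rightInverse_of_surjective
    (LinearMap.range_eq_top.2 hsurj)
  have hσ' : ∀ l, tensorMul K L K' (σ l) = l := fun l => LinearMap.congr_fun hσ l
  have hinj := koszulElt_mul_injective (L := L) ht ht'
  let e := LinearEquiv.ofInjective _ hinj
  -- The section `σ` exists because `K'` is a field. The complement `id - σ μ` takes values in the
  -- kernel of `μ`, which is the image of multiplication by the Koszul element, and that
  -- multiplication can be inverted there.
  let π : K' ⊗[K] L →ₗ[K'] LinearMap.range (LinearMap.mulLeft K' (koszulElt K L t)) :=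
    LinearMap.codRestrict _ (LinearMap.id - σ.comp (tensorMul K L K')) (fun z => by
      obtain ⟨z', hz'⟩ := exists_koszulElt_mul_of_tensorMul_eq_zero ht'
        (z - σ (tensorMul K L K' z)) (by rw [map_sub, hσ', sub_self])
      exact ⟨z', hz'⟩)
  have hρ : ∀ z, koszulElt K L t * e.symm (π z) = z - σ (tensorMul K L K' z) := fun z =>
    congrArg Subtype.val (e.apply_symm_apply (π z))
  have hμ : ∀ z, tensorMul K L K' (koszulElt K L t * z) = 0 := by
    intro z
    induction z using TensorProduct.induction_on with
    | zero => simp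
    | tmul x l =>
      simp only [koszulElt, sub_mul, Algebra.TensorProduct.tmul_mul_tmul, map_sub,
        tensorMul_tmul, map_mul, map_one]
      ring
    | add a b ha hb => rw [mul_add, map_add, ha, hb, add_zero]
  refine ⟨e.symm.toLinearMap.comp π, σ, fun z => ?_, hσ', fun z => ?_⟩
  · apply hinj
    change koszulElt K L t * e.symm (π (koszulElt K L t * z)) = _
    rw [hρ, hμ, map_zero, sub_zero]
    rfl
  · change koszulElt K L t * e.symm (π z) + _ = _
    rw [hρ, sub_add_cancel]

end Koszul

namespace BObj

/-! ### The adjunction between free objects and the forgetful functor -/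

section FreeLemmas

variable {k : Type*} [CommRing k] {L : Type*} [Ring L] [Algebra k L] [Module.Free k L]
  {D : Type u} [Category.{v} D] [Preadditive D] [Linear k D]
  [HasCoproductsOfShape (Module.Free.ChooseBasisIndex k L) D]

/-- The morphism `x ↦ b ⊗ x` from `W` to the underlying object of `L ⊗ W`. -/
noncomputable def freeIncl (k : Type*) [CommRing k] {L : Type*} [Ring L] [Algebra k L]
    [Module.Free k L] {D : Type u} [Category.{v} D] [Preadditive D] [Linear k D]
    [HasCoproductsOfShape (Module.Free.ChooseBasisIndex k L) D] (W : D) (b : L) :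
    W ⟶ ((free k L D).obj W).obj := freeι k L W b

lemma freeIncl_act (W : D) (a b : L) :
    freeIncl k W b ≫ ((free k L D).obj W).act a = freeIncl k W (a * b) := freeι_act L W a b

lemma freeIncl_add (W : D) (a b : L) :
    freeIncl k W (a + b) = freeIncl k W a + freeIncl k W b := map_add (tmul L W) a b

lemma freeIncl_smul (W : D) (c : k) (b : L) :
    freeIncl k W (c • b) = c • freeIncl k W b := map_smul (tmul L W) c b

lemma freeIncl_hom_ext {W Y : D} {f g : ((free k L D).obj W).obj ⟶ Y}
    (h : ∀ b : L, freeIncl k W b ≫ f = freeIncl k W b ≫ g) : f = g := freeι_hom_ext L h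

lemma exists_freeIncl_comp {W Y : D} (φ : L →ₗ[k] (W ⟶ Y)) :
    ∃ ψ : ((free k L D).obj W).obj ⟶ Y, ∀ b, freeIncl k W b ≫ ψ = φ b :=
  ⟨tensorDesc L φ, fun b => tmul_tensorDesc L φ b⟩

lemma freeAdjunction_unit_app (W : D) :
    (freeAdjunction k L D).unit.app W = freeIncl k W 1 :=
  Category.comp_id _

lemma freeIncl_comp_hom {W : D} {M : BObj k L D} (f : (free k L D).obj W ⟶ M) (b : L) :
    freeIncl k W b ≫ f.hom = (freeIncl k W 1 ≫ f.hom) ≫ M.act b := by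
  rw [Category.assoc, ← f.comm, ← Category.assoc, freeIncl_act, mul_one]

lemma free_hom_ext {W : D} {M : BObj k L D} {f g : (free k L D).obj W ⟶ M}
    (h : freeIncl k W 1 ≫ f.hom = freeIncl k W 1 ≫ g.hom) : f = g :=
  hom_ext (freeIncl_hom_ext fun b => by rw [freeIncl_comp_hom, h, ← freeIncl_comp_hom])

/-- The action map `L ⊗ M ⟶ M`. -/
noncomputable def actMap (M : BObj k L D) : (free k L D).obj M.obj ⟶ M :=
  (freeAdjunction k L D).counit.app M

lemma freeIncl_actMap (M : BObj k L D) (b : L) :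
    freeIncl k M.obj b ≫ (actMap M).hom = M.act b := by
  have h : freeIncl k M.obj 1 ≫ (actMap M).hom = 𝟙 _ := by
    have := (freeAdjunction k L D).right_triangle_components M
    rwa [freeAdjunction_unit_app] at this
  rw [freeIncl_comp_hom, h, Category.id_comp]

lemma freeIncl_map {W W' : D} (f : W ⟶ W') (b : L) :
    freeIncl k W b ≫ ((free k L D).map f).hom = f ≫ freeIncl k W' b := by
  have h : freeIncl k W (1 : L) ≫ ((free k L D).map f).hom = f ≫ freeIncl k W' 1 := by
    have := (freeAdjunction k L D).unit.naturality f
    rw [freeAdjunction_unit_app, freeAdjunction_unit_app] at this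
    exact this.symm
  rw [freeIncl_comp_hom, h, Category.assoc, freeIncl_act, mul_one]

instance : (free k L D).Additive where
  map_add {W W' f g} := free_hom_ext (by
    rw [add_hom, Preadditive.comp_add, freeIncl_map, freeIncl_map, freeIncl_map,
      Preadditive.add_comp])

lemma relProj_iff (M : BObj k L D) : (freeAdjunction k L D).RelProj M ↔
    ∃ s : M ⟶ (free k L D).obj M.obj, s.hom ≫ (actMap M).hom = 𝟙 M.obj :=
  ⟨fun ⟨s, hs⟩ => ⟨s, congrArg Hom.hom hs⟩, fun ⟨s, hs⟩ => ⟨s, hom_ext hs⟩⟩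

end FreeLemmas

/-! ### Restriction of scalars -/

/-- Restriction of scalars along a homomorphism of algebras `K ⟶ L`. -/
def restrict (k : Type*) [CommRing k] (K : Type*) [CommRing K] [Algebra k K]
    (L : Type*) [CommRing L] [Algebra k L] [Algebra K L] [IsScalarTower k K L]
    (D : Type u) [Category.{v} D] [Preadditive D] [Linear k D] : BObj k L D ⥤ BObj k K D where
  obj M := { obj := M.obj, ρ := M.ρ.comp (IsScalarTower.toAlgHom k K L) }
  map f := { hom := f.hom, comm := fun b => f.comm (algebraMap K L b) }

/-! ### Extension of scalars -/

section Ext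

set_option linter.unusedSectionVars false

variable {k : Type*} [CommRing k] {K : Type*} [CommRing K] [Algebra k K]
  {K' : Type*} [CommRing K'] [Algebra k K'] [Algebra K K'] [IsScalarTower k K K']
  {L : Type*} [CommRing L] [Algebra k L] [Algebra K L] [IsScalarTower k K L]
  {D : Type u} [Category.{v} D] [Preadditive D] [Linear k D]

/-- The `L`-object `M` is, via `i : V ⟶ M`, the extension of scalars `L ⊗_K V` of the `K'`-object
`V`, regarded as a `K`-object: morphisms of `D` out of `M` are the `K`-balanced families of
morphisms out of `V` indexed by `L`. -/
structure IsExtension (K : Type*) [CommRing K] {K' : Type*} [CommRing K'] [Algebra k K']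
    [Algebra K K'] {L : Type*} [CommRing L] [Algebra k L] [Algebra K L]
    (V : BObj k K' D) (M : BObj k L D) (i : V.obj ⟶ M.obj) : Prop where
  act_comp : ∀ x : K, V.act (algebraMap K K' x) ≫ i = i ≫ M.act (algebraMap K L x)
  exists_desc : ∀ {Y : D} (φ : L →+ (V.obj ⟶ Y)),
    (∀ (x : K) l, φ (x • l) = V.act (algebraMap K K' x) ≫ φ l) →
    ∃ ψ : M.obj ⟶ Y, ∀ l, i ≫ M.act l ≫ ψ = φ l
  hom_ext : ∀ {Y : D} (ψ ψ' : M.obj ⟶ Y),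
    (∀ l, i ≫ M.act l ≫ ψ = i ≫ M.act l ≫ ψ') → ψ = ψ'

namespace IsExtension

variable {V : BObj k K' D} {M : BObj k L D} {i : V.obj ⟶ M.obj}

/-- A `K`-linear `f` extends by `l ⊗ v ↦ l f(v)`. Linearity over `L` follows from the uniqueness of
morphisms out of `M`, by comparing both sides on the elements `l ⊗ v`. -/
lemma exists_hom (h : IsExtension K V M i) (N : BObj k L D) (f : V.obj ⟶ N.obj)
    (hf : ∀ x : K, V.act (algebraMap K K' x) ≫ f = f ≫ N.act (algebraMap K L x)) :
    ∃ g : M ⟶ N, i ≫ g.hom = f := by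
  let φ : L →+ (V.obj ⟶ N.obj) := AddMonoidHom.mk' (fun l => f ≫ N.act l)
    (fun a b => by rw [act_add, Preadditive.comp_add])
  obtain ⟨ψ, hψ⟩ := h.exists_desc φ (fun x l => by
    change f ≫ N.act (x • l) = V.act _ ≫ f ≫ N.act l
    rw [Algebra.smul_def, mul_comm, act_mul, ← Category.assoc, ← Category.assoc, hf])
  refine ⟨⟨ψ, fun b => h.hom_ext _ _ fun l => ?_⟩, ?_⟩
  · have e1 : i ≫ M.act l ≫ M.act b ≫ ψ = f ≫ N.act (b * l) := by
      have := hψ (b * l)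
      rw [act_mul] at this
      simpa [φ] using this
    have e2 : i ≫ M.act l ≫ ψ ≫ N.act b = f ≫ N.act (b * l) := by
      rw [act_mul, ← Category.assoc f, ← Category.assoc (M.act l), ← Category.assoc i]
      exact congrArg (fun t => t ≫ N.act b) (hψ l)
    rw [e1, e2]
  · have := hψ 1
    rw [act_one, Category.id_comp] at this
    refine this.trans ?_
    change f ≫ N.act 1 = f
    rw [act_one, Category.comp_id]

lemma hom_ext' (h : IsExtension K V M i) {N : BObj k L D} {g g' : M ⟶ N}
    (hg : i ≫ g.hom = i ≫ g'.hom) : g = g' := by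
  apply BObj.hom_ext
  refine h.hom_ext _ _ fun l => ?_
  rw [g.comm, g'.comm, ← Category.assoc, hg, Category.assoc]

end IsExtension

variable [Module.Free K L] [HasCoproductsOfShape (Module.Free.ChooseBasisIndex K L) D]

/-- The morphism `x ↦ l ⊗ x` from `V` to `L ⊗_K V`. -/
noncomputable def extendIncl (V : BObj k K D) (l : L) :
    V.obj ⟶ ((extendScalars k K L D).obj V).obj :=
  (freeIncl K V l).hom

lemma extendIncl_act (V : BObj k K D) (a b : L) :
    extendIncl V b ≫ ((extendScalars k K L D).obj V).act a = extendIncl V (a * b) :=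
  congrArg Hom.hom (freeIncl_act (k := K) V a b)

lemma extendIncl_add (V : BObj k K D) (a b : L) :
    extendIncl V (a + b) = extendIncl V a + extendIncl V b :=
  congrArg Hom.hom (freeIncl_add (k := K) V a b)

lemma extendIncl_smul (V : BObj k K D) (x : K) (l : L) :
    extendIncl V (x • l) = V.act x ≫ extendIncl V l :=
  (congrArg Hom.hom (freeIncl_smul (k := K) V x l)).trans ((freeIncl K V l).comm x).symm

lemma extendIncl_zero (V : BObj k K D) : extendIncl V (0 : L) = 0 := by
  have := extendIncl_smul V 0 (0 : L)
  rwa [zero_smul, act_zero, zero_comp] at this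

/-- The underlying object of `L ⊗_K V` is a coproduct of copies of `V`. -/
noncomputable def isColimitExtend (V : BObj k K D) :
    IsColimit (Cofan.mk ((extendScalars k K L D).obj V).obj
      fun j => extendIncl V (Module.Free.chooseBasis K L j)) :=
  have hι : ∀ j, tmul (k := K) L V (Module.Free.chooseBasis K L j) = Sigma.ι (fun _ => V) j :=
    fun j => (Module.Free.chooseBasis K L).constr_basis K _ j
  IsColimit.ofIsoColimit (isColimitMapCoconeCofanMkEquiv (forget k K D) _ _
    (isColimitOfPreserves (forget k K D) (coproductIsCoproduct
      (fun _ : Module.Free.ChooseBasisIndex K L => V))))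
    (Cofan.ext (Iso.refl _) (fun j => (Category.comp_id _).trans (congrArg Hom.hom (hι j)).symm))

lemma isExtension_extendScalars (V : BObj k K D) :
    IsExtension K V ((extendScalars k K L D).obj V) (extendIncl V (1 : L)) := by
  have hact : ∀ l : L, extendIncl V 1 ≫ ((extendScalars k K L D).obj V).act l =
      extendIncl V l := fun l => by rw [extendIncl_act, mul_one]
  refine ⟨fun x => ?_, fun {Y} φ hφ => ?_, fun {Y} ψ ψ' h => ?_⟩
  · rw [hact, Algebra.algebraMap_eq_smul_one (A := L), extendIncl_smul, Algebra.algebraMap_self_apply]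
  · obtain ⟨ψ, hψ⟩ : ∃ ψ : ((extendScalars k K L D).obj V).obj ⟶ Y,
        ∀ j, extendIncl V (Module.Free.chooseBasis K L j) ≫ ψ =
          φ (Module.Free.chooseBasis K L j) :=
      ⟨Cofan.IsColimit.desc (isColimitExtend (L := L) V) (fun j => φ (Module.Free.chooseBasis K L j)),
        fun j => Cofan.IsColimit.fac (isColimitExtend (L := L) V) _ j⟩
    refine ⟨ψ, fun l => ?_⟩
    rw [← Category.assoc, hact]
    -- Both sides are additive and `K`-balanced in `l`, so agreement on the basis propagates to its
    -- span.
    have hl : l ∈ Submodule.span K (Set.range (Module.Free.chooseBasis K L)) := by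
      rw [Module.Basis.span_eq]; trivial
    induction hl using Submodule.span_induction with
    | mem x hx => obtain ⟨j, rfl⟩ := hx; exact hψ j
    | zero => rw [extendIncl_zero, zero_comp, map_zero]
    | add a b _ _ ha hb => rw [extendIncl_add, Preadditive.add_comp, ha, hb, map_add]
    | smul x a _ ha => rw [extendIncl_smul, Category.assoc, ha, hφ, Algebra.algebraMap_self_apply]
  · refine Cofan.IsColimit.hom_ext (isColimitExtend (L := L) V) _ _ fun j => ?_
    have := h (Module.Free.chooseBasis K L j)
    rw [← Category.assoc, ← Category.assoc, hact] at this
    exact this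

lemma isExtension_extendScalars_restrict (V : BObj k K' D) :
    IsExtension K V ((extendScalars k K L D).obj ((restrict k K K' D).obj V))
      (extendIncl ((restrict k K K' D).obj V) (1 : L)) :=
  have h := isExtension_extendScalars (L := L) ((restrict k K K' D).obj V)
  ⟨h.act_comp, h.exists_desc, h.hom_ext⟩

end Ext

end BObj

namespace BObj

/-! ### The relative projective dimension of extended objects -/

section Extension

variable {k K K' L : Type w} [Field k] [Field K] [Field K'] [Field L] [Algebra k K] [Algebra k K']
  [Algebra k L] [Algebra K L] [Algebra K K'] [Algebra K' L] [IsScalarTower k K L]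
  [IsScalarTower k K' L] [IsScalarTower k K K'] [IsScalarTower K K' L]
  {D : Type u} [Category.{v} D] [Abelian D] [Linear k D] [HasCoproducts.{w} D]

set_option linter.unusedSectionVars false

/-- When `K` is the image of `k`, every morphism of `D` is `K`-linear, so `M` is free on `V`; the
section of the action map is `l ⊗ v ↦ l ⊗ (1 ⊗ v)`. -/
lemma IsExtension.relProj {V : BObj k K D} {M : BObj k L D} {i : V.obj ⟶ M.obj}
    (h : IsExtension K V M i) (hK : Function.Surjective (algebraMap k K)) :
    (freeAdjunction k L D).RelProj M := by
  obtain ⟨s, hs⟩ := h.exists_hom ((free k L D).obj M.obj) (i ≫ freeIncl k M.obj 1) (fun x => by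
    obtain ⟨c, rfl⟩ := hK x
    rw [Algebra.algebraMap_self_apply, act_algebraMap, ← IsScalarTower.algebraMap_apply,
      act_algebraMap, Linear.smul_comp, Linear.comp_smul, Category.id_comp, Category.comp_id])
  refine (relProj_iff M).2 ⟨s, ?_⟩
  have : s ≫ actMap M = 𝟙 M := h.hom_ext' (by
    rw [comp_hom, ← Category.assoc, hs, Category.assoc, freeIncl_actMap, act_one, id_hom])
  exact congrArg Hom.hom this

open TensorProduct

/-- The morphism `x ⊗ l ↦ (v ↦ l ⊗ x v)`. -/
noncomputable def balanced {V : BObj k K' D} {M : BObj k L D} {i : V.obj ⟶ M.obj}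
    (h : IsExtension K V M i) : K' ⊗[K] L →+ (V.obj ⟶ M.obj) :=
  TensorProduct.liftAddHom
    (AddMonoidHom.mk' (fun x => AddMonoidHom.mk' (fun l => V.act x ≫ i ≫ M.act l)
      (fun a b => by rw [act_add, Preadditive.comp_add, Preadditive.comp_add]))
      (fun a b => by
        ext l
        simp only [AddMonoidHom.mk'_apply, AddMonoidHom.add_apply]
        rw [act_add, Preadditive.add_comp]))
    (fun c x l => by
      simp only [AddMonoidHom.mk'_apply]
      rw [Algebra.smul_def, act_mul, Category.assoc, Algebra.smul_def, mul_comm,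
        act_mul, ← Category.assoc (V.act (algebraMap K K' c)), h.act_comp, Category.assoc,
        act_comm])

section

variable {V : BObj k K' D} {M : BObj k L D} {i : V.obj ⟶ M.obj} (h : IsExtension K V M i)

lemma balanced_tmul (x : K') (l : L) : balanced h (x ⊗ₜ l) = V.act x ≫ i ≫ M.act l := rfl

lemma balanced_smul (x : K') (z : K' ⊗[K] L) : balanced h (x • z) = V.act x ≫ balanced h z := by
  induction z using TensorProduct.induction_on with
  | zero => rw [smul_zero, map_zero, comp_zero]
  | tmul y l =>
    rw [TensorProduct.smul_tmul', balanced_tmul, balanced_tmul, smul_eq_mul, mul_comm, act_mul,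
      Category.assoc]
  | add a b ha hb => rw [smul_add, map_add, ha, hb, map_add, Preadditive.comp_add]

end

section Separable

variable [FiniteDimensional K K'] [Algebra.IsSeparable K K']

/-- If `K'` is finite separable over `K`, then `L ⊗_{K'} V` is a retract of `L ⊗_K V`. -/
lemma exists_retract_of_isSeparable {V : BObj k K' D} {M M' : BObj k L D} {i : V.obj ⟶ M.obj}
    {i' : V.obj ⟶ M'.obj} (h : IsExtension K V M i) (h' : IsExtension K' V M' i') :
    ∃ (a : M' ⟶ M) (b : M ⟶ M'), a ≫ b = 𝟙 M' := by
  have : Algebra.FormallyUnramified K K' := Algebra.FormallyUnramified.of_isSeparable K K'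
  let j : K' ⊗[K] K' →ₗ[K'] K' ⊗[K] L :=
    TensorProduct.AlgebraTensorModule.lTensor K' K' (IsScalarTower.toAlgHom K K' L).toLinearMap
  have hj : ∀ x y, j (x ⊗ₜ y) = x ⊗ₜ algebraMap K' L y := fun _ _ => rfl
  -- The separability element of `K' ⊗_K K'`. The relation `(1 ⊗ x) e = (x ⊗ 1) e` makes `v ↦ e v`
  -- linear over `K'`, and its image `1` under multiplication makes the composite with `L ⊗_K V ⟶ L
  -- ⊗_{K'} V` the identity.
  let e := Algebra.FormallyUnramified.elem K K'
  have hact : ∀ (x : K') z, balanced h (j ((1 ⊗ₜ x) * z)) =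
      balanced h (j z) ≫ M.act (algebraMap K' L x) := by
    intro x z
    induction z using TensorProduct.induction_on with
    | zero => rw [mul_zero, map_zero, map_zero, zero_comp]
    | tmul a b =>
      rw [Algebra.TensorProduct.tmul_mul_tmul, hj, hj, balanced_tmul, balanced_tmul, one_mul,
        map_mul, act_mul, Category.assoc, Category.assoc]
    | add a b ha hb => rw [mul_add, map_add, map_add, ha, hb, map_add, map_add,
        Preadditive.add_comp]
  have hact' : ∀ (x : K') z, balanced h (j ((x ⊗ₜ 1) * z)) = V.act x ≫ balanced h (j z) := by
    intro x z
    rw [← balanced_smul, ← map_smul]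
    congr 2
    rw [Algebra.smul_def]
    rfl
  obtain ⟨a, ha⟩ := h'.exists_hom M (balanced h (j e)) (fun x => by
    rw [Algebra.algebraMap_self_apply, ← hact, ← hact', Algebra.FormallyUnramified.one_tmul_mul_elem])
  obtain ⟨b, hb⟩ := h.exists_hom M' i' (fun x => by
    rw [IsScalarTower.algebraMap_apply K K' L, ← h'.act_comp, Algebra.algebraMap_self_apply])
  refine ⟨a, b, h'.hom_ext' ?_⟩
  have key : ∀ z, balanced h (j z) ≫ b.hom =
      i' ≫ M'.act (algebraMap K' L (Algebra.TensorProduct.lmul' K z)) := by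
    intro z
    induction z using TensorProduct.induction_on with
    | zero => rw [map_zero, map_zero, zero_comp, map_zero, map_zero, act_zero, comp_zero]
    | tmul x y =>
      rw [hj, balanced_tmul, Category.assoc, Category.assoc, b.comm, ← Category.assoc i, hb,
        Algebra.TensorProduct.lmul'_apply_tmul, mul_comm, map_mul, act_mul, ← Category.assoc,
        ← Category.assoc]
      congr 1
      exact h'.act_comp x
    | add a b ha hb => rw [map_add, map_add, Preadditive.add_comp, ha, hb, map_add, map_add,
        act_add, Preadditive.comp_add]
  rw [comp_hom, ← Category.assoc, ha, key, Algebra.FormallyUnramified.lmul_elem, map_one, act_one,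
    id_hom]

end Separable

/-- If `K' = K(t)` with `t` transcendental, then `L ⊗_{K'} V` has a resolution of length one by
`L ⊗_K V`. -/
lemma exists_relSplitting_of_transcendental {V : BObj k K' D} {M M' : BObj k L D}
    {i : V.obj ⟶ M.obj} {i' : V.obj ⟶ M'.obj} (h : IsExtension K V M i)
    (h' : IsExtension K' V M' i') {t : K'} (ht : Transcendental K t)
    (ht' : IntermediateField.adjoin K {t} = ⊤) :
    ∃ (d : M ⟶ M) (p : M ⟶ M'), Nonempty (Adjunction.RelSplitting (forget k L D) d p) := by
  obtain ⟨ρ, σ, hρ, hσ, hρσ⟩ := exists_koszul_splitting (L := L) ht ht'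
  -- On `L ⊗_K V` this is `l ⊗ v ↦ lt ⊗ v - l ⊗ tv`.
  obtain ⟨d, hd⟩ := h.exists_hom M (i ≫ M.act (algebraMap K' L t) - V.act t ≫ i) (fun x => by
    rw [Preadditive.comp_sub, Preadditive.sub_comp, ← Category.assoc, ← Category.assoc, h.act_comp,
      act_comm, Category.assoc, Category.assoc, Category.assoc, act_comm, h.act_comp, Category.assoc])
  obtain ⟨p, hp⟩ := h.exists_hom M' i' (fun x => by
    rw [IsScalarTower.algebraMap_apply K K' L, ← h'.act_comp, Algebra.algebraMap_self_apply])
  -- `Θ` lets elements of `K' ⊗_K L` parametrize morphisms from `V` to `L ⊗_K V`. Composition with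
  -- `d` becomes multiplication by the Koszul element and composition with `p` becomes the
  -- multiplication map, so the `K'`-linear splitting `ρ`, `σ` transports to `r` and `s`. These are
  -- morphisms of `D` only, not of `L`-objects.
  let Θ := balanced h
  have h1 : ∀ l, Θ (1 ⊗ₜ l) = i ≫ M.act l := fun l => by
    rw [balanced_tmul, act_one, Category.id_comp]
  have hΘd : ∀ z, Θ z ≫ d.hom = Θ (koszulElt K L t * z) := by
    intro z
    induction z using TensorProduct.induction_on with
    | zero => rw [mul_zero, map_zero, zero_comp]
    | tmul x l =>
      rw [koszulElt, sub_mul, Algebra.TensorProduct.tmul_mul_tmul,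
        Algebra.TensorProduct.tmul_mul_tmul, map_sub, balanced_tmul, balanced_tmul, balanced_tmul,
        one_mul, one_mul, Category.assoc, Category.assoc, d.comm, ← Category.assoc i, hd,
        Preadditive.sub_comp, Preadditive.comp_sub, mul_comm _ l, act_mul M,
        act_mul V]
      simp only [Category.assoc]
    | add a b ha hb => rw [mul_add, map_add, map_add, Preadditive.add_comp, ha, hb]
  have hΘp : ∀ z, Θ z ≫ p.hom = i' ≫ M'.act (tensorMul K L K' z) := by
    intro z
    induction z using TensorProduct.induction_on with
    | zero => rw [map_zero, zero_comp, map_zero, act_zero, comp_zero]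
    | tmul x l =>
      rw [balanced_tmul, tensorMul_tmul, Category.assoc, Category.assoc, p.comm,
        ← Category.assoc i, hp, mul_comm, act_mul, ← Category.assoc, ← Category.assoc]
      congr 1
      exact h'.act_comp x
    | add a b ha hb => rw [map_add, Preadditive.add_comp, ha, hb, map_add, act_add,
        Preadditive.comp_add]
  obtain ⟨r, hr⟩ := h.exists_desc (Θ.comp (ρ.toAddMonoidHom.comp
    (TensorProduct.mk K K' L 1).toAddMonoidHom)) (fun x l => by
      change Θ (ρ (1 ⊗ₜ (x • l))) = _ ≫ Θ (ρ (1 ⊗ₜ l))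
      rw [← balanced_smul, ← map_smul]
      congr 2
      rw [← TensorProduct.smul_tmul, Algebra.smul_def, mul_one, TensorProduct.smul_tmul',
        smul_eq_mul, mul_one])
  have hΘr : ∀ z, Θ z ≫ r = Θ (ρ z) := by
    intro z
    induction z using TensorProduct.induction_on with
    | zero => rw [map_zero, zero_comp, map_zero, map_zero]
    | tmul x l =>
      have : x ⊗ₜ[K] l = x • ((1 : K') ⊗ₜ[K] l) := by
        rw [TensorProduct.smul_tmul', smul_eq_mul, mul_one]
      rw [this, ρ.map_smul, balanced_smul h, balanced_smul h, Category.assoc]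
      congr 1
      exact (congrArg (fun f => f ≫ r) (h1 l)).trans ((Category.assoc _ _ _).trans (hr l))
    | add a b ha hb => rw [map_add, Preadditive.add_comp, ha, hb, map_add, map_add]
  obtain ⟨s, hs⟩ := h'.exists_desc (Θ.comp σ.toAddMonoidHom) (fun x l => by
      change Θ (σ (x • l)) = _ ≫ Θ (σ l)
      rw [map_smul, balanced_smul, Algebra.algebraMap_self_apply])
  have hs' : ∀ l, i' ≫ M'.act l ≫ s = Θ (σ l) := hs
  have hMext : ∀ {Y : D} {f g : M.obj ⟶ Y}, (∀ z, Θ z ≫ f = Θ z ≫ g) → f = g := by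
    intro Y f g hfg
    refine h.hom_ext _ _ fun l => ?_
    have := hfg (1 ⊗ₜ l)
    rwa [h1, Category.assoc, Category.assoc] at this
  refine ⟨d, p, ⟨⟨r, s, ?_, ?_, ?_, ?_⟩⟩⟩
  · apply BObj.hom_ext
    refine hMext fun z => ?_
    rw [comp_hom, ← Category.assoc, hΘd, hΘp, zero_hom, comp_zero]
    have : tensorMul K L K' (koszulElt K L t * z) = 0 := by
      have := hρσ (koszulElt K L t * z)
      rw [hρ] at this
      have h2 := congrArg (tensorMul K L K') (left_eq_add.1 this.symm)
      rwa [hσ, map_zero] at h2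
    rw [this, act_zero, comp_zero]
  · change d.hom ≫ r = 𝟙 _
    refine hMext fun z => ?_
    rw [← Category.assoc, hΘd, hΘr, hρ, Category.comp_id]
  · change s ≫ p.hom = 𝟙 _
    refine h'.hom_ext _ _ fun l => ?_
    rw [← Category.assoc (M'.act l), ← Category.assoc i', hs', hΘp, hσ, Category.comp_id]
  · change r ≫ d.hom + p.hom ≫ s = 𝟙 _
    refine hMext fun z => ?_
    rw [Preadditive.comp_add, ← Category.assoc, ← Category.assoc, hΘr, hΘd, hΘp, Category.assoc,
      hs', ← map_add, hρσ, Category.comp_id]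

end Extension

end BObj

/-- The two complementary projectors on `F (G (F V))`, in the shape of the field `id` of a
`RelSplitting`. -/
lemma CategoryTheory.Adjunction.syzygyRetraction_add {A : Type u} [Category.{v} A] [Abelian A]
    {B : Type u'} [Category.{v'} B] [Abelian B] {G : B ⥤ A} {F : A ⥤ B} (adj : G ⊣ F)
    [PreservesFiniteLimits F] [F.Additive] (V : A) :
    adj.syzygyRetraction V ≫ F.map (adj.syzygyι V) +
      (F.map (adj.counit.app V) ≫ adj.unit.app (F.obj V) :
        F.obj (G.obj (F.obj V)) ⟶ F.obj (G.obj (F.obj V))) = 𝟙 _ := by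
  rw [syzygyRetraction_ι]
  exact sub_add_cancel _ _

namespace BObj

/-! ### Finitely generated fields of definition -/

section FinitelyGenerated

set_option linter.unusedSectionVars false

/-- Adjoining one generator `x` to the field of definition. If `x` is transcendental, the
transcendence degree rises by one and the Koszul resolution raises the dimension by at most one. If
`x` is algebraic, it is separable by characteristic zero, and the new object is a retract of one
defined over `K`. -/
lemma relPD_of_isExtension_of_adjoin {k K K' L : Type w} [Field k] [Field K] [Field K'] [Field L]
    [Algebra k K] [Algebra k K'] [Algebra k L] [Algebra K L] [Algebra K K'] [Algebra K' L]
    [IsScalarTower k K L] [IsScalarTower k K' L] [IsScalarTower k K K'] [IsScalarTower K K' L]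
    {D : Type u} [Category.{v} D] [Abelian D] [Linear k D] [HasCoproducts.{w} D] [CharZero K]
    (x : K') (hx : IntermediateField.adjoin K {x} = ⊤)
    (ih : ∀ n : ℕ, Algebra.trdeg k K ≤ n → ∀ (V : BObj k K D) (M : BObj k L D) (i : V.obj ⟶ M.obj),
      IsExtension K V M i → (freeAdjunction k L D).RelPD n M)
    (n : ℕ) (hn : Algebra.trdeg k K' ≤ n) (V : BObj k K' D) (M : BObj k L D) (i : V.obj ⟶ M.obj)
    (hM : IsExtension K' V M i) : (freeAdjunction k L D).RelPD n M := by
  have h0 : ∀ n : ℕ, Algebra.trdeg k K ≤ n → (freeAdjunction k L D).RelPD n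
      ((extendScalars k K L D).obj ((restrict k K K' D).obj V)) := fun n hn =>
    ih n hn _ _ _ (isExtension_extendScalars (L := L) ((restrict k K K' D).obj V))
  have h1 := isExtension_extendScalars_restrict (K := K) (L := L) V
  have htr := trdeg_add_eq k K (A := K')
  by_cases hxa : Transcendental K x
  · obtain ⟨d, p, ⟨σ⟩⟩ := exists_relSplitting_of_transcendental h1 hM hxa hx
    have h2 : 1 ≤ Algebra.trdeg K K' := by
      have : Algebra.Transcendental K K' := ⟨x, hxa⟩
      exact Cardinal.one_le_iff_pos.2 (trdeg_pos K K')
    have h3 : Algebra.trdeg k K + 1 ≤ n := (add_le_add_right h2 _).trans (htr.le.trans hn)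
    -- The bound `0` is impossible here, as the transcendence degree is at least one.
    obtain _ | m := n
    · exact absurd (le_add_self.trans h3) (by simp)
    · have h4 : Algebra.trdeg k K ≤ m := by
        rw [Nat.cast_add, Nat.cast_one] at h3
        exact (Cardinal.add_one_le_add_one_iff).1 h3
      exact .of_splitting σ (h0 m h4) (h0 m h4)
  · have hxi : IsIntegral K x := (not_not.1 hxa).isIntegral
    have hf : FiniteDimensional K K' := by
      have := IntermediateField.adjoin.finiteDimensional hxi
      rw [hx] at this
      exact (IntermediateField.topEquiv (F := K) (E := K')).toLinearEquiv.finiteDimensional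
    obtain ⟨a, b, hab⟩ := exists_retract_of_isSeparable h1 hM
    exact (h0 n ((self_le_add_right _ _).trans (htr.le.trans hn))).of_retract a b hab

/-- Induction on generators of `K`. The bottom field is the image of `k`, where extended objects are
free. -/
lemma relPD_of_isExtension {k L : Type w} [Field k] [CharZero k] [Field L] [Algebra k L]
    {D : Type u} [Category.{v} D] [Abelian D] [Linear k D] [HasCoproducts.{w} D]
    (K : IntermediateField k L) (hK : K.FG) (n : ℕ) (hn : Algebra.trdeg k K ≤ n)
    (V : BObj k K D) (M : BObj k L D) (i : V.obj ⟶ M.obj)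
    (hM : IsExtension K V M i) : (freeAdjunction k L D).RelPD n M := by
  revert n V M i
  refine IntermediateField.induction_on_adjoin_fg (fun K => ∀ n : ℕ, Algebra.trdeg k K ≤ n →
    ∀ (V : BObj k K D) (M : BObj k L D) (i : V.obj ⟶ M.obj), IsExtension K V M i →
      (freeAdjunction k L D).RelPD n M) ?_ (fun K x ih => ?_) K hK
  · intro n _ V M i hM
    exact .of_relProj (hM.relProj fun x => by
      obtain ⟨y, hy⟩ := IntermediateField.mem_bot.1 x.2
      exact ⟨y, Subtype.ext hy⟩)
  · have : CharZero K := charZero_of_injective_algebraMap (algebraMap k K).injective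
    -- The field `K(x)` has to be seen at once as an extension of `K` and as an intermediate field
    -- of `L` over `k`. That `x` generates it over `K` is checked after embedding into `L`.
    let K' := (IntermediateField.adjoin K {x}).restrictScalars k
    have hKK' : K ≤ K' := fun y hy =>
      (IntermediateField.adjoin K {x}).algebraMap_mem ⟨y, hy⟩
    let alg : Algebra K K' := (IntermediateField.inclusion hKK').toRingHom.toAlgebra
    have : IsScalarTower k K K' := IsScalarTower.of_algebraMap_eq fun _ => rfl
    have : IsScalarTower K K' L := IsScalarTower.of_algebraMap_eq fun _ => rfl
    have hxK' : x ∈ K' := IntermediateField.mem_adjoin_simple_self K x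
    refine relPD_of_isExtension_of_adjoin (K := K) (K' := K') ⟨x, hxK'⟩ (eq_top_iff.2 ?_) ih
    rintro ⟨y, hy⟩ -
    have h1 : (IntermediateField.adjoin K {(⟨x, hxK'⟩ : K')}).map (IsScalarTower.toAlgHom K K' L) =
        IntermediateField.adjoin K {x} := by
      rw [IntermediateField.adjoin_map, Set.image_singleton]
      rfl
    have h2 : y ∈ (IntermediateField.adjoin K {(⟨x, hxK'⟩ : K')}).map
        (IsScalarTower.toAlgHom K K' L) := h1 ▸ hy
    obtain ⟨z, hz, hzy⟩ := h2
    rwa [← (Subtype.ext hzy : z = ⟨y, hy⟩)]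

end FinitelyGenerated

/-! ### Restriction of scalars and relative projective dimension -/

section Restrict

variable {k K L : Type w} [Field k] [Field K] [Field L] [Algebra k K]
  [Algebra k L] [Algebra K L] [IsScalarTower k K L]
  {D : Type u} [Category.{v} D] [Abelian D] [Linear k D] [HasCoproducts.{w} D]

set_option linter.unusedSectionVars false

open TensorProduct

/-- The morphism `x ⊗ l ↦ (w ↦ x ⊗ (l ⊗ w))`. -/
noncomputable def doubleIncl (k K L : Type w) [Field k] [Field K] [Field L] [Algebra k K]
    [Algebra k L] {D : Type u} [Category.{v} D] [Abelian D] [Linear k D] [HasCoproducts.{w} D]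
    (W : D) : K ⊗[k] L →ₗ[k]
    (W ⟶ ((free k K D).obj ((free k L D).obj W).obj).obj) :=
  TensorProduct.lift (LinearMap.mk₂ k
    (fun x l => freeIncl k W l ≫ freeIncl k ((free k L D).obj W).obj x)
    (fun x y l => by rw [freeIncl_add, Preadditive.comp_add])
    (fun c x l => by rw [freeIncl_smul, Linear.comp_smul])
    (fun x l m => by rw [freeIncl_add, Preadditive.add_comp])
    (fun c x l => by rw [freeIncl_smul, Linear.smul_comp]))

lemma doubleIncl_tmul (W : D) (x : K) (l : L) : doubleIncl k K L W (x ⊗ₜ l) =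
    freeIncl k W l ≫ freeIncl k ((free k L D).obj W).obj x := rfl

lemma doubleIncl_smul (W : D) (x : K) (z : K ⊗[k] L) : doubleIncl k K L W (x • z) =
    doubleIncl k K L W z ≫ ((free k K D).obj ((free k L D).obj W).obj).act x := by
  induction z using TensorProduct.induction_on with
  | zero => rw [smul_zero, map_zero, zero_comp]
  | tmul y l =>
    rw [TensorProduct.smul_tmul', doubleIncl_tmul, doubleIncl_tmul, Category.assoc, freeIncl_act,
      smul_eq_mul]
  | add a b ha hb => rw [smul_add, map_add, ha, hb, map_add, Preadditive.add_comp]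

/-- The multiplication `K ⊗_k L ⟶ L` has a `K`-linear section because `K` is a field; tensoring it
with `W` splits the `K`-action map. -/
lemma relProj_restrict_free (W : D) :
    (freeAdjunction k K D).RelProj ((restrict k K L D).obj ((free k L D).obj W)) := by
  obtain ⟨σ, hσ⟩ := (tensorMul k L K).exists_rightInverse_of_surjective
    (LinearMap.range_eq_top.2 fun l => ⟨1 ⊗ₜ l, by simp⟩)
  have hσ' : ∀ l, tensorMul k L K (σ l) = l := fun l => LinearMap.congr_fun hσ l
  obtain ⟨ψ, hψ⟩ := exists_freeIncl_comp (k := k) (L := L)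
    ((doubleIncl k K L W).comp (σ.restrictScalars k))
  have hψ' : ∀ l, freeIncl k W l ≫ ψ = doubleIncl k K L W (σ l) := hψ
  have hact : ∀ x : K, ((free k L D).obj W).act (algebraMap K L x) ≫ ψ =
      ψ ≫ ((free k K D).obj ((free k L D).obj W).obj).act x := fun x =>
    freeIncl_hom_ext fun l => by
      rw [← Category.assoc, freeIncl_act, hψ', ← Category.assoc, hψ', ← doubleIncl_smul,
        ← σ.map_smul, Algebra.smul_def]
  have hmul : ∀ z : K ⊗[k] L, doubleIncl k K L W z ≫
      (actMap ((restrict k K L D).obj ((free k L D).obj W))).hom =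
        freeIncl k W (tensorMul k L K z) := by
    intro z
    have hz : freeIncl k W (0 : L) = 0 := by
      have := freeIncl_smul W (0 : k) (0 : L); rwa [zero_smul, zero_smul] at this
    induction z using TensorProduct.induction_on with
    | zero => rw [map_zero, map_zero, hz]; exact zero_comp
    | tmul y l =>
      rw [tensorMul_tmul, ← freeIncl_act, doubleIncl_tmul]
      refine (Category.assoc _ _ _).trans (congrArg (fun t => freeIncl k W l ≫ t) ?_)
      exact freeIncl_actMap ((restrict k K L D).obj ((free k L D).obj W)) y
    | add a b ha hb => rw [map_add, map_add, freeIncl_add, ← ha, ← hb]; exact Preadditive.add_comp _ _ _ _ _ _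
  refine (relProj_iff _).2 ⟨⟨ψ, hact⟩, freeIncl_hom_ext fun l => ?_⟩
  refine (Category.assoc _ _ _).symm.trans ?_
  refine (congrArg (fun t => t ≫ _) (hψ' l)).trans ((hmul _).trans ?_)
  rw [hσ']
  exact (Category.comp_id _).symm

lemma relProj_restrict {M : BObj k L D} (hM : (freeAdjunction k L D).RelProj M) :
    (freeAdjunction k K D).RelProj ((restrict k K L D).obj M) := by
  obtain ⟨s, hs⟩ := hM
  exact (relProj_restrict_free M.obj).of_retract ((restrict k K L D).map s)
    ((restrict k K L D).map ((freeAdjunction k L D).counit.app M))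
    (((restrict k K L D).map_comp _ _).symm.trans
      ((congrArg _ hs).trans ((restrict k K L D).map_id M)))

/-- Restricting the `L`-syzygy does not give the `K`-syzygy. The restricted sequence still splits in
`D` and has relatively projective middle term, so the relative Schanuel lemma compares the two. -/
lemma relPD_restrict {n : ℕ} {M : BObj k L D} (hM : (freeAdjunction k L D).RelPD n M) :
    (freeAdjunction k K D).RelPD n ((restrict k K L D).obj M) := by
  induction n generalizing M with
  | zero => exact relProj_restrict hM
  | succ n ih =>
    let adj := freeAdjunction k L D
    let σ : Adjunction.RelSplitting (forget k K D) ((restrict k K L D).map (adj.syzygyι M))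
        ((restrict k K L D).map (adj.counit.app M)) :=
      { r := adj.syzygyRetraction M
        s := adj.unit.app M.obj
        w := hom_ext (congrArg (fun t : _ ⟶ M => t.hom) (adj.syzygyι_counit M) :)
        f_r := adj.syzygyι_retraction M
        s_g := adj.right_triangle_components M
        id := adj.syzygyRetraction_add M }
    exact .of_relProj_of_splitting σ (ih hM) (relProj_restrict_free M.obj)

/-- A `K`-object `V` is a retract of `L ⊗_K V`. -/
lemma exists_retract_restrict_extend (V : BObj k K D) :
    ∃ (a : V ⟶ (restrict k K L D).obj ((extendScalars k K L D).obj V))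
      (b : (restrict k K L D).obj ((extendScalars k K L D).obj V) ⟶ V), a ≫ b = 𝟙 V := by
  -- A `K`-linear retraction of `K ⟶ L`; the retraction of `V ⟶ L ⊗_K V` is then `l ⊗ v ↦ μ(l) v`.
  obtain ⟨μ, hμ⟩ := (Algebra.linearMap K L).exists_leftInverse_of_injective
    (LinearMap.ker_eq_bot.2 (algebraMap K L).injective)
  have hμ1 : μ 1 = 1 := by simpa using LinearMap.congr_fun hμ 1
  have h := isExtension_extendScalars (L := L) V
  obtain ⟨ψ, hψ⟩ := h.exists_desc (AddMonoidHom.mk' (fun l => V.act (μ l))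
    (fun a b => by rw [map_add, act_add])) (fun x l => by
      simp only [AddMonoidHom.mk'_apply]
      rw [map_smul, smul_eq_mul, mul_comm, act_mul, Algebra.algebraMap_self_apply])
  have hψ' : ∀ l, extendIncl V 1 ≫ ((extendScalars k K L D).obj V).act l ≫ ψ = V.act (μ l) := hψ
  refine ⟨⟨extendIncl V 1, h.act_comp⟩, ⟨ψ, fun x => ?_⟩, hom_ext ?_⟩
  · refine h.hom_ext _ _ fun l => ?_
    have h1 := hψ' (algebraMap K L x * l)
    rw [act_mul, ← Algebra.smul_def, map_smul, smul_eq_mul, act_mul, ← hψ' l] at h1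
    simp only [Category.assoc] at h1
    exact h1
  · have := hψ' 1
    rw [act_one, Category.id_comp, hμ1, act_one] at this
    exact this

lemma extendIncl_comp_comm {V : BObj k K D} {N : BObj k L D}
    (f : (extendScalars k K L D).obj V ⟶ N) (x : K) :
    V.act x ≫ extendIncl V 1 ≫ f.hom = (extendIncl V 1 ≫ f.hom) ≫ N.act (algebraMap K L x) := by
  have h := (isExtension_extendScalars (L := L) V).act_comp x
  rw [Algebra.algebraMap_self_apply] at h
  rw [← Category.assoc, h, Category.assoc, f.comm, Category.assoc]

/-- Morphisms out of `L ⊗_K V`. -/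
noncomputable def extendHomEquiv (V : BObj k K D) (N : BObj k L D) :
    ((extendScalars k K L D).obj V ⟶ N) ≃ (V ⟶ (restrict k K L D).obj N) :=
  Equiv.ofBijective
    (fun f => ⟨extendIncl V 1 ≫ f.hom, fun x => extendIncl_comp_comm f x⟩)
    ⟨fun f g hfg => (isExtension_extendScalars (L := L) V).hom_ext' (congrArg Hom.hom hfg),
      fun g => by
        obtain ⟨f, hf⟩ := (isExtension_extendScalars (L := L) V).exists_hom N g.hom g.comm
        exact ⟨f, hom_ext hf⟩⟩

/-- Extension of scalars is left adjoint to restriction of scalars. -/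
noncomputable def extendAdjunction (k K L : Type w) [Field k] [Field K] [Field L] [Algebra k K]
    [Algebra k L] [Algebra K L] [IsScalarTower k K L]
    (D : Type u) [Category.{v} D] [Abelian D] [Linear k D] [HasCoproducts.{w} D] :
    extendScalars k K L D ⊣ restrict k K L D :=
  Adjunction.mkOfHomEquiv
    { homEquiv := extendHomEquiv
      homEquiv_naturality_left_symm := fun {V' V N} f g => by
        obtain ⟨g', rfl⟩ := (extendHomEquiv V N).surjective g
        rw [Equiv.symm_apply_eq, Equiv.symm_apply_apply]
        apply hom_ext
        have h1 : extendIncl V' (1 : L) ≫ ((extendScalars k K L D).map f).hom =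
          f.hom ≫ extendIncl V 1 := congrArg Hom.hom (freeIncl_map (k := K) f (1 : L))
        change f.hom ≫ extendIncl V 1 ≫ g'.hom =
          extendIncl V' 1 ≫ ((extendScalars k K L D).map f).hom ≫ g'.hom
        rw [← Category.assoc, ← h1, Category.assoc]
      homEquiv_naturality_right := fun f g => hom_ext (Category.assoc _ _ _).symm }

end Restrict

end BObj

/-! ### From essential dimension to relative projective dimension -/

section EssentialDimension

variable {k : Type w} [Field k] {L : Type w} [Field L] [Algebra k L]
  {C : Type u} [Category.{v} C] [EssentiallySmall.{w} C] [Abelian C] [Linear k C]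

/-- A left adjoint preserves finitely presented objects when its right adjoint, here restriction of
scalars, preserves filtered colimits; that is tested on underlying objects. -/
lemma isFinitelyPresentable_extendScalars {L' : Type w} [Field L'] [Algebra k L'] [Algebra L L']
    [IsScalarTower k L L'] (V : BaseExt k L C) :
    ObjectProperty.isFinitelyPresentable.{w} (IndBase k L' C)
      ((BObj.extendScalars k L L' (IndCat.{w} C)).obj V.obj) := by
  have := Cardinal.fact_isRegular_aleph0.{w}
  have hV : IsCardinalPresentable V.obj Cardinal.aleph0.{w} := V.property
  have : (BObj.restrict k L L' (IndCat.{w} C)).IsCardinalAccessible Cardinal.aleph0.{w} :=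
    Functor.isFinitelyAccessible_iff_preservesFilteredColimits.2
      ⟨fun J _ _ => by
        have : PreservesColimitsOfShape J
          (BObj.restrict k L L' (IndCat.{w} C) ⋙ BObj.forget k L (IndCat.{w} C)) :=
          inferInstanceAs (PreservesColimitsOfShape J (BObj.forget k L' (IndCat.{w} C)))
        exact preservesColimitsOfShape_of_reflects_of_preserves _
          (BObj.forget k L (IndCat.{w} C))⟩
  exact (BObj.extendAdjunction k L L' (IndCat.{w} C)).isCardinalPresentable_leftAdjoint_obj
    Cardinal.aleph0.{w} V.obj

/-- Condition (E2) reduces to indecomposable summands, each of which is defined over a finitely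
generated field of transcendence degree at most `d`. -/
lemma relPD_of_hasEssDimLE_of_isAlgClosed [CharZero k] [IsAlgClosed L]
    (hE2 : SatisfiesE2.{w} k C) {d : ℕ} (hd : HasEssDimLE.{w} k C d) (V : BaseExt k L C) :
    (BObj.freeAdjunction k L (IndCat.{w} C)).RelPD d V.obj := by
  obtain ⟨n, U, hU, ⟨e⟩⟩ := hE2 L V
  refine Adjunction.RelPD.of_sum (U := fun i => (U i).obj) (fun i => ?_)
    (fun i => (e.hom ≫ biproduct.π U i).hom) (fun i => (biproduct.ι U i ≫ e.inv).hom) ?_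
  · obtain ⟨L₀, V₀, hfg, htr, ⟨e⟩⟩ := hd L (U i) (hU i)
    exact (BObj.relPD_of_isExtension L₀ hfg d htr V₀.obj _ _
      (BObj.isExtension_extendScalars V₀.obj)).of_iso e
  · have h : ∑ i, (e.hom ≫ biproduct.π U i) ≫ biproduct.ι U i ≫ e.inv = 𝟙 V := by
      simp only [Category.assoc]
      simp only [← Preadditive.comp_sum, ← Category.assoc _ _ e.inv, ← Preadditive.sum_comp,
        biproduct.total]
      rw [Category.comp_id, Iso.hom_inv_id]
    have h2 := congrArg (ObjectProperty.ι _).map h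
    rw [Functor.map_sum] at h2
    exact h2

/-- The definition of essential dimension only concerns algebraically closed fields. The object is
extended to the algebraic closure of `L` and restricted back; `V` is a retract of the result. -/
lemma relPD_of_hasEssDimLE [CharZero k] (hE2 : SatisfiesE2.{w} k C) {d : ℕ}
    (hd : HasEssDimLE.{w} k C d) (V : BaseExt k L C) :
    (BObj.freeAdjunction k L (IndCat.{w} C)).RelPD d V.obj := by
  obtain ⟨a, b, hab⟩ := BObj.exists_retract_restrict_extend (L := AlgebraicClosure L) V.obj
  exact (BObj.relPD_restrict (relPD_of_hasEssDimLE_of_isAlgClosed hE2 hd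
    ⟨_, isFinitelyPresentable_extendScalars (L' := AlgebraicClosure L) V⟩)).of_retract a b hab

end EssentialDimension

/-! ### Coproducts in derived categories -/

namespace CochainComplex

section Coproducts

variable {B : Type u} [Category.{v} B] [Abelian B] {J : Type w} [HasCoproductsOfShape J B]

/-- The degreewise coproduct of a family of complexes. -/
noncomputable def sigma (W : J → CochainComplex B ℤ) : CochainComplex B ℤ where
  X n := ∐ fun j => (W j).X n
  d m n := Limits.Sigma.map fun j => (W j).d m n
  shape m n h := Limits.Sigma.hom_ext _ _ fun j => by simp [(W j).shape m n h]
  d_comp_d' l m n _ _ := Limits.Sigma.hom_ext _ _ fun j => by simp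

section

variable (W : J → CochainComplex B ℤ) {W' : J → CochainComplex B ℤ} {Y : CochainComplex B ℤ}

/-- The inclusions into the degreewise coproduct, in a given degree. -/
noncomputable def sigmaIncl (n : ℤ) (j : J) : (W j).X n ⟶ (sigma W).X n :=
  Limits.Sigma.ι (fun j => (W j).X n) j

lemma sigmaIncl_d (m n : ℤ) (j : J) :
    sigmaIncl W m j ≫ (sigma W).d m n = (W j).d m n ≫ sigmaIncl W n j :=
  ι_colimMap _ _

variable {W}

lemma sigmaIncl_hom_ext {n : ℤ} {Z : B} {f g : (sigma W).X n ⟶ Z}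
    (h : ∀ j, sigmaIncl W n j ≫ f = sigmaIncl W n j ≫ g) : f = g :=
  Limits.Sigma.hom_ext _ _ h

/-- Morphisms out of the degreewise coproduct, in a given degree. -/
noncomputable def sigmaLift {n : ℤ} {Z : B} (f : ∀ j, (W j).X n ⟶ Z) : (sigma W).X n ⟶ Z :=
  Limits.Sigma.desc f

@[simp]
lemma sigmaIncl_lift {n : ℤ} {Z : B} (f : ∀ j, (W j).X n ⟶ Z) (j : J) :
    sigmaIncl W n j ≫ sigmaLift f = f j :=
  Limits.Sigma.ι_desc _ _

variable (W) in
/-- The inclusions into the degreewise coproduct. -/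
noncomputable def sigmaι (j : J) : W j ⟶ sigma W where
  f n := sigmaIncl W n j
  comm' m n _ := sigmaIncl_d W m n j

/-- Morphisms out of the degreewise coproduct. -/
noncomputable def sigmaDesc (f : ∀ j, W j ⟶ Y) : sigma W ⟶ Y where
  f n := sigmaLift fun j => (f j).f n
  comm' m n _ := sigmaIncl_hom_ext fun j => by
    rw [← Category.assoc, sigmaIncl_lift, ← Category.assoc, sigmaIncl_d, Category.assoc,
      sigmaIncl_lift, (f j).comm]

lemma sigmaIncl_desc_f (f : ∀ j, W j ⟶ Y) (j : J) (n : ℤ) :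
    sigmaIncl W n j ≫ (sigmaDesc f).f n = (f j).f n :=
  sigmaIncl_lift _ j

lemma sigmaι_desc (f : ∀ j, W j ⟶ Y) (j : J) : sigmaι W j ≫ sigmaDesc f = f j := by
  ext n
  exact sigmaIncl_lift _ j

lemma sigma_hom_ext {f g : sigma W ⟶ Y} (h : ∀ j, sigmaι W j ≫ f = sigmaι W j ≫ g) : f = g := by
  ext n
  refine sigmaIncl_hom_ext fun j => ?_
  exact congrArg (fun t => HomologicalComplex.Hom.f t n) (h j)

/-- The functoriality of the degreewise coproduct. -/
noncomputable def sigmaMap (f : ∀ j, W j ⟶ W' j) : sigma W ⟶ sigma W' :=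
  sigmaDesc fun j => f j ≫ sigmaι W' j

end

/-- A family of complexes, regarded as a complex of families. -/
def discreteComplex (W : J → CochainComplex B ℤ) : CochainComplex (Discrete J ⥤ B) ℤ where
  X n := Discrete.functor fun j => (W j).X n
  d m n := Discrete.natTrans fun j => (W j.as).d m n
  shape m n h := by ext j; exact (W j.as).shape m n h
  d_comp_d' l m n _ _ := by ext j; exact (W j.as).d_comp_d l m n

/-- A family of morphisms of complexes, regarded as a morphism of complexes of families. -/
def discreteMap {W W' : J → CochainComplex B ℤ} (f : ∀ j, W j ⟶ W' j) :
    discreteComplex W ⟶ discreteComplex W' where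
  f n := Discrete.natTrans fun j => (f j.as).f n
  comm' m n _ := by ext j; exact (f j.as).comm m n

/-- The degreewise coproduct is the exact functor `colim` applied to a complex of families, and
exact functors preserve quasi-isomorphisms. -/
lemma quasiIso_sigmaMap [HasExactColimitsOfShape (Discrete J) B] {W W' : J → CochainComplex B ℤ}
    (f : ∀ j, W j ⟶ W' j) (hf : ∀ j, QuasiIso (f j)) : QuasiIso (sigmaMap f) := by
  have h : QuasiIso (discreteMap f) := by
    rw [HomologicalComplex.quasiIso_iff_evaluation]
    exact fun j => hf j.as
  have h' : QuasiIso (((colim (J := Discrete J) (C := B)).mapHomologicalComplex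
    (ComplexShape.up ℤ)).map (discreteMap f)) := inferInstance
  suffices h : sigmaMap f = ((colim (J := Discrete J) (C := B)).mapHomologicalComplex
    (ComplexShape.up ℤ)).map (discreteMap f) by rw [h]; exact h'
  ext n
  refine sigmaIncl_hom_ext fun j => (sigmaIncl_desc_f _ j n).trans ?_
  exact (ι_colimMap ((discreteMap f).f n) ⟨j⟩).symm

/-- A morphism out of a degreewise coproduct is null homotopic if all its components are. -/
noncomputable def homotopyZeroSigma {W : J → CochainComplex B ℤ} {Y : CochainComplex B ℤ}
    (f : sigma W ⟶ Y) (h : ∀ j, Homotopy (sigmaι W j ≫ f) 0) : Homotopy f 0 where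
  hom m n := sigmaLift fun j => (h j).hom m n
  zero m n hmn := sigmaIncl_hom_ext fun j => by
    rw [sigmaIncl_lift, (h j).zero m n hmn, comp_zero]
  comm n := sigmaIncl_hom_ext fun j => by
    have h1 := (h j).comm n
    have h2 := dNext_comp_left (sigmaι W j)
      (fun m n => (sigmaLift fun j => (h j).hom m n : (sigma W).X m ⟶ Y.X n)) n
    have h3 := prevD_comp_left (sigmaι W j)
      (fun m n => (sigmaLift fun j => (h j).hom m n : (sigma W).X m ⟶ Y.X n)) n
    have h4 : (fun m n => (sigmaι W j).f m ≫
        (sigmaLift fun j => (h j).hom m n : (sigma W).X m ⟶ Y.X n)) = (h j).hom :=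
      funext fun m => funext fun n => sigmaIncl_lift _ j
    rw [h4] at h2 h3
    rw [HomologicalComplex.zero_f, add_zero] at h1 ⊢
    rw [Preadditive.comp_add]
    exact h1.trans (congrArg₂ (· + ·) h2 h3)

end Coproducts

end CochainComplex

/-! ### Degreewise coproducts as coproducts in the derived category -/

namespace DerivedCategory

open CochainComplex

variable {B : Type u} [Category.{v} B] [Abelian B]

/-- Calculus of fractions in the homotopy category: a morphism dies in the localization only if some
quasi-isomorphism kills it up to homotopy. -/
lemma exists_homotopy_of_Q_map_eq_zero {X Y : CochainComplex B ℤ} (f : X ⟶ Y)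
    (hf : Q.map f = 0) :
    ∃ (X' : CochainComplex B ℤ) (s : X' ⟶ X) (_ : IsIso (Q.map s)), Nonempty (Homotopy (s ≫ f) 0) := by
  have h : Qh.map ((HomotopyCategory.quotient _ _).map f) =
      Qh.map ((HomotopyCategory.quotient _ _).map 0) := by
    refine Eq.trans (b := Q.map f) rfl (hf.trans ?_)
    rw [Functor.map_zero, Functor.map_zero]
    rfl
  obtain ⟨X', s, hs, h⟩ := (MorphismProperty.map_eq_iff_precomp Qh
    (HomotopyCategory.quasiIso B (ComplexShape.up ℤ)) _ _).1 h
  obtain ⟨X', rfl⟩ := HomotopyCategory.quotient_obj_surjective X'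
  obtain ⟨s, rfl⟩ := (HomotopyCategory.quotient _ _).map_surjective s
  rw [← isIso_Qh_map_iff] at hs
  refine ⟨X', s, hs, ⟨HomotopyCategory.homotopyOfEq _ _ ?_⟩⟩
  rw [Functor.map_comp, h, ← Functor.map_comp, comp_zero]

variable {J : Type w} [HasCoproductsOfShape J B] [HasExactColimitsOfShape (Discrete J) B]
  {W T : CochainComplex B ℤ}

lemma isIso_Q_map_sigmaDesc (i : J → (W ⟶ T))
    (hi : ∀ n, IsColimit (Cofan.mk (T.X n) (fun j => (i j).f n)))
    {W' : J → CochainComplex B ℤ} (s : ∀ j, W' j ⟶ W)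
    (hs : ∀ j, IsIso (Q.map (s j))) : IsIso (Q.map (sigmaDesc fun j => s j ≫ i j)) := by
  have h1 : QuasiIso (sigmaMap s) :=
    quasiIso_sigmaMap s fun j => (isIso_Q_map_iff_quasiIso _ _).1 (hs j)
  have h2 : ∀ n, IsIso ((sigmaDesc i).f n) := fun n => by
    let e := (coproductIsCoproduct (fun _ : J => W.X n)).coconePointUniqueUpToIso (hi n)
    have : (sigmaDesc i).f n = e.hom := sigmaIncl_hom_ext fun j => by
      rw [sigmaIncl_desc_f]
      exact (IsColimit.comp_coconePointUniqueUpToIso_hom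
        (coproductIsCoproduct (fun _ : J => W.X n)) (hi n) ⟨j⟩).symm
    rw [this]
    exact e.isIso_hom
  have h3 : IsIso (sigmaDesc i) := HomologicalComplex.Hom.isIso_of_components _
  have h4 : sigmaDesc (fun j => s j ≫ i j) = sigmaMap s ≫ sigmaDesc i :=
    sigma_hom_ext fun j => by
      rw [sigmaι_desc, sigmaMap, ← Category.assoc, sigmaι_desc, Category.assoc, sigmaι_desc]
  rw [h4, Functor.map_comp]
  infer_instance

/-- Each component is a roof with left leg a quasi-isomorphism `W' j ⟶ W`. By exactness of
coproducts these left legs assemble to a quasi-isomorphism from the coproduct of the `W' j` to `T`,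
which yields one roof out of `T`. -/
lemma exists_Q_desc (i : J → (W ⟶ T))
    (hi : ∀ n, IsColimit (Cofan.mk (T.X n) (fun j => (i j).f n)))
    {Y : DerivedCategory B} (φ : J → (Q.obj W ⟶ Y)) :
    ∃ ψ : Q.obj T ⟶ Y, ∀ j, Q.map (i j) ≫ ψ = φ j := by
  let e := Q.objObjPreimageIso Y
  have h := fun j => right_fac (φ j ≫ e.inv)
  choose W' s hs g hg using h
  have hc := isIso_Q_map_sigmaDesc i hi s hs
  refine ⟨inv (Q.map (sigmaDesc fun j => s j ≫ i j)) ≫ Q.map (sigmaDesc g) ≫ e.hom, fun j => ?_⟩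
  rw [← cancel_epi (Q.map (s j)), ← Q.map_comp_assoc, ← sigmaι_desc (fun j => s j ≫ i j),
    Q.map_comp_assoc, IsIso.hom_inv_id_assoc, ← Q.map_comp_assoc, sigmaι_desc,
    ← cancel_mono e.inv, Category.assoc, Category.assoc, hg j]
  simp

/-- A difference that vanishes on every copy of `W` becomes null homotopic on each after a
quasi-isomorphism; the homotopies assemble over the coproduct of the new sources. -/
lemma Q_hom_ext (i : J → (W ⟶ T))
    (hi : ∀ n, IsColimit (Cofan.mk (T.X n) (fun j => (i j).f n)))
    {Y : DerivedCategory B} {ψ ψ' : Q.obj T ⟶ Y}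
    (h : ∀ j, Q.map (i j) ≫ ψ = Q.map (i j) ≫ ψ') : ψ = ψ' := by
  let e := Q.objObjPreimageIso Y
  rw [← sub_eq_zero, ← cancel_mono e.inv, zero_comp]
  obtain ⟨Y', g, t, ht, hg⟩ := left_fac ((ψ - ψ') ≫ e.inv)
  suffices Q.map g = 0 by rw [hg, this, zero_comp]
  have h1 : ∀ j, Q.map (i j ≫ g) = 0 := fun j => by
    rw [Q.map_comp, ← cancel_mono (inv (Q.map t)), Category.assoc, ← hg, ← Category.assoc,
      Preadditive.comp_sub, h j, sub_self, zero_comp, zero_comp]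
  choose W' s hs H using fun j => exists_homotopy_of_Q_map_eq_zero _ (h1 j)
  have hc := isIso_Q_map_sigmaDesc i hi s hs
  have H' : Homotopy (sigmaDesc (fun j => s j ≫ i j) ≫ g) 0 :=
    homotopyZeroSigma _ fun j => (Homotopy.ofEq (by
      rw [← Category.assoc, sigmaι_desc, Category.assoc])).trans (H j).some
  rw [← cancel_epi (Q.map (sigmaDesc (fun j => s j ≫ i j))), ← Q.map_comp,
    Q_map_eq_of_homotopy _ H', Functor.map_zero, comp_zero]

end DerivedCategory

/-! ### The derived adjunction -/

namespace CategoryTheory.Adjunction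

variable {A : Type u} [Category.{v} A] {B : Type u'} [Category.{v'} B]
  {G : B ⥤ A} {F : A ⥤ B} (adj : G ⊣ F)

/-- An adjunction between additive functors extends to complexes. -/
def mapCochainComplex [Preadditive A] [Preadditive B] [G.Additive] [F.Additive] :
    G.mapHomologicalComplex (ComplexShape.up ℤ) ⊣ F.mapHomologicalComplex (ComplexShape.up ℤ) :=
  Adjunction.mkOfUnitCounit
    { unit :=
        { app := fun K => { f := fun n => adj.unit.app (K.X n)
                            comm' := fun m n _ => (adj.unit.naturality (K.d m n)).symm }
          naturality := fun _ _ f => by ext n; exact adj.unit.naturality (f.f n) }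
      counit :=
        { app := fun K => { f := fun n => adj.counit.app (K.X n)
                            comm' := fun m n _ => (adj.counit.naturality (K.d m n)).symm }
          naturality := fun _ _ f => by ext n; exact adj.counit.naturality (f.f n) }
      left_triangle := by
        ext K n
        exact (congrArg (fun t => G.map (adj.unit.app (K.X n)) ≫ t) (Category.id_comp _)).trans
          (adj.left_triangle_components (K.X n))
      right_triangle := by
        ext K n
        exact (congrArg (fun t => adj.unit.app (F.obj (K.X n)) ≫ t) (Category.id_comp _)).trans
          (adj.right_triangle_components (K.X n)) }

section

variable [Abelian A] [Abelian B] [G.Additive] [PreservesFiniteLimits G]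
  [PreservesFiniteColimits G] [F.Additive] [PreservesFiniteLimits F] [PreservesFiniteColimits F]

/-- An adjunction between exact functors extends to derived categories. -/
noncomputable def mapDerived : G.mapDerivedCategory ⊣ F.mapDerivedCategory :=
  letI : CatCommSq (G.mapHomologicalComplex (ComplexShape.up ℤ)) DerivedCategory.Q
    DerivedCategory.Q G.mapDerivedCategory := ⟨G.mapDerivedCategoryFactors.symm⟩
  letI : CatCommSq (F.mapHomologicalComplex (ComplexShape.up ℤ)) DerivedCategory.Q
    DerivedCategory.Q F.mapDerivedCategory := ⟨F.mapDerivedCategoryFactors.symm⟩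
  adj.mapCochainComplex.localization DerivedCategory.Q
    (HomologicalComplex.quasiIso B (ComplexShape.up ℤ)) DerivedCategory.Q
    (HomologicalComplex.quasiIso A (ComplexShape.up ℤ)) _ _

lemma mapDerived_unit_app (W : CochainComplex B ℤ) :
    adj.mapDerived.unit.app (DerivedCategory.Q.obj W) =
      DerivedCategory.Q.map (adj.mapCochainComplex.unit.app W) ≫
        F.mapDerivedCategoryFactors.inv.app
          ((G.mapHomologicalComplex (ComplexShape.up ℤ)).obj W) ≫
        F.mapDerivedCategory.map (G.mapDerivedCategoryFactors.inv.app W) := by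
  let : CatCommSq (G.mapHomologicalComplex (ComplexShape.up ℤ)) DerivedCategory.Q
    DerivedCategory.Q G.mapDerivedCategory := ⟨G.mapDerivedCategoryFactors.symm⟩
  let : CatCommSq (F.mapHomologicalComplex (ComplexShape.up ℤ)) DerivedCategory.Q
    DerivedCategory.Q F.mapDerivedCategory := ⟨F.mapDerivedCategoryFactors.symm⟩
  exact adj.mapCochainComplex.localization_unit_app DerivedCategory.Q
    (HomologicalComplex.quasiIso B (ComplexShape.up ℤ)) DerivedCategory.Q
    (HomologicalComplex.quasiIso A (ComplexShape.up ℤ)) _ _ W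

end

end CategoryTheory.Adjunction

/-! ### Scalar extension on derived categories -/

namespace BObj

section

variable (k : Type*) [CommRing k] (L : Type*) [CommRing L] [Algebra k L] [Module.Free k L]
  (D : Type u) [Category.{v} D] [Abelian D] [Linear k D]
  [HasCoproductsOfShape (Module.Free.ChooseBasisIndex k L) D]

set_option linter.unusedSectionVars false

instance : PreservesFiniteColimits (free k L D) :=
  have := (freeAdjunction k L D).leftAdjoint_preservesColimits
  inferInstance

variable {k L D} in
/-- The underlying object of `L ⊗ W` is a coproduct of copies of `W`. -/
noncomputable def isColimitFree (W : D) :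
    IsColimit (Cofan.mk ((free k L D).obj W).obj
      fun j => freeIncl k W (Module.Free.chooseBasis k L j)) :=
  IsColimit.ofIsoColimit (coproductIsCoproduct
      (fun _ : Module.Free.ChooseBasisIndex k L => W))
    (Cofan.ext (Iso.refl _) (fun j => (Category.comp_id _).trans
      ((Module.Free.chooseBasis k L).constr_basis k _ j).symm))

variable [HasExactColimitsOfShape (Discrete (Module.Free.ChooseBasisIndex k L)) D]

/-- The underlying object of `L ⊗ W` as a colimit, naturally in `W`. -/
noncomputable def freeCompForget : free k L D ⋙ forget k L D ≅
    Functor.const (Discrete (Module.Free.ChooseBasisIndex k L)) ⋙ colim :=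
  NatIso.ofComponents (fun W => (isColimitFree W).coconePointUniqueUpToIso
      (colimit.isColimit ((Functor.const _).obj W))) (fun {W W'} f =>
    Cofan.IsColimit.hom_ext (isColimitFree W) _ _ fun j => by
      have h : ∀ W : D, freeIncl k W (Module.Free.chooseBasis k L j) ≫
          ((isColimitFree W).coconePointUniqueUpToIso
            (colimit.isColimit ((Functor.const _).obj W))).hom =
          colimit.ι ((Functor.const (Discrete (Module.Free.ChooseBasisIndex k L))).obj W) ⟨j⟩ :=
        fun W => (isColimitFree W).comp_coconePointUniqueUpToIso_hom _ ⟨j⟩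
      have h1 : freeIncl k W (Module.Free.chooseBasis k L j) ≫ ((free k L D).map f).hom ≫
          ((isColimitFree W').coconePointUniqueUpToIso
            (colimit.isColimit ((Functor.const _).obj W'))).hom =
          f ≫ colimit.ι ((Functor.const _).obj W') ⟨j⟩ := by
        rw [← Category.assoc, freeIncl_map, Category.assoc, h]
      refine h1.trans (Eq.trans ?_ (Category.assoc _ _ _))
      exact (ι_colimMap ((Functor.const _).map f) _).symm.trans (congrArg (fun t => t ≫ _) (h W).symm))

/-- Underlying `L ⊗ W` is a coproduct of copies of `W`, coproducts are exact by assumption, and the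
forgetful functor reflects finite limits. -/
instance : PreservesFiniteLimits (free k L D) := by
  have : PreservesFiniteLimits (free k L D ⋙ forget k L D) :=
    preservesFiniteLimits_of_natIso (freeCompForget k L D).symm
  exact preservesFiniteLimits_of_reflects_of_preserves _ (forget k L D)

/-- The forgetful functor on derived categories. -/
noncomputable abbrev dForget : DerivedCategory (BObj k L D) ⥤ DerivedCategory D :=
  (forget k L D).mapDerivedCategory

/-- The functor `W ↦ L ⊗ W` on derived categories. -/
noncomputable abbrev dFree : DerivedCategory D ⥤ DerivedCategory (BObj k L D) :=
  (free k L D).mapDerivedCategory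

/-- The adjunction between `L ⊗ -` and the forgetful functor on derived categories. -/
noncomputable abbrev dAdj : dFree k L D ⊣ dForget k L D := (freeAdjunction k L D).mapDerived

/-- The functor sending an object of the derived category of `L`-objects to its underlying object,
with the induced action of `L`. -/
noncomputable abbrev dLift : DerivedCategory (BObj k L D) ⥤ BObj k L (DerivedCategory D) where
  obj X :=
    { obj := (dForget k L D).obj X
      ρ := ((tautological k L (DerivedCategory (BObj k L D)) ⋙
        BObj.map L (dForget k L D)).obj X).ρ }
  map f :=
    { hom := (dForget k L D).map f
      comm := ((tautological k L (DerivedCategory (BObj k L D)) ⋙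
        BObj.map L (dForget k L D)).map f).comm }

/-- The morphism `w ↦ b ⊗ w` in the derived category. -/
noncomputable def dIncl (W : DerivedCategory D) (b : L) :
    W ⟶ (dForget k L D).obj ((dFree k L D).obj W) :=
  (dAdj k L D).unit.app W ≫ (dForget k L D).map (b • 𝟙 ((dFree k L D).obj W))

variable {k L D}

lemma dIncl_one (W : DerivedCategory D) : dIncl k L D W 1 = (dAdj k L D).unit.app W := by
  rw [dIncl, one_smul, CategoryTheory.Functor.map_id]
  exact Category.comp_id _

lemma dIncl_add (W : DerivedCategory D) (a b : L) :
    dIncl k L D W (a + b) = dIncl k L D W a + dIncl k L D W b := by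
  simp only [dIncl]
  rw [add_smul, Functor.map_add]
  exact Preadditive.comp_add _ _ _ _ _ _

lemma dIncl_smul (W : DerivedCategory D) (c : k) (b : L) :
    dIncl k L D W (c • b) = c • dIncl k L D W b := by
  simp only [dIncl]
  rw [smul_assoc, Functor.map_smul]
  exact Linear.comp_smul _ _ _ _ _ _

lemma dIncl_naturality {W W' : DerivedCategory D} (f : W ⟶ W') (b : L) :
    dIncl k L D W b ≫ (dForget k L D).map ((dFree k L D).map f) = f ≫ dIncl k L D W' b := by
  have h := (dAdj k L D).unit.naturality f
  dsimp at h
  simp only [dIncl, Category.assoc]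
  rw [reassoc_of% h]
  refine congrArg (fun t => _ ≫ t) ?_
  refine ((dForget k L D).map_comp _ _).symm.trans
    (Eq.trans (congrArg _ ?_) ((dForget k L D).map_comp _ _))
  simp

/-- The morphism `w ↦ b ⊗ w` of complexes. -/
noncomputable def complexIncl (W : CochainComplex D ℤ) (b : L) :
    W ⟶ ((forget k L D).mapHomologicalComplex (ComplexShape.up ℤ)).obj
      (((free k L D).mapHomologicalComplex (ComplexShape.up ℤ)).obj W) :=
  (freeAdjunction k L D).mapCochainComplex.unit.app W ≫
    ((forget k L D).mapHomologicalComplex (ComplexShape.up ℤ)).map (b • 𝟙 _)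

lemma complexIncl_f (W : CochainComplex D ℤ) (b : L) (n : ℤ) :
    (complexIncl (k := k) W b).f n = freeIncl k (W.X n) b := by
  have h : (complexIncl (k := k) W b).f n = freeIncl k (W.X n) (1 : L) ≫
      ((free k L D).obj (W.X n)).act b := by
    refine (congrArg (fun t => t ≫ _) (freeAdjunction_unit_app (k := k) (L := L) (W.X n))).trans ?_
    exact congrArg (fun t => freeIncl k (W.X n) (1 : L) ≫ t) (Category.id_comp _)
  rw [h, freeIncl_act, mul_one]

/-- The functor `L ⊗ -` on derived categories is induced by that on complexes. -/
noncomputable def dComparison (W : CochainComplex D ℤ) :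
    DerivedCategory.Q.obj (((forget k L D).mapHomologicalComplex (ComplexShape.up ℤ)).obj
      (((free k L D).mapHomologicalComplex (ComplexShape.up ℤ)).obj W)) ⟶
    (dForget k L D).obj ((dFree k L D).obj (DerivedCategory.Q.obj W)) :=
  (forget k L D).mapDerivedCategoryFactors.inv.app
      (((free k L D).mapHomologicalComplex (ComplexShape.up ℤ)).obj W) ≫
    (dForget k L D).map ((free k L D).mapDerivedCategoryFactors.inv.app W)

instance (W : CochainComplex D ℤ) : IsIso (dComparison (k := k) (L := L) W) := by
  unfold dComparison
  exact IsIso.comp_isIso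

/-- The derived unit is computed by the unit on complexes, so the inclusions `w ↦ b ⊗ w` may be
taken degreewise and the results on coproducts apply to them. -/
lemma dIncl_Q_obj (W : CochainComplex D ℤ) (b : L) :
    dIncl k L D (DerivedCategory.Q.obj W) b = DerivedCategory.Q.map (complexIncl W b) ≫
      dComparison W := by
  let X := ((free k L D).mapHomologicalComplex (ComplexShape.up ℤ)).obj W
  let β : DerivedCategory.Q.obj X ⟶ (dFree k L D).obj (DerivedCategory.Q.obj W) :=
    (free k L D).mapDerivedCategoryFactors.inv.app W
  let α : DerivedCategory.Q.obj (((forget k L D).mapHomologicalComplex (ComplexShape.up ℤ)).obj X) ⟶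
    (dForget k L D).obj (DerivedCategory.Q.obj X) :=
    (forget k L D).mapDerivedCategoryFactors.inv.app X
  let η : W ⟶ ((forget k L D).mapHomologicalComplex (ComplexShape.up ℤ)).obj X :=
    (freeAdjunction k L D).mapCochainComplex.unit.app W
  have h0 : (dAdj k L D).unit.app (DerivedCategory.Q.obj W) =
    DerivedCategory.Q.map η ≫ α ≫ (dForget k L D).map β :=
    (freeAdjunction k L D).mapDerived_unit_app W
  have h1 : β ≫ (b • 𝟙 _) = DerivedCategory.Q.map (b • 𝟙 X) ≫ β := by
    rw [Functor.map_smul, CategoryTheory.Functor.map_id, Linear.comp_smul, Linear.smul_comp,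
      Category.id_comp, Category.comp_id]
  have h2 : α ≫ (dForget k L D).map (DerivedCategory.Q.map (b • 𝟙 X)) = DerivedCategory.Q.map
      (((forget k L D).mapHomologicalComplex (ComplexShape.up ℤ)).map (b • 𝟙 X)) ≫ α :=
    ((forget k L D).mapDerivedCategoryFactors.inv.naturality (b • 𝟙 X)).symm
  have h3 : complexIncl W b =
    η ≫ ((forget k L D).mapHomologicalComplex (ComplexShape.up ℤ)).map (b • 𝟙 X) := rfl
  have h4 : (DerivedCategory.Q.map η ≫ α ≫ (dForget k L D).map β) ≫
      (dForget k L D).map (b • 𝟙 ((dFree k L D).obj (DerivedCategory.Q.obj W))) =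
    DerivedCategory.Q.map (complexIncl W b) ≫ α ≫ (dForget k L D).map β := by
    rw [h3, Functor.map_comp, Category.assoc, Category.assoc, Category.assoc, ← Functor.map_comp,
      h1, Functor.map_comp, reassoc_of% h2]
  exact (congrArg (fun t => t ≫ _) h0).trans h4

/-- In the derived category `L ⊗ W` is still a coproduct of copies of `W` indexed by a basis of `L`;
by linearity, prescribing a morphism on that basis prescribes it for all `b`. -/
lemma exists_dIncl_comp {W Y : DerivedCategory D} (φ : L →ₗ[k] (W ⟶ Y)) :
    ∃ ψ : (dForget k L D).obj ((dFree k L D).obj W) ⟶ Y, ∀ b, dIncl k L D W b ≫ ψ = φ b := by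
  suffices h : ∃ ψ : (dForget k L D).obj ((dFree k L D).obj W) ⟶ Y, ∀ j,
      dIncl k L D W (Module.Free.chooseBasis k L j) ≫ ψ = φ (Module.Free.chooseBasis k L j) by
    obtain ⟨ψ, hψ⟩ := h
    let φ' : L →ₗ[k] (W ⟶ Y) :=
      { toFun := fun b => dIncl k L D W b ≫ ψ
        map_add' := fun a b => by rw [dIncl_add, Preadditive.add_comp]
        map_smul' := fun c b => by rw [dIncl_smul, Linear.smul_comp, RingHom.id_apply] }
    have : φ' = φ := (Module.Free.chooseBasis k L).ext hψ
    exact ⟨ψ, fun b => LinearMap.congr_fun this b⟩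
  let e := DerivedCategory.Q.objObjPreimageIso W
  obtain ⟨ψ, hψ⟩ := DerivedCategory.exists_Q_desc
    (fun j => complexIncl (k := k) (DerivedCategory.Q.objPreimage W) (Module.Free.chooseBasis k L j))
    (fun n => IsColimit.ofIsoColimit (isColimitFree _)
      (Cofan.ext (Iso.refl _) fun j => (Category.comp_id _).trans (complexIncl_f _ _ n).symm))
    (fun j => e.hom ≫ φ (Module.Free.chooseBasis k L j))
  refine ⟨(dForget k L D).map ((dFree k L D).map e.inv) ≫ inv ((dComparison _)) ≫ ψ, fun j => ?_⟩
  rw [← Category.assoc, dIncl_naturality, Category.assoc, dIncl_Q_obj, Category.assoc,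
    IsIso.hom_inv_id_assoc, hψ, Iso.inv_hom_id_assoc]

lemma dIncl_hom_ext {W Y : DerivedCategory D}
    {ψ ψ' : (dForget k L D).obj ((dFree k L D).obj W) ⟶ Y}
    (h : ∀ b : L, dIncl k L D W b ≫ ψ = dIncl k L D W b ≫ ψ') : ψ = ψ' := by
  let e := DerivedCategory.Q.objObjPreimageIso W
  rw [← cancel_epi ((dForget k L D).map ((dFree k L D).map e.hom)),
    ← cancel_epi (dComparison (k := k) (L := L) _)]
  refine DerivedCategory.Q_hom_ext
    (fun j => complexIncl (k := k) (DerivedCategory.Q.objPreimage W) (Module.Free.chooseBasis k L j))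
    (fun n => IsColimit.ofIsoColimit (isColimitFree _)
      (Cofan.ext (Iso.refl _) fun j => (Category.comp_id _).trans (complexIncl_f _ _ n).symm))
    fun j => ?_
  rw [← Category.assoc, ← dIncl_Q_obj, ← Category.assoc, dIncl_naturality, Category.assoc, h,
    ← Category.assoc, ← Category.assoc, ← dIncl_naturality, Category.assoc, dIncl_Q_obj]

end

end BObj

namespace DerivedCategory

variable {D : Type u} [Category.{v} D] [Abelian D]

/-- The cohomology of a complex is the cohomology of its image in the derived category. -/
noncomputable def homologyQIso (K : CochainComplex D ℤ) (n : ℤ) :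
    (homologyFunctor D n).obj (Q.obj K) ≅ K.homology n :=
  (homologyFunctorFactors D n).app K

lemma homologyFunctor_map_Q_map {K K' : CochainComplex D ℤ} (f : K ⟶ K') (n : ℤ) :
    (homologyFunctor D n).map (Q.map f) =
      (homologyQIso K n).hom ≫ HomologicalComplex.homologyMap f n ≫ (homologyQIso K' n).inv := by
  have : (homologyFunctor D n).map (Q.map f) ≫ (homologyQIso K' n).hom =
      (homologyQIso K n).hom ≫ HomologicalComplex.homologyMap f n :=
    (homologyFunctorFactors D n).hom.naturality f
  rw [← reassoc_of% this, Iso.hom_inv_id, Category.comp_id]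

end DerivedCategory

namespace BObj

section

variable {k : Type*} [CommRing k] {L : Type*} [CommRing L] [Algebra k L] [Module.Free k L]
  {D : Type u} [Category.{v} D] [Abelian D] [Linear k D]
  [HasCoproductsOfShape (Module.Free.ChooseBasisIndex k L) D]
  [HasExactColimitsOfShape (Discrete (Module.Free.ChooseBasisIndex k L)) D]

/-! ### Free objects of the category of `L`-objects of the derived category -/

lemma dIncl_act (W : DerivedCategory D) (a b : L) :
    dIncl k L D W b ≫ ((dLift k L D).obj ((dFree k L D).obj W)).act a = dIncl k L D W (a * b) := by
  have h : (dForget k L D).map (b • 𝟙 ((dFree k L D).obj W)) ≫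
      (dForget k L D).map (a • 𝟙 ((dFree k L D).obj W)) =
      (dForget k L D).map ((a * b) • 𝟙 ((dFree k L D).obj W)) := by
    rw [← Functor.map_comp, Linear.smul_comp, Category.id_comp, smul_smul, mul_comm]
  exact (Category.assoc _ _ _).trans (congrArg (fun t => (dAdj k L D).unit.app W ≫ t) h)

lemma dIncl_comp_hom {W : DerivedCategory D} {Z : BObj k L (DerivedCategory D)}
    (f : (dLift k L D).obj ((dFree k L D).obj W) ⟶ Z) (b : L) :
    dIncl k L D W b ≫ f.hom = (dIncl k L D W 1 ≫ f.hom) ≫ Z.act b := by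
  rw [Category.assoc, ← f.comm, ← Category.assoc, dIncl_act, mul_one]

lemma dLift_hom_ext {W : DerivedCategory D} {Z : BObj k L (DerivedCategory D)}
    {f g : (dLift k L D).obj ((dFree k L D).obj W) ⟶ Z}
    (h : dIncl k L D W 1 ≫ f.hom = dIncl k L D W 1 ≫ g.hom) : f = g :=
  hom_ext (dIncl_hom_ext fun b => by
    refine (dIncl_comp_hom f b).trans (Eq.trans ?_ (dIncl_comp_hom g b).symm)
    rw [h])

/-- With `dLift_hom_ext`, this makes `L ⊗ W` the free `L`-object on `W` among the `L`-objects of the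
derived category. The morphism is `b ⊗ w ↦ b g(w)`. -/
lemma exists_dLift_hom {W : DerivedCategory D} {Z : BObj k L (DerivedCategory D)}
    (g : W ⟶ Z.obj) : ∃ f : (dLift k L D).obj ((dFree k L D).obj W) ⟶ Z,
      dIncl k L D W 1 ≫ f.hom = g := by
  obtain ⟨ψ, hψ⟩ := exists_dIncl_comp (k := k) (L := L)
    { toFun := fun b => g ≫ Z.act b
      map_add' := fun a b => by rw [act_add, Preadditive.comp_add]
      map_smul' := fun c b => by rw [act_smul, Linear.comp_smul, RingHom.id_apply] }
  have hψ' : ∀ b, dIncl k L D W b ≫ ψ = g ≫ Z.act b := hψ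
  have hcomm : ∀ a : L, ((dLift k L D).obj ((dFree k L D).obj W)).act a ≫ ψ = ψ ≫ Z.act a :=
    fun a => dIncl_hom_ext fun b => by
      have h1 : dIncl k L D W b ≫ ((dLift k L D).obj ((dFree k L D).obj W)).act a ≫ ψ =
          g ≫ Z.act (a * b) := by
        rw [← hψ', ← dIncl_act]; exact (Category.assoc _ _ _).symm
      exact h1.trans (by rw [act_mul, ← Category.assoc, ← hψ', Category.assoc])
  refine ⟨⟨ψ, hcomm⟩, ?_⟩
  have := hψ' 1
  rwa [act_one, Category.comp_id] at this

variable (k L) in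
/-- The action map `L ⊗ Z ⟶ Z` in the category of `L`-objects of the derived category. -/
noncomputable def dActMap (Z : BObj k L (DerivedCategory D)) :
    (dLift k L D).obj ((dFree k L D).obj Z.obj) ⟶ Z :=
  (exists_dLift_hom (𝟙 Z.obj)).choose

lemma dIncl_dActMap (Z : BObj k L (DerivedCategory D)) :
    dIncl k L D Z.obj 1 ≫ (dActMap k L Z).hom = 𝟙 Z.obj :=
  (exists_dLift_hom (𝟙 Z.obj)).choose_spec

/-- A morphism out of a relatively projective object of the derived category of `L`-objects is
determined by the underlying morphism. -/
lemma dForget_map_injective_of_relProj {X Y : DerivedCategory (BObj k L D)}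
    (hX : (dAdj k L D).RelProj X) {f g : X ⟶ Y}
    (h : (dForget k L D).map f = (dForget k L D).map g) : f = g := by
  obtain ⟨s, hs⟩ := hX
  have hf := (dAdj k L D).counit.naturality f
  have hg := (dAdj k L D).counit.naturality g
  dsimp at hf hg
  rw [h, hg] at hf
  rw [← Category.id_comp f, ← Category.id_comp g, ← hs, Category.assoc, Category.assoc, hf]

/-- The morphism `L ⊗ h` always lifts, and as `h` commutes with `L` it is compatible with the action
maps. A section of the action map of `X` then carries the lift down to `X`. -/
lemma exists_dLift_map_of_relProj {X Y : DerivedCategory (BObj k L D)}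
    (hX : (dAdj k L D).RelProj X) (h : (dLift k L D).obj X ⟶ (dLift k L D).obj Y) :
    ∃ f : X ⟶ Y, (dLift k L D).map f = h := by
  obtain ⟨s, hs⟩ := hX
  have key : (dLift k L D).map ((dFree k L D).map h.hom ≫ (dAdj k L D).counit.app Y) =
      (dLift k L D).map ((dAdj k L D).counit.app X) ≫ h := by
    apply dLift_hom_ext
    have e1 : dIncl k L D ((dForget k L D).obj X) 1 ≫
        (dForget k L D).map ((dAdj k L D).counit.app X) = 𝟙 _ := by
      rw [dIncl_one]; exact (dAdj k L D).right_triangle_components X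
    have e2 : dIncl k L D ((dForget k L D).obj Y) 1 ≫
        (dForget k L D).map ((dAdj k L D).counit.app Y) = 𝟙 _ := by
      rw [dIncl_one]; exact (dAdj k L D).right_triangle_components Y
    have e3 := dIncl_naturality (k := k) (L := L)
      (h.hom : (dForget k L D).obj X ⟶ (dForget k L D).obj Y) 1
    have a1 : dIncl k L D ((dForget k L D).obj X) 1 ≫ (dForget k L D).map
        ((dFree k L D).map (h.hom : (dForget k L D).obj X ⟶ (dForget k L D).obj Y) ≫
          (dAdj k L D).counit.app Y) = h.hom := by
      rw [Functor.map_comp]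
      refine (Category.assoc _ _ _).symm.trans ((congrArg (fun t => t ≫ _) e3).trans ?_)
      refine (Category.assoc _ _ _).trans ((congrArg (fun t => _ ≫ t) e2).trans ?_)
      exact Category.comp_id _
    have a2 : dIncl k L D ((dForget k L D).obj X) 1 ≫
        ((dLift k L D).map ((dAdj k L D).counit.app X) ≫ h).hom = h.hom :=
      (Category.assoc _ _ _).symm.trans ((congrArg (fun t => t ≫ h.hom) e1).trans
        (Category.id_comp h.hom))
    exact a1.trans a2.symm
  refine ⟨s ≫ (dFree k L D).map h.hom ≫ (dAdj k L D).counit.app Y, ?_⟩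
  have : (dLift k L D).map s ≫ (dLift k L D).map ((dAdj k L D).counit.app X) = 𝟙 _ := by
    refine ((dLift k L D).map_comp _ _).symm.trans ?_
    exact (congrArg _ hs).trans ((dLift k L D).map_id X)
  rw [Functor.map_comp, key]
  exact (Category.assoc _ _ _).symm.trans ((congrArg (fun t => t ≫ h) this).trans
    (Category.id_comp h))

lemma dActMap_dLift (X : DerivedCategory (BObj k L D)) :
    dActMap k L ((dLift k L D).obj X) = (dLift k L D).map ((dAdj k L D).counit.app X) :=
  dLift_hom_ext ((dIncl_dActMap _).trans (by
    have := (dAdj k L D).right_triangle_components X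
    rw [← dIncl_one] at this
    exact this.symm))

/-! ### Cohomology of free objects -/

/-- Homology commutes with the exact functor that sends `W` to the object underlying `L ⊗ W`, and
compatibly with the natural transformation `w ↦ b ⊗ w`. The isomorphism `e` is the comparison for
the identity functor; it does not depend on `b`. -/
lemma exists_homologyMap_complexIncl (W : CochainComplex D ℤ) (n : ℤ) :
    ∃ (e : W.homology n ≅ W.homology n)
      (θ : ((free k L D).obj (W.homology n)).obj ≅
        (((forget k L D).mapHomologicalComplex (ComplexShape.up ℤ)).obj
          (((free k L D).mapHomologicalComplex (ComplexShape.up ℤ)).obj W)).homology n),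
      ∀ b : L, HomologicalComplex.homologyMap (complexIncl W b) n =
        e.hom ≫ freeIncl k (W.homology n) b ≫ θ.hom := by
  let τ : L → (𝟭 D ⟶ free k L D ⋙ forget k L D) := fun b =>
    { app := fun X => freeIncl k X b
      naturality := fun _ _ f => (freeIncl_map f b).symm }
  refine ⟨(W.sc n).mapHomologyIso (𝟭 D),
    ((W.sc n).mapHomologyIso (free k L D ⋙ forget k L D)).symm, fun b => ?_⟩
  refine Eq.trans ?_ ((W.sc n).homologyMap_mapNatTrans (τ b))
  have h : (HomologicalComplex.shortComplexFunctor D (ComplexShape.up ℤ) n).map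
    (complexIncl (k := k) W b) = (W.sc n).mapNatTrans (τ b) := by
    refine ShortComplex.hom_ext _ _ ?_ ?_ ?_
    · exact complexIncl_f W b _
    · exact complexIncl_f W b _
    · exact complexIncl_f W b _
  exact congrArg (fun t => ShortComplex.homologyMap t) h

open DerivedCategory in
lemma exists_homology_map_dIncl (W : DerivedCategory D) (n : ℤ) :
    ∃ (X : D) (e : (homologyFunctor D n).obj W ≅ X) (θ : ((free k L D).obj X).obj ≅
        (homologyFunctor D n).obj ((dForget k L D).obj ((dFree k L D).obj W))),
      ∀ b : L, (homologyFunctor D n).map (dIncl k L D W b) = e.hom ≫ freeIncl k X b ≫ θ.hom := by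
  let e := Q.objObjPreimageIso W
  let W₀ := Q.objPreimage W
  obtain ⟨e', θ, h⟩ := exists_homologyMap_complexIncl (k := k) (L := L) W₀ n
  let a₁ : (homologyFunctor D n).obj W ≅ W₀.homology n :=
    (homologyFunctor D n).mapIso e.symm ≪≫ homologyQIso W₀ n ≪≫ e'
  let a₂ := θ ≪≫ (homologyQIso _ n).symm ≪≫
      (homologyFunctor D n).mapIso (asIso (dComparison W₀)) ≪≫
      (homologyFunctor D n).mapIso ((dForget k L D).mapIso ((dFree k L D).mapIso e))
  have ha₁ : a₁.hom = (homologyFunctor D n).map e.inv ≫ (homologyQIso W₀ n).hom ≫ e'.hom := rfl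
  have ha₂ : a₂.hom = θ.hom ≫ (homologyQIso _ n).inv ≫ (homologyFunctor D n).map (dComparison W₀) ≫
    (homologyFunctor D n).map ((dForget k L D).map ((dFree k L D).map e.hom)) := rfl
  refine ⟨W₀.homology n, a₁, a₂, fun b => ?_⟩
  have h1 : dIncl k L D W b = e.inv ≫ Q.map (complexIncl W₀ b) ≫ dComparison W₀ ≫
      (dForget k L D).map ((dFree k L D).map e.hom) := by
    rw [← Category.assoc (Q.map _), ← dIncl_Q_obj, dIncl_naturality, Iso.inv_hom_id_assoc]
  rw [h1, ha₁, ha₂, Functor.map_comp, Functor.map_comp, Functor.map_comp, homologyFunctor_map_Q_map,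
    h b]
  simp only [Category.assoc]
  rfl

open DerivedCategory in
/-- The cohomology of `L ⊗ W` is `L ⊗ H^n(W)`. -/
lemma exists_iso_homology_dFree (W : DerivedCategory D) (n : ℤ) :
    ∃ c : (free k L D).obj ((homologyFunctor D n).obj W) ≅
        (BObj.map L (homologyFunctor D n)).obj ((dLift k L D).obj ((dFree k L D).obj W)),
      ∀ b, freeIncl k ((homologyFunctor D n).obj W) b ≫ c.hom.hom =
        (homologyFunctor D n).map (dIncl k L D W b) := by
  obtain ⟨X, e, θ, h⟩ := exists_homology_map_dIncl (k := k) (L := L) W n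
  let c : ((free k L D).obj ((homologyFunctor D n).obj W)).obj ≅
    (homologyFunctor D n).obj ((dForget k L D).obj ((dFree k L D).obj W)) :=
    (forget k L D).mapIso ((free k L D).mapIso e) ≪≫ θ
  have hc : ∀ b, freeIncl k ((homologyFunctor D n).obj W) b ≫ c.hom =
      (homologyFunctor D n).map (dIncl k L D W b) := fun b => by
    have h1 : freeIncl k ((homologyFunctor D n).obj W) b ≫ ((free k L D).map e.hom).hom ≫ θ.hom =
        (homologyFunctor D n).map (dIncl k L D W b) := by
      rw [h b, ← Category.assoc, freeIncl_map, Category.assoc]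
    exact h1
  refine ⟨isoMk c fun a => freeIncl_hom_ext fun b => ?_, hc⟩
  have h1 : freeIncl k ((homologyFunctor D n).obj W) b ≫
      ((free k L D).obj ((homologyFunctor D n).obj W)).act a ≫ c.hom =
      (homologyFunctor D n).map (dIncl k L D W (a * b)) := by
    rw [← Category.assoc, freeIncl_act, hc]
  refine h1.trans ?_
  rw [← dIncl_act]
  refine ((homologyFunctor D n).map_comp _ _).trans ?_
  exact (congrArg (fun t => t ≫ _) (hc b).symm).trans (Category.assoc _ _ _)

end

end BObj

/-! ### Split epimorphisms in pretriangulated categories -/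

namespace CategoryTheory.Pretriangulated

/-- A section of `p` forces the connecting morphism to vanish, so `ι` is a monomorphism and `𝟙 - p ≫
s` factors uniquely through it. -/
lemma exists_splitting_of_mor₃_eq_zero {E : Type u} [Category.{v} E] [Preadditive E] [HasZeroObject E]
    [HasShift E ℤ] [∀ n : ℤ, (shiftFunctor E n).Additive] [Pretriangulated E]
    {K P V : E} {ι : K ⟶ P} {p : P ⟶ V} {h : V ⟶ K⟦(1 : ℤ)⟧} (hT : Triangle.mk ι p h ∈ distTriang E)
    (s : V ⟶ P) (hs : s ≫ p = 𝟙 V) :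
    ι ≫ p = 0 ∧ ∃ r : P ⟶ K, ι ≫ r = 𝟙 K ∧ r ≫ ι + p ≫ s = 𝟙 P := by
  have h1 : ι ≫ p = 0 := comp_distTriang_mor_zero₁₂ _ hT
  have h2 : p ≫ h = 0 := comp_distTriang_mor_zero₂₃ _ hT
  have h3 : h = 0 := by rw [← Category.id_comp h, ← hs, Category.assoc, h2, comp_zero]
  have hm : Mono ι := (Triangle.mor₃_eq_zero_iff_mono₁ _ hT).1 h3
  have h4 : (𝟙 P - p ≫ s) ≫ p = 0 := by
    rw [Preadditive.sub_comp, Category.id_comp, Category.assoc, hs, Category.comp_id, sub_self]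
  obtain ⟨r, hr'⟩ : ∃ r : P ⟶ K, 𝟙 P - p ≫ s = r ≫ ι :=
    Triangle.coyoneda_exact₂ _ hT (𝟙 P - p ≫ s) h4
  refine ⟨h1, r, ?_, by rw [← hr', sub_add_cancel]⟩
  rw [← cancel_mono ι, Category.assoc, ← hr', Preadditive.comp_sub, Category.comp_id,
    ← Category.assoc, h1, zero_comp, sub_zero, Category.id_comp]

end CategoryTheory.Pretriangulated

namespace CategoryTheory.Adjunction

/-- `S.X₁` is a kernel of the counit up to isomorphism, hence a retract of the syzygy. -/
lemma RelPD.of_shortExact {A : Type u} [Category.{v} A] [Abelian A] {B : Type u'} [Category.{v'} B]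
    [Abelian B] {G : B ⥤ A} {F : A ⥤ B} {adj : G ⊣ F} [F.Additive] [G.Additive]
    {S : ShortComplex A} (hS : S.ShortExact) (c : G.obj (F.obj S.X₃) ≅ S.X₂)
    (hc : c.hom ≫ S.g = adj.counit.app S.X₃) {n : ℕ} (h : adj.RelPD (n + 1) S.X₃) :
    adj.RelPD n S.X₁ := by
  have hm : Mono S.f := hS.mono_f
  have h1 : (adj.syzygyι S.X₃ ≫ c.hom) ≫ S.g = 0 := by
    rw [Category.assoc, hc, syzygyι_counit]
  obtain ⟨b, hb⟩ : ∃ b : adj.syzygy S.X₃ ⟶ S.X₁, b ≫ S.f = adj.syzygyι S.X₃ ≫ c.hom :=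
    ⟨_, hS.exact.lift_f _ h1⟩
  have ha : (S.f ≫ c.inv) ≫ adj.counit.app S.X₃ = 0 := by
    rw [← hc, Category.assoc, Iso.inv_hom_id_assoc, S.zero]
  refine RelPD.of_retract (adj := adj) (n := n) h (adj.syzygyLift _ ha) b ?_
  rw [← cancel_mono S.f, Category.assoc, hb, ← Category.assoc,
    syzygyLift_ι, Category.assoc, Iso.inv_hom_id, Category.comp_id, Category.id_comp]

end CategoryTheory.Adjunction

/-! ### Sequences that split after forgetting the action -/

namespace BObj

section

variable {k : Type*} [CommRing k] {L : Type*} [CommRing L] [Algebra k L]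
  {E : Type u} [Category.{v} E] [Preadditive E] [Linear k E]
  {E' : Type u'} [Category.{v'} E'] [Preadditive E'] [Linear k E']

/-- The kernel of a morphism of `L`-objects whose underlying morphism is a split epimorphism. -/
lemma exists_relSplitting {P V : BObj k L E} (p : P ⟶ V) {K : E} {ι : K ⟶ P.obj} {r : P.obj ⟶ K}
    {s : V.obj ⟶ P.obj} (hs : s ≫ p.hom = 𝟙 _) (hι : ι ≫ p.hom = 0) (hr : ι ≫ r = 𝟙 K)
    (hrs : r ≫ ι + p.hom ≫ s = 𝟙 _) :
    ∃ (K' : BObj k L E) (i : K' ⟶ P), Nonempty (Adjunction.RelSplitting (forget k L E) i p) := by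
  -- The action of `P` preserves the kernel of `p`, so compressing it by `ι` and `r` loses nothing.
  have key : ∀ b, (ι ≫ P.act b ≫ r) ≫ ι = ι ≫ P.act b := fun b => by
    rw [Category.assoc, Category.assoc, eq_sub_of_add_eq hrs, Preadditive.comp_sub,
      Category.comp_id, Preadditive.comp_sub, ← Category.assoc (P.act b), p.comm,
      Category.assoc, ← Category.assoc ι, hι, zero_comp, sub_zero]
  have hm : ∀ {f g : K ⟶ K}, f ≫ ι = g ≫ ι → f = g := fun {f g} h => by
    rw [← Category.comp_id f, ← Category.comp_id g, ← hr, ← Category.assoc, h, Category.assoc]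
  let K' : BObj k L E := mk' K (fun b => ι ≫ P.act b ≫ r)
    (by rw [act_one, Category.id_comp, hr])
    (fun a b => hm (by rw [key, Category.assoc, key, ← Category.assoc, key, Category.assoc,
      act_mul]))
    (fun a b => by rw [act_add, Preadditive.add_comp, Preadditive.comp_add])
    (fun c b => by rw [act_smul, Linear.smul_comp, Linear.comp_smul])
  exact ⟨K', ⟨ι, key⟩, ⟨⟨r, s, hom_ext hι, hr, hs, hrs⟩⟩⟩

/-- Additive functors preserve split sequences. -/
def mapRelSplitting (T : E ⥤ E') [T.Additive] [T.Linear k] {K P V : BObj k L E} {f : K ⟶ P}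
    {g : P ⟶ V} (σ : Adjunction.RelSplitting (forget k L E) f g) :
    Adjunction.RelSplitting (forget k L E') ((BObj.map L T).map f) ((BObj.map L T).map g) where
  r := T.map σ.r
  s := T.map σ.s
  w := hom_ext (by
    have h : f.hom ≫ g.hom = 0 := congrArg Hom.hom σ.w
    exact (T.map_comp f.hom g.hom).symm.trans ((congrArg T.map h).trans (T.map_zero _ _)))
  f_r := by
    have h : f.hom ≫ σ.r = 𝟙 _ := σ.f_r
    exact (T.map_comp f.hom σ.r).symm.trans ((congrArg T.map h).trans (T.map_id _))
  s_g := by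
    have h : σ.s ≫ g.hom = 𝟙 _ := σ.s_g
    exact (T.map_comp σ.s g.hom).symm.trans ((congrArg T.map h).trans (T.map_id _))
  id := by
    let r : P.obj ⟶ K.obj := σ.r
    let s : V.obj ⟶ P.obj := σ.s
    have h : r ≫ f.hom + g.hom ≫ s = 𝟙 _ := σ.id
    have h' : T.map r ≫ T.map f.hom + T.map g.hom ≫ T.map s = 𝟙 _ := by
      rw [← T.map_comp, ← T.map_comp, ← T.map_add, h]
      exact T.map_id _
    exact h'

end

section

variable {k : Type*} [CommRing k] {L : Type*} [CommRing L] [Algebra k L]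
  {D : Type u} [Category.{v} D] [Abelian D] [Linear k D]

open DerivedCategory

/-- The cohomology of an `L`-object of the derived category, as an `L`-object. -/
noncomputable abbrev homologyL (k : Type*) [CommRing k] (L : Type*) [CommRing L] [Algebra k L]
    (D : Type u) [Category.{v} D] [Abelian D] [Linear k D] (n : ℤ) :
    BObj k L (DerivedCategory D) ⥤ BObj k L D :=
  BObj.map L (homologyFunctor D n)

/-- The cohomology of an object of the derived category of `L`-objects. -/
noncomputable def homologyLiftIso (X : DerivedCategory (BObj k L D)) (n : ℤ) :
    (homologyL k L D n).obj ((dLift k L D).obj X) ≅ (homologyFunctor (BObj k L D) n).obj X :=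
  isoMk ((mapDerivedHomologyIso (forget k L D) n).app X) (fun b => by
    have h1 := (mapDerivedHomologyIso (forget k L D) n).hom.naturality (b • 𝟙 X)
    refine h1.trans (congrArg (fun t => _ ≫ t) ?_)
    have h2 : (homologyFunctor (BObj k L D) n).map (b • 𝟙 X) = b • 𝟙 _ := by
      rw [Functor.map_smul, CategoryTheory.Functor.map_id]
    refine (congrArg (forget k L D).map h2).trans ?_
    exact Category.id_comp _)

lemma homologyLiftIso_naturality {X Y : DerivedCategory (BObj k L D)} (f : X ⟶ Y) (n : ℤ) :
    (homologyL k L D n).map ((dLift k L D).map f) ≫ (homologyLiftIso Y n).hom =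
      (homologyLiftIso X n).hom ≫ (homologyFunctor (BObj k L D) n).map f :=
  hom_ext ((mapDerivedHomologyIso (forget k L D) n).hom.naturality f)

/-- Isomorphisms are detected on cohomology, and the cohomology in `L`-objects is that of the
underlying complex with its induced action. -/
lemma isIso_of_isIso_dForget_map {X Y : DerivedCategory (BObj k L D)} (f : X ⟶ Y)
    (h : IsIso ((dForget k L D).map f)) : IsIso f := by
  rw [DerivedCategory.isIso_iff]
  intro n
  have : IsIso ((dLift k L D).map f) :=
    have : IsIso ((forget k L (DerivedCategory D)).map ((dLift k L D).map f)) := h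
    isIso_of_reflects_iso _ (forget k L (DerivedCategory D))
  have h1 : (homologyFunctor (BObj k L D) n).map f = (homologyLiftIso X n).inv ≫
      (homologyL k L D n).map ((dLift k L D).map f) ≫ (homologyLiftIso Y n).hom := by
    rw [homologyLiftIso_naturality, Iso.inv_hom_id_assoc]
  rw [h1]
  infer_instance

end

/-! ### Relative syzygies in the derived category -/

section

variable {k : Type*} [CommRing k] {L : Type*} [CommRing L] [Algebra k L] [Module.Free k L]
  {D : Type u} [Category.{v} D] [Abelian D] [Linear k D]
  [HasCoproductsOfShape (Module.Free.ChooseBasisIndex k L) D]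
  [HasExactColimitsOfShape (Discrete (Module.Free.ChooseBasisIndex k L)) D]

open DerivedCategory

/-- Derived categories lack kernels in general, but the action map is split by `z ↦ 1 ⊗ z`. The
third vertex of a triangle on it is therefore a genuine kernel and inherits the action of `L`. -/
lemma exists_dSyzygy (Z : BObj k L (DerivedCategory D)) :
    ∃ (K : BObj k L (DerivedCategory D)) (i : K ⟶ (dLift k L D).obj ((dFree k L D).obj Z.obj)),
      Nonempty (Adjunction.RelSplitting (forget k L (DerivedCategory D)) i (dActMap k L Z)) := by
  obtain ⟨K, ι, h, hT⟩ := Pretriangulated.distinguished_cocone_triangle₁ (dActMap k L Z).hom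
  obtain ⟨h1, r, h2, h3⟩ := Pretriangulated.exists_splitting_of_mor₃_eq_zero hT _ (dIncl_dActMap Z)
  exact exists_relSplitting (dActMap k L Z) (dIncl_dActMap Z) h1 h2 h3

/-- If `K` is the kernel of the action map `L ⊗ Z ⟶ Z`, then the cohomology of `K` is the
relative syzygy of the cohomology of `Z`. -/
lemma relPD_homology_of_splitting {Z K : BObj k L (DerivedCategory D)}
    {i : K ⟶ (dLift k L D).obj ((dFree k L D).obj Z.obj)}
    (σ : Adjunction.RelSplitting (forget k L (DerivedCategory D)) i (dActMap k L Z)) {n : ℕ} {m : ℤ}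
    (hZ : (freeAdjunction k L D).RelPD (n + 1) ((homologyL k L D m).obj Z)) :
    (freeAdjunction k L D).RelPD n ((homologyL k L D m).obj K) := by
  obtain ⟨c, hc⟩ := exists_iso_homology_dFree (k := k) (L := L) Z.obj m
  let adj := freeAdjunction k L D
  have hS := (mapRelSplitting (homologyFunctor D m) σ).shortExact
  -- Under `H^m(L ⊗ Z) ≅ L ⊗ H^m(Z)`, the cohomology of the action map is the action map of the
  -- cohomology.
  have hcg : c.hom ≫ (homologyL k L D m).map (dActMap k L Z) =
      adj.counit.app ((homologyL k L D m).obj Z) := by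
    refine free_hom_ext ((Category.assoc _ _ _).symm.trans ?_)
    refine (congrArg (fun t => t ≫ _) (hc 1)).trans ?_
    refine ((homologyFunctor D m).map_comp _ _).symm.trans ?_
    refine (congrArg _ (dIncl_dActMap Z)).trans ?_
    refine Eq.trans ?_ (freeIncl_actMap ((homologyL k L D m).obj Z) 1).symm
    rw [act_one]
    exact (homologyFunctor D m).map_id _
  exact Adjunction.RelPD.of_shortExact hS c hcg hZ

end

end BObj

/-! ### Dévissage in bounded derived categories -/

namespace DerivedCategory

open Pretriangulated

variable {A : Type u} [Category.{v} A] [Abelian A]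

/-- The truncation triangle, with its effect on cohomology. -/
lemma exists_truncation_triangle (X : DerivedCategory A) (n₀ n₁ : ℤ) (hn : n₀ + 1 = n₁) :
    ∃ (Y Z : DerivedCategory A) (f : Y ⟶ X) (g : X ⟶ Z) (h : Z ⟶ Y⟦(1 : ℤ)⟧),
      Triangle.mk f g h ∈ distTriang _ ∧ Y.IsLE n₀ ∧ Z.IsGE n₁ ∧
      (∀ m, m ≤ n₀ → IsIso ((homologyFunctor A m).map f)) ∧
      ∀ m, n₁ ≤ m → IsIso ((homologyFunctor A m).map g) := by
  obtain ⟨Y, Z, hY, hZ, f, g, h, hT⟩ := TStructure.t.exists_triangle X n₀ n₁ hn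
  have hY' : Y.IsLE n₀ := ⟨hY⟩
  have hZ' : Z.IsGE n₁ := ⟨hZ⟩
  refine ⟨Y, Z, f, g, h, hT, hY', hZ', fun m hm => ?_, fun m hm => ?_⟩
  · have h1 : Mono ((homologyFunctor A m).map f) :=
      (HomologySequence.mono_homologyMap_mor₁_iff _ hT (m - 1) m).2
        ((isZero_of_isGE Z n₁ (m - 1) (by lia)).eq_of_src _ _)
    have h2 : Epi ((homologyFunctor A m).map f) :=
      (HomologySequence.epi_homologyMap_mor₁_iff _ hT m).2
        ((isZero_of_isGE Z n₁ m (by lia)).eq_of_tgt _ _)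
    exact isIso_of_mono_of_epi _
  · have h1 : Mono ((homologyFunctor A m).map g) :=
      (HomologySequence.mono_homologyMap_mor₂_iff _ hT m).2
        ((isZero_of_isLE Y n₀ m (by lia)).eq_of_src _ _)
    have h2 : Epi ((homologyFunctor A m).map g) :=
      (HomologySequence.epi_homologyMap_mor₂_iff _ hT m (m + 1)).2
        ((isZero_of_isLE Y n₀ (m + 1) (by lia)).eq_of_tgt _ _)
    exact isIso_of_mono_of_epi _

lemma isGE_of_isIso_homology {X Y : DerivedCategory A} {a : ℤ} [hX : X.IsGE a]
    (h : ∀ m, m < a → Nonempty ((homologyFunctor A m).obj Y ≅ (homologyFunctor A m).obj X) ∨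
      IsZero ((homologyFunctor A m).obj Y)) : Y.IsGE a :=
  (isGE_iff _ _).2 fun m hm => (h m hm).elim
    (fun ⟨e⟩ => (isZero_of_isGE X a m hm).of_iso e) id

lemma isLE_of_isIso_homology {X Y : DerivedCategory A} {a : ℤ} [hX : X.IsLE a]
    (h : ∀ m, a < m → Nonempty ((homologyFunctor A m).obj Y ≅ (homologyFunctor A m).obj X) ∨
      IsZero ((homologyFunctor A m).obj Y)) : Y.IsLE a :=
  (isLE_iff _ _).2 fun m hm => (h m hm).elim
    (fun ⟨e⟩ => (isZero_of_isLE X a m hm).of_iso e) id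

lemma nonempty_iso_single (X : DerivedCategory A) (n : ℤ) [X.IsGE n] [X.IsLE n] :
    Nonempty (X ≅ (singleFunctor A n).obj ((homologyFunctor A n).obj X)) := by
  obtain ⟨Y, ⟨e⟩⟩ := exists_iso_singleFunctor_obj_of_isGE_of_isLE X n
  exact ⟨e ≪≫ (singleFunctor A n).mapIso
    (((singleFunctorCompHomologyFunctorIso A n).app Y).symm ≪≫
      (homologyFunctor A n).mapIso e.symm)⟩

lemma bounded_iff (X : DerivedCategory A) :
    TStructure.t.bounded X ↔ ∃ a b : ℤ, X.IsGE a ∧ X.IsLE b :=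
  ⟨fun ⟨⟨a, ha⟩, ⟨b, hb⟩⟩ => ⟨a, b, ha, hb⟩, fun ⟨a, b, ha, hb⟩ => ⟨⟨a, ha⟩, ⟨b, hb⟩⟩⟩

/-- A property of objects of the derived category which is closed under extensions holds for a
bounded object if it holds for its cohomology objects. -/
lemma bounded_induction (P : ObjectProperty (DerivedCategory A)) [P.IsClosedUnderIsomorphisms]
    (hzero : ∀ X, IsZero X → P X)
    (hext : ∀ T : Triangle (DerivedCategory A), T ∈ distTriang _ → P T.obj₁ → P T.obj₃ → P T.obj₂)
    (X : DerivedCategory A) (hX : TStructure.t.bounded X)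
    (h : ∀ n, P ((singleFunctor A n).obj ((homologyFunctor A n).obj X))) : P X := by
  obtain ⟨a, b, ha, hb⟩ := (bounded_iff X).1 hX
  -- `N` bounds the number of degrees carrying cohomology, in the interval from `a` to `a + N - 1`;
  -- for `N = 0` the interval is empty and the object is zero.
  obtain ⟨N, hN⟩ : ∃ N : ℕ, b ≤ a + N - 1 := ⟨(b - a + 1).toNat, by lia⟩
  have hb' : X.IsLE (a + N - 1) := TStructure.t.isLE_of_le X b _ hN
  clear hN hb hX
  induction N generalizing X with
  | zero => exact hzero X (TStructure.t.isZero X (a + (0 : ℕ) - 1) a (by simp))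
  | succ N ih =>
    obtain ⟨Y, Z, f, g, δ, hT, hY, hZ, hf, hg⟩ :=
      exists_truncation_triangle X (a + N - 1) (a + N) (by lia)
    have hs : ∀ n M, IsZero M → P ((singleFunctor A n).obj M) := fun n M hM =>
      hzero _ ((singleFunctor A n).map_isZero hM)
    have hYa : Y.IsGE a := isGE_of_isIso_homology (X := X) fun m hm => by
      rcases le_or_gt m (a + N - 1) with h1 | h1
      · have := hf m h1
        exact Or.inl ⟨asIso ((homologyFunctor A m).map f)⟩
      · exact Or.inr (isZero_of_isLE Y _ m h1)
    have hXb : X.IsLE (a + N) := TStructure.t.isLE_of_le X (a + (N + 1 : ℕ) - 1) _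
      (by push_cast; lia)
    have hZb : Z.IsLE (a + N) := isLE_of_isIso_homology (X := X) fun m hm => by
      have := hg m (by lia)
      exact Or.inl ⟨(asIso ((homologyFunctor A m).map g)).symm⟩
    refine hext _ hT (ih Y (fun n => ?_) hYa hY) ?_
    · rcases le_or_gt n (a + N - 1) with h1 | h1
      · have := hf n h1
        exact P.prop_of_iso ((singleFunctor A n).mapIso
          (asIso ((homologyFunctor A n).map f)).symm) (h n)
      · exact hs _ _ (isZero_of_isLE Y _ n h1)
    · obtain ⟨e⟩ := nonempty_iso_single Z (a + N)
      have := hg (a + N) le_rfl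
      exact P.prop_of_iso ((singleFunctor A (a + N)).mapIso
          (asIso ((homologyFunctor A (a + N)).map g)) ≪≫ e.symm) (h (a + N))

/-- After a shift, `f` is a class in `Ext^(n - m)(M, N)` with `n - m > d`. -/
lemma hom_single_eq_zero_of_hasProjectiveDimensionLE {M N : A} {d : ℕ}
    [HasProjectiveDimensionLE M d] {n m : ℤ} (hmn : m + d < n)
    (f : (singleFunctor A n).obj M ⟶ (singleFunctor A m).obj N) : f = 0 := by
  obtain ⟨i, hi⟩ := Int.eq_ofNat_of_zero_le (show 0 ≤ n - m by lia)
  have : HasExt.{max u v} A := HasExt.standard A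
  let α := (singleFunctors A).shiftIso n 0 n (by lia)
  let β := (singleFunctors A).shiftIso n (m - n) m (by lia)
  let γ := (singleFunctors A).shiftIso (i : ℤ) (m - n) 0 (by lia)
  let g : (singleFunctor A 0).obj M ⟶ ((singleFunctor A 0).obj N)⟦(i : ℤ)⟧ :=
    α.inv.app M ≫ (shiftFunctor (DerivedCategory A) n).map f ≫ β.hom.app N ≫ γ.inv.app N
  have hg : g = 0 := by
    have h1 : Subsingleton (Abelian.Ext.{max u v} M N i) :=
      HasProjectiveDimensionLT.subsingleton M (d + 1) i (by lia) N
    have h2 : Subsingleton (ShiftedHom ((singleFunctor A 0).obj M)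
      ((singleFunctor A 0).obj N) (i : ℤ)) :=
        (Abelian.Ext.homEquiv (X := M) (Y := N) (n := i)).symm.subsingleton
    exact h2.elim _ _
  have h3 : (shiftFunctor (DerivedCategory A) n).map f =
      α.hom.app M ≫ g ≫ γ.hom.app N ≫ β.inv.app N := by
    simp [g]
  apply (shiftFunctor (DerivedCategory A) n).map_injective
  rw [h3, hg, zero_comp, comp_zero, CategoryTheory.Functor.map_zero]

/-- Vanishing of all morphisms from a fixed object is stable under extensions of the target, so the
cohomology objects of `X`, in degrees at most `m`, suffice. -/
lemma hom_eq_zero_of_hasProjectiveDimensionLE {M : A} {d : ℕ} [HasProjectiveDimensionLE M d]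
    {n m : ℤ} (hmn : m + d < n) (X : DerivedCategory A) (hX : TStructure.t.bounded X) [X.IsLE m]
    (f : (singleFunctor A n).obj M ⟶ X) : f = 0 := by
  let P : ObjectProperty (DerivedCategory A) := fun X => ∀ f : (singleFunctor A n).obj M ⟶ X, f = 0
  have : P.IsClosedUnderIsomorphisms :=
    ⟨fun {X Y} e h f => by
      rw [← cancel_mono e.inv, zero_comp]
      exact h _⟩
  refine bounded_induction P (fun X h f => h.eq_of_tgt _ _) (fun T hT h1 h3 f => ?_) X hX
    (fun i => ?_) f
  · obtain ⟨g, hg⟩ := Triangle.coyoneda_exact₂ T hT f (h3 _)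
    rw [hg, h1 g, zero_comp]
  · intro f
    rcases le_or_gt i m with hi | hi
    · exact hom_single_eq_zero_of_hasProjectiveDimensionLE (d := d) (by lia) f
    · exact ((singleFunctor A i).map_isZero (isZero_of_isLE X m i hi)).eq_of_tgt _ _

/-- In the bounded derived category of a hereditary category, cohomology objects are realized by
morphisms from complexes concentrated in one degree. -/
lemma exists_single_hom_isIso_homology (hA : IsHereditary A) (Y : DerivedCategory A)
    (hY : TStructure.t.bounded Y) (n : ℤ) :
    ∃ (M : A) (j : (singleFunctor A n).obj M ⟶ Y), IsIso ((homologyFunctor A n).map j) := by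
  obtain ⟨a, b, ha, hb⟩ := (bounded_iff Y).1 hY
  obtain ⟨Y₁, Z₁, f₁, g₁, δ₁, hT₁, hY₁, hZ₁, hf₁, hg₁⟩ :=
    exists_truncation_triangle Y n (n + 1) rfl
  have hY₁a : Y₁.IsGE a := isGE_of_isIso_homology (X := Y) fun m hm => by
    rcases le_or_gt m n with h1 | h1
    · have := hf₁ m h1
      exact Or.inl ⟨asIso ((homologyFunctor A m).map f₁)⟩
    · exact Or.inr (isZero_of_isLE Y₁ _ m h1)
  obtain ⟨Y₂, Z₂, f₂, g₂, δ₂, hT₂, hY₂, hZ₂, hf₂, hg₂⟩ :=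
    exists_truncation_triangle Y₁ (n - 1) n (by lia)
  have hY₂a : Y₂.IsGE a := isGE_of_isIso_homology (X := Y₁) fun m hm => by
    rcases le_or_gt m (n - 1) with h1 | h1
    · have := hf₂ m h1
      exact Or.inl ⟨asIso ((homologyFunctor A m).map f₂)⟩
    · exact Or.inr (isZero_of_isLE Y₂ _ m h1)
  have hZ₂n : Z₂.IsLE n := isLE_of_isIso_homology (X := Y₁) fun m hm => by
    have := hg₂ m (by lia)
    exact Or.inl ⟨(asIso ((homologyFunctor A m).map g₂)).symm⟩
  obtain ⟨e⟩ := nonempty_iso_single Z₂ n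
  have hM := hA ((homologyFunctor A n).obj Z₂)
  have h1 : (Y₂⟦(1 : ℤ)⟧).IsLE (n - 2) := TStructure.t.isLE_shift Y₂ (n - 1) 1 _ (by lia)
  have h2 : (Y₂⟦(1 : ℤ)⟧).IsGE (a - 1) := TStructure.t.isGE_shift Y₂ a 1 _ (by lia)
  -- Heredity is used here: `δ₂` goes from an object in degree `n` to a complex in degrees at most
  -- `n - 2`, so only `Ext^i` with `i ≥ 2` is involved. Hence the top cohomology of the truncation
  -- splits off.
  have h3 : δ₂ = 0 := by
    rw [← cancel_epi e.inv, comp_zero]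
    exact hom_eq_zero_of_hasProjectiveDimensionLE (d := 1) (m := n - 2) (by lia) _
      ((bounded_iff _).2 ⟨_, _, h2, h1⟩) _
  obtain ⟨s, hs⟩ : ∃ s : Z₂ ⟶ Y₁, 𝟙 Z₂ = s ≫ g₂ :=
    Triangle.coyoneda_exact₃ _ hT₂ (𝟙 Z₂) (by
      change 𝟙 Z₂ ≫ δ₂ = 0
      rw [h3, comp_zero])
  refine ⟨_, e.inv ≫ s ≫ f₁, ?_⟩
  have h4 := hf₁ n le_rfl
  have h5 := hg₂ n le_rfl
  have h6 : (homologyFunctor A n).map s = inv ((homologyFunctor A n).map g₂) := by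
    rw [← cancel_mono ((homologyFunctor A n).map g₂), ← Functor.map_comp, ← hs, IsIso.inv_hom_id,
      CategoryTheory.Functor.map_id]
  rw [Functor.map_comp, Functor.map_comp, h6]
  infer_instance

end DerivedCategory

namespace DerivedCategory

variable {A : Type u} [Category.{v} A] [Abelian A]

/-- A complex concentrated in degree `n` is its cohomology placed in that degree, so morphisms into
the cohomology are realized. -/
lemma exists_single_hom (X : DerivedCategory A) (n : ℤ) [X.IsGE n] [X.IsLE n] {V : A}
    (t : V ⟶ (homologyFunctor A n).obj X) :
    ∃ u : (singleFunctor A n).obj V ⟶ X, (homologyFunctor A n).map u =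
      (singleFunctorCompHomologyFunctorIso A n).hom.app V ≫ t := by
  obtain ⟨Y, ⟨e⟩⟩ := exists_iso_singleFunctor_obj_of_isGE_of_isLE X n
  let σ := singleFunctorCompHomologyFunctorIso A n
  let q : V ⟶ Y := t ≫ (homologyFunctor A n).map e.hom ≫ σ.hom.app Y
  have h : (homologyFunctor A n).map ((singleFunctor A n).map q) ≫ σ.hom.app Y =
      σ.hom.app V ≫ q := σ.hom.naturality q
  refine ⟨(singleFunctor A n).map q ≫ e.inv, ?_⟩
  rw [← cancel_mono ((homologyFunctor A n).map e.hom), ← Functor.map_comp, Category.assoc,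
    Iso.inv_hom_id, Category.comp_id]
  refine (cancel_mono (σ.hom.app Y)).1 (h.trans ?_)
  simp only [q, σ, Category.assoc]

end DerivedCategory

/-- If the transpose of `g` is an isomorphism, then `g` is the counit up to isomorphism and is split
by any section of the counit. -/
lemma CategoryTheory.Adjunction.RelProj.exists_section {A : Type u} [Category.{v} A]
    {B : Type u'} [Category.{v'} B] {G : B ⥤ A} {F : A ⥤ B} {adj : G ⊣ F} {V : A}
    (h : adj.RelProj V) {W : B} (g : G.obj W ⟶ V) (hg : IsIso (adj.unit.app W ≫ F.map g)) :
    ∃ q : V ⟶ G.obj W, q ≫ g = 𝟙 V := by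
  obtain ⟨s, hs⟩ := h
  have h1 : G.map (adj.unit.app W ≫ F.map g) ≫ adj.counit.app V = g := by simp
  refine ⟨s ≫ G.map (inv (adj.unit.app W ≫ F.map g)), ?_⟩
  have h2 : G.map (inv (adj.unit.app W ≫ F.map g)) ≫ g = adj.counit.app V := by
    refine (congrArg (fun t => G.map (inv (adj.unit.app W ≫ F.map g)) ≫ t) h1.symm).trans ?_
    rw [← Category.assoc, ← G.map_comp, IsIso.inv_hom_id, G.map_id, Category.id_comp]
  rw [Category.assoc, h2, hs]

/-! ### Lifting objects with relatively projective cohomology -/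

namespace BObj

open DerivedCategory ZeroObject

section

variable {k : Type*} [CommRing k] {L : Type*} [CommRing L] [Algebra k L]
  {D : Type u} [Category.{v} D] [Abelian D] [Linear k D]

lemma isIso_of_isIso_hom {E : Type u} [Category.{v} E] [Preadditive E] [Linear k E]
    {Z Z' : BObj k L E} (f : Z ⟶ Z') (h : IsIso f.hom) : IsIso f := by
  have : IsIso ((forget k L E).map f) := h
  exact isIso_of_reflects_iso f (forget k L E)

lemma isZero_homology_dForget_iff (X : DerivedCategory (BObj k L D)) (n : ℤ) :
    IsZero ((homologyFunctor D n).obj ((dForget k L D).obj X)) ↔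
      IsZero ((homologyFunctor (BObj k L D) n).obj X) := by
  have e : (homologyFunctor D n).obj ((dForget k L D).obj X) ≅
    ((homologyFunctor (BObj k L D) n).obj X).obj := (mapDerivedHomologyIso (forget k L D) n).app X
  refine ⟨fun h => ?_, fun h => ((forget k L D).map_isZero h).of_iso e⟩
  have h' : IsZero ((homologyFunctor (BObj k L D) n).obj X).obj := h.of_iso e.symm
  rw [IsZero.iff_id_eq_zero]
  exact hom_ext (h'.eq_of_src _ _)

lemma bounded_dForget_iff (X : DerivedCategory (BObj k L D)) :
    TStructure.t.bounded ((dForget k L D).obj X) ↔ TStructure.t.bounded X := by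
  simp only [bounded_iff, isGE_iff, isLE_iff, isZero_homology_dForget_iff]

end

section

variable {k : Type*} [CommRing k] {L : Type*} [CommRing L] [Algebra k L] [Module.Free k L]
  {D : Type u} [Category.{v} D] [Abelian D] [Linear k D]
  [HasCoproductsOfShape (Module.Free.ChooseBasisIndex k L) D]
  [HasExactColimitsOfShape (Discrete (Module.Free.ChooseBasisIndex k L)) D]

lemma relProj_single {V : BObj k L D} (hV : (freeAdjunction k L D).RelProj V) (n : ℤ) :
    (dAdj k L D).RelProj ((singleFunctor (BObj k L D) n).obj V) := by
  obtain ⟨s, hs⟩ := hV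
  let e : (dFree k L D).obj ((singleFunctor D n).obj V.obj) ≅
      (singleFunctor (BObj k L D) n).obj ((free k L D).obj ((forget k L D).obj V)) :=
    ((free k L D).mapDerivedCategorySingleFunctor n).app V.obj
  refine Adjunction.RelProj.of_retract ((dAdj k L D).relProj_obj ((singleFunctor D n).obj V.obj))
    ((singleFunctor (BObj k L D) n).map s ≫ e.inv)
    (e.hom ≫ (singleFunctor (BObj k L D) n).map ((freeAdjunction k L D).counit.app V)) ?_
  rw [Category.assoc, Iso.inv_hom_id_assoc]
  refine ((singleFunctor (BObj k L D) n).map_comp _ _).symm.trans ?_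
  rw [hs, CategoryTheory.Functor.map_id]

lemma isGE_dFree (W : DerivedCategory D) (n : ℤ) [W.IsGE n] : ((dFree k L D).obj W).IsGE n :=
  (isGE_iff _ _).2 fun i hi => ((free k L D).map_isZero (isZero_of_isGE W n i hi)).of_iso
    ((mapDerivedHomologyIso (free k L D) i).app W)

lemma isLE_dFree (W : DerivedCategory D) (n : ℤ) [W.IsLE n] : ((dFree k L D).obj W).IsLE n :=
  (isLE_iff _ _).2 fun i hi => ((free k L D).map_isZero (isZero_of_isLE W n i hi)).of_iso
    ((mapDerivedHomologyIso (free k L D) i).app W)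

lemma bounded_dFree {W : DerivedCategory D} (h : TStructure.t.bounded W) :
    TStructure.t.bounded ((dFree k L D).obj W) := by
  obtain ⟨a, b, ha, hb⟩ := (bounded_iff W).1 h
  exact (bounded_iff _).2 ⟨a, b, isGE_dFree W a, isLE_dFree W b⟩

/-- A relatively projective cohomology object is realized by a morphism from a relatively projective
object concentrated in one degree. -/
lemma exists_single_dLift_hom (hD : IsHereditary D) (Z : BObj k L (DerivedCategory D))
    (hZ : TStructure.t.bounded Z.obj) (n : ℤ)
    (h : (freeAdjunction k L D).RelProj ((homologyL k L D n).obj Z)) :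
    ∃ u : (dLift k L D).obj ((singleFunctor (BObj k L D) n).obj ((homologyL k L D n).obj Z)) ⟶ Z,
      IsIso ((homologyFunctor D n).map u.hom) := by
  obtain ⟨M, j, hj⟩ := exists_single_hom_isIso_homology hD Z.obj hZ n
  let W := (singleFunctor D n).obj M
  -- The morphism `j` is only one of `D(D)`. Its extension to `L ⊗ M` placed in degree `n` is an
  -- action map on `H^n`, up to isomorphism, and so has an `L`-linear section `q`; this `q` is then
  -- realized by a morphism `u` of complexes in one degree.
  obtain ⟨ĵ, hĵ⟩ := exists_dLift_hom (k := k) (L := L) (Z := Z) j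
  obtain ⟨c, hc⟩ := exists_iso_homology_dFree (k := k) (L := L) W n
  let P := (dFree k L D).obj W
  obtain ⟨q, hq⟩ := h.exists_section (c.hom ≫ (homologyL k L D n).map ĵ) (by
    have h1 : freeIncl k ((homologyFunctor D n).obj W) 1 ≫ c.hom.hom ≫
        ((homologyL k L D n).map ĵ).hom = (homologyFunctor D n).map j := by
      rw [← Category.assoc, hc]
      exact ((homologyFunctor D n).map_comp _ _).symm.trans (congrArg _ hĵ)
    rw [freeAdjunction_unit_app]
    change IsIso (freeIncl k ((homologyFunctor D n).obj W) 1 ≫ c.hom.hom ≫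
        ((homologyL k L D n).map ĵ).hom)
    rw [h1]
    exact hj)
  have : P.IsGE n := isGE_dFree W n
  have : P.IsLE n := isLE_dFree W n
  obtain ⟨u, hu⟩ := exists_single_hom P n (q ≫ c.hom ≫ (homologyLiftIso P n).hom)
  refine ⟨(dLift k L D).map u ≫ ĵ, ?_⟩
  let V := (homologyL k L D n).obj Z
  let X := (singleFunctor (BObj k L D) n).obj V
  let σ : (homologyFunctor (BObj k L D) n).obj X ≅ V :=
    (singleFunctorCompHomologyFunctorIso (BObj k L D) n).app V
  have h3 : (homologyL k L D n).map ((dLift k L D).map u) ≫ (homologyLiftIso P n).hom =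
      (homologyLiftIso X n).hom ≫ σ.hom ≫ q ≫ c.hom ≫ (homologyLiftIso P n).hom :=
    (homologyLiftIso_naturality u n).trans (congrArg (fun t => (homologyLiftIso X n).hom ≫ t) hu)
  have h3' : (homologyL k L D n).map ((dLift k L D).map u) =
      (homologyLiftIso X n).hom ≫ σ.hom ≫ q ≫ c.hom := by
    refine (cancel_mono (homologyLiftIso P n).hom).1 (h3.trans ?_)
    simp only [Category.assoc]
  have h4 : (homologyL k L D n).map ((dLift k L D).map u ≫ ĵ) =
      (homologyLiftIso X n).hom ≫ σ.hom := by
    refine ((homologyL k L D n).map_comp _ _).trans ?_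
    refine (congrArg (fun t => t ≫ _) h3').trans ?_
    simp only [Category.assoc]
    refine congrArg (fun t => (homologyLiftIso X n).hom ≫ t) ?_
    exact (congrArg (fun t => σ.hom ≫ t) hq).trans (Category.comp_id _)
  have h5 : IsIso ((homologyL k L D n).map ((dLift k L D).map u ≫ ĵ)) := by
    rw [h4]; infer_instance
  exact inferInstanceAs (IsIso ((forget k L D).map
    ((homologyL k L D n).map ((dLift k L D).map u ≫ ĵ))))

lemma isIso_map_biprod_fst {E : Type*} [Category* E] [Preadditive E] [HasBinaryBiproducts E]
    {E' : Type*} [Category* E'] [Preadditive E'] (T : E ⥤ E') [T.Additive] (X Y : E)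
    (h : IsZero (T.obj Y)) : IsIso (T.map (biprod.fst : X ⊞ Y ⟶ X)) := by
  refine ⟨T.map biprod.inl, ?_, ?_⟩
  · have h1 : (biprod.fst : X ⊞ Y ⟶ X) ≫ biprod.inl = 𝟙 _ - biprod.snd ≫ biprod.inr := by
      rw [← biprod.total, add_sub_cancel_right]
    rw [← T.map_comp, h1, T.map_sub, T.map_comp, T.map_id, h.eq_of_tgt (T.map biprod.snd) 0,
      zero_comp, sub_zero]
  · rw [← T.map_comp, biprod.inl_fst, T.map_id]

lemma isIso_map_biprod_snd {E : Type*} [Category* E] [Preadditive E] [HasBinaryBiproducts E]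
    {E' : Type*} [Category* E'] [Preadditive E'] (T : E ⥤ E') [T.Additive] (X Y : E)
    (h : IsZero (T.obj X)) : IsIso (T.map (biprod.snd : X ⊞ Y ⟶ Y)) := by
  refine ⟨T.map biprod.inr, ?_, ?_⟩
  · have h1 : (biprod.snd : X ⊞ Y ⟶ Y) ≫ biprod.inr = 𝟙 _ - biprod.fst ≫ biprod.inl := by
      rw [← biprod.total, add_sub_cancel_left]
    rw [← T.map_comp, h1, T.map_sub, T.map_comp, T.map_id, h.eq_of_tgt (T.map biprod.fst) 0,
      zero_comp, sub_zero]
  · rw [← T.map_comp, biprod.inr_snd, T.map_id]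

/-- The morphisms from the single degrees in `S` are added up. They do not interfere on cohomology,
since each source has cohomology in its own degree only. -/
lemma exists_relProj_dLift_hom (hD : IsHereditary D) (Z : BObj k L (DerivedCategory D))
    (hZ : TStructure.t.bounded Z.obj)
    (h : ∀ n, (freeAdjunction k L D).RelProj ((homologyL k L D n).obj Z)) (S : Finset ℤ) :
    ∃ (X : DerivedCategory (BObj k L D)) (u : (dLift k L D).obj X ⟶ Z), (dAdj k L D).RelProj X ∧
      (∀ n, n ∈ S → IsIso ((homologyFunctor D n).map u.hom)) ∧
      (∀ n, n ∉ S → IsZero ((homologyFunctor D n).obj ((dForget k L D).obj X))) := by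
  induction S using Finset.induction_on with
  | empty =>
    refine ⟨0, 0, ⟨0, (isZero_zero _).eq_of_src _ _⟩, fun n hn => absurd hn (Finset.notMem_empty n),
      fun n _ => Functor.map_isZero _ (Functor.map_isZero _ (isZero_zero _))⟩
  | insert n S hn ih =>
    obtain ⟨X, u, hX, hu, hX'⟩ := ih
    obtain ⟨u', hu'⟩ := exists_single_dLift_hom hD Z hZ n (h n)
    let Y := (singleFunctor (BObj k L D) n).obj ((homologyL k L D n).obj Z)
    have hY : ∀ m, m ≠ n → IsZero ((homologyFunctor D m).obj ((dForget k L D).obj Y)) :=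
      fun m hm => (isZero_homology_dForget_iff Y m).2 (by
        rcases lt_or_gt_of_ne hm with h1 | h1
        · exact isZero_of_isGE Y n m h1
        · exact isZero_of_isLE Y n m h1)
    let φ : (dForget k L D).obj (X ⊞ Y) ⟶ Z.obj :=
      (dForget k L D).map biprod.fst ≫ u.hom + (dForget k L D).map biprod.snd ≫ u'.hom
    refine ⟨X ⊞ Y, (dLift k L D).map biprod.fst ≫ u + (dLift k L D).map biprod.snd ≫ u',
      ?_, fun m hm => ?_, fun m hm => ?_⟩
    · refine Adjunction.RelProj.of_sum (ι := Bool) (U := fun b => cond b X Y) ?_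
        (fun b => match b with
          | true => biprod.fst
          | false => biprod.snd)
        (fun b => match b with
          | true => biprod.inl
          | false => biprod.inr) ?_
      · rintro (_ | _)
        · exact relProj_single (h n) n
        · exact hX
      · rw [Fintype.sum_bool]
        exact biprod.total
    · change IsIso ((homologyFunctor D m).map φ)
      have e : (homologyFunctor D m).map φ =
          (dForget k L D ⋙ homologyFunctor D m).map biprod.fst ≫ (homologyFunctor D m).map u.hom +
          (dForget k L D ⋙ homologyFunctor D m).map biprod.snd ≫
            (homologyFunctor D m).map u'.hom := by
        simp only [φ]
        rw [Functor.map_add, Functor.map_comp, Functor.map_comp]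
        rfl
      rw [e]
      by_cases hmn : m = n
      · subst hmn
        have h1 : IsZero ((dForget k L D ⋙ homologyFunctor D m).obj X) := hX' m hn
        rw [h1.eq_of_tgt ((dForget k L D ⋙ homologyFunctor D m).map biprod.fst) 0, zero_comp,
          zero_add]
        have := isIso_map_biprod_snd (dForget k L D ⋙ homologyFunctor D m) X Y h1
        exact IsIso.comp_isIso
      · have h1 : IsZero ((dForget k L D ⋙ homologyFunctor D m).obj Y) := hY m hmn
        rw [h1.eq_of_tgt ((dForget k L D ⋙ homologyFunctor D m).map biprod.snd) 0, zero_comp,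
          add_zero]
        have := isIso_map_biprod_fst (dForget k L D ⋙ homologyFunctor D m) X Y h1
        have := hu m ((Finset.mem_insert.1 hm).resolve_left hmn)
        exact IsIso.comp_isIso
    · rw [Finset.mem_insert, not_or] at hm
      have := isIso_map_biprod_fst (dForget k L D ⋙ homologyFunctor D m) X Y (hY m hm.1)
      exact (hX' m hm.2).of_iso
        (asIso ((dForget k L D ⋙ homologyFunctor D m).map (biprod.fst : X ⊞ Y ⟶ X)))

/-- An `L`-object of the bounded derived category of a hereditary category with relatively
projective cohomology comes from a relatively projective object. -/
lemma exists_relProj_dLift_iso (hD : IsHereditary D) (Z : BObj k L (DerivedCategory D))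
    (hZ : TStructure.t.bounded Z.obj)
    (h : ∀ n, (freeAdjunction k L D).RelProj ((homologyL k L D n).obj Z)) :
    ∃ X : DerivedCategory (BObj k L D), (dAdj k L D).RelProj X ∧
      Nonempty ((dLift k L D).obj X ≅ Z) := by
  obtain ⟨a, b, ha, hb⟩ := (bounded_iff Z.obj).1 hZ
  obtain ⟨X, u, hX, h1, h2⟩ := exists_relProj_dLift_hom hD Z hZ h (Finset.Icc a b)
  have : IsIso u := isIso_of_isIso_hom u (by
    rw [DerivedCategory.isIso_iff]
    intro n
    by_cases hn : n ∈ Finset.Icc a b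
    · exact h1 n hn
    · have h3 : IsZero ((homologyFunctor D n).obj Z.obj) := by
        rw [Finset.mem_Icc, not_and_or, not_le, not_le] at hn
        rcases hn with hn | hn
        · exact isZero_of_isGE Z.obj a n hn
        · exact isZero_of_isLE Z.obj b n hn
      exact isIso_of_source_target_iso_zero _ (h2 n hn).isoZero h3.isoZero)
  exact ⟨X, hX, ⟨asIso u⟩⟩

/-- The underlying `L`-object of `X` is isomorphic to that of some relatively projective `X'`.
Fullness on morphisms out of `X'` lifts the isomorphism, and the lift is invertible because
`dForget` reflects isomorphisms. -/
lemma relProj_of_relProj_homology (hD : IsHereditary D) (X : DerivedCategory (BObj k L D))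
    (hX : TStructure.t.bounded X)
    (h : ∀ n, (freeAdjunction k L D).RelProj ((homologyFunctor (BObj k L D) n).obj X)) :
    (dAdj k L D).RelProj X := by
  obtain ⟨X', hX', ⟨e⟩⟩ := exists_relProj_dLift_iso hD ((dLift k L D).obj X)
    ((bounded_dForget_iff X).2 hX) fun n =>
      (h n).of_retract (homologyLiftIso X n).hom (homologyLiftIso X n).inv (Iso.hom_inv_id _)
  obtain ⟨f, hf⟩ := exists_dLift_map_of_relProj hX' e.hom
  have : IsIso f := isIso_of_isIso_dForget_map f (by
    have h1 : IsIso ((forget k L (DerivedCategory D)).map ((dLift k L D).map f)) := by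
      rw [hf]; infer_instance
    exact h1)
  exact hX'.of_retract (inv f) f (IsIso.inv_hom_id f)

end

end BObj

lemma DerivedCategory.bounded_of_retract {A : Type u} [Category.{v} A] [Abelian A]
    {X Y : DerivedCategory A} (hY : TStructure.t.bounded Y) (i : X ⟶ Y) (r : Y ⟶ X)
    (h : i ≫ r = 𝟙 X) : TStructure.t.bounded X := by
  obtain ⟨a, b, ha, hb⟩ := (bounded_iff Y).1 hY
  have key : ∀ n, IsZero ((homologyFunctor A n).obj Y) → IsZero ((homologyFunctor A n).obj X) :=
    fun n hn => by
      rw [IsZero.iff_id_eq_zero, ← CategoryTheory.Functor.map_id, ← h, Functor.map_comp,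
        hn.eq_of_tgt ((homologyFunctor A n).map i) 0, zero_comp]
  exact (bounded_iff X).2 ⟨a, b, (isGE_iff _ _).2 fun i hi => key i (isZero_of_isGE Y a i hi),
    (isLE_iff _ _).2 fun i hi => key i (isZero_of_isLE Y b i hi)⟩

/-! ### Fullness and essential surjectivity of `dLift` -/

namespace BObj

open DerivedCategory Pretriangulated

section

variable {k : Type*} [CommRing k] {L : Type*} [CommRing L] [Algebra k L]
  {E : Type u} [Category.{v} E] [Preadditive E] [Linear k E]

/-- Cokernels of morphisms which are split after forgetting the action are unique. -/
lemma nonempty_iso_of_relSplitting {K K' P V V' : BObj k L E} {f : K ⟶ P} {g : P ⟶ V}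
    {f' : K' ⟶ P} {g' : P ⟶ V'} (σ : Adjunction.RelSplitting (forget k L E) f g)
    (σ' : Adjunction.RelSplitting (forget k L E) f' g') (e : K ≅ K') (he : e.hom ≫ f' = f) :
    Nonempty (V ≅ V') := by
  have aux : ∀ {K K' V V' : BObj k L E} {f : K ⟶ P} {g : P ⟶ V} {f' : K' ⟶ P} {g' : P ⟶ V'}
      (σ : Adjunction.RelSplitting (forget k L E) f g)
      (σ' : Adjunction.RelSplitting (forget k L E) f' g') (e : K ≅ K') (_ : e.hom ≫ f' = f),
      ∃ φ : V ⟶ V', g ≫ φ = g' := by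
    intro K K' V V' f g f' g' σ σ' e he
    let r : P.obj ⟶ K.obj := σ.r
    let s : V.obj ⟶ P.obj := σ.s
    have hs : s ≫ g.hom = 𝟙 _ := σ.s_g
    have hid : r ≫ f.hom + g.hom ≫ s = 𝟙 _ := σ.id
    have hw : f.hom ≫ g'.hom = 0 := by
      have h : f ≫ g' = 0 := by rw [← he, Category.assoc, σ'.w, comp_zero]
      exact congrArg Hom.hom h
    have hφ : g.hom ≫ s ≫ g'.hom = g'.hom := by
      rw [← Category.assoc, eq_sub_of_add_eq' hid, Preadditive.sub_comp, Category.id_comp,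
        Category.assoc, hw, comp_zero, sub_zero]
    have hcancel : ∀ {a b : V.obj ⟶ V'.obj}, g.hom ≫ a = g.hom ≫ b → a = b := fun {a b} hab => by
      rw [← Category.id_comp a, ← Category.id_comp b, ← hs, Category.assoc, hab, Category.assoc]
    exact ⟨⟨s ≫ g'.hom, fun b => hcancel (by
      rw [← Category.assoc, ← g.comm, Category.assoc, hφ, g'.comm, ← Category.assoc (g.hom), hφ])⟩,
      hom_ext hφ⟩
  have hepi : ∀ {K V T : BObj k L E} {f : K ⟶ P} {g : P ⟶ V}
      (_ : Adjunction.RelSplitting (forget k L E) f g) {a b : V ⟶ T}, g ≫ a = g ≫ b → a = b := by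
    intro K V T f g σ a b hab
    let s : V.obj ⟶ P.obj := σ.s
    have hs : s ≫ g.hom = 𝟙 _ := σ.s_g
    have hab' : g.hom ≫ a.hom = g.hom ≫ b.hom := congrArg Hom.hom hab
    exact hom_ext (by
      rw [← Category.id_comp a.hom, ← Category.id_comp b.hom, ← hs, Category.assoc, hab',
        Category.assoc])
  obtain ⟨φ, hφ⟩ := aux σ σ' e he
  obtain ⟨ψ, hψ⟩ := aux σ' σ e.symm (by rw [Iso.symm_hom, ← he, Iso.inv_hom_id_assoc])
  exact ⟨⟨φ, ψ, hepi σ (by rw [← Category.assoc, hφ, hψ, Category.comp_id]),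
    hepi σ' (by rw [← Category.assoc, hψ, hφ, Category.comp_id])⟩⟩

variable {D : Type u} [Category.{v} D] [Abelian D] [Linear k D]

/-- A triangle of the derived category of `L`-objects which splits in the underlying derived
category. -/
lemma nonempty_relSplitting_of_section {K P V : DerivedCategory (BObj k L D)} {i : K ⟶ P}
    {p : P ⟶ V} {h : V ⟶ K⟦(1 : ℤ)⟧} (hT : Triangle.mk i p h ∈ distTriang _)
    (s : (dForget k L D).obj V ⟶ (dForget k L D).obj P) (hs : s ≫ (dForget k L D).map p = 𝟙 _) :
    Nonempty (Adjunction.RelSplitting (forget k L (DerivedCategory D)) ((dLift k L D).map i)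
      ((dLift k L D).map p)) := by
  have hT' := (dForget k L D).map_distinguished _ hT
  obtain ⟨h1, r, h2, h3⟩ := exists_splitting_of_mor₃_eq_zero hT' s hs
  have h0 : i ≫ p = 0 := comp_distTriang_mor_zero₁₂ _ hT
  exact ⟨⟨r, s, hom_ext h1, h2, hs, h3⟩⟩

lemma nonempty_relSplitting_of_retraction {K P V : DerivedCategory (BObj k L D)} {i : K ⟶ P}
    {p : P ⟶ V} {h : V ⟶ K⟦(1 : ℤ)⟧} (hT : Triangle.mk i p h ∈ distTriang _)
    (r : (dForget k L D).obj P ⟶ (dForget k L D).obj K) (hr : (dForget k L D).map i ≫ r = 𝟙 _) :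
    Nonempty (Adjunction.RelSplitting (forget k L (DerivedCategory D)) ((dLift k L D).map i)
      ((dLift k L D).map p)) := by
  have hT' := (dForget k L D).map_distinguished _ hT
  have hm : Mono ((dForget k L D).map i) := mono_of_mono_fac hr
  have h3 := (Triangle.mor₃_eq_zero_iff_mono₁ _ hT').2 hm
  obtain ⟨s, hs⟩ : ∃ s : (dForget k L D).obj V ⟶ (dForget k L D).obj P,
      𝟙 _ = s ≫ (dForget k L D).map p :=
    Triangle.coyoneda_exact₃ _ hT' (𝟙 ((dForget k L D).obj V)) (by
      rw [h3]; exact comp_zero)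
  exact nonempty_relSplitting_of_section hT s hs.symm

end

section

variable {k : Type*} [CommRing k] {L : Type*} [CommRing L] [Algebra k L] [Module.Free k L]
  {D : Type u} [Category.{v} D] [Abelian D] [Linear k D]
  [HasCoproductsOfShape (Module.Free.ChooseBasisIndex k L) D]
  [HasExactColimitsOfShape (Discrete (Module.Free.ChooseBasisIndex k L)) D]

/-- Fullness of `dLift` for objects with cohomology of relative projective dimension `≤ 1`. -/
lemma exists_dLift_map_of_relPD_one (hD : IsHereditary D) {X Y : DerivedCategory (BObj k L D)}
    (hX : TStructure.t.bounded X)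
    (hX' : ∀ n, (freeAdjunction k L D).RelPD 1 ((homologyFunctor (BObj k L D) n).obj X))
    (h : (dLift k L D).obj X ⟶ (dLift k L D).obj Y) : ∃ f : X ⟶ Y, (dLift k L D).map f = h := by
  let P := (dFree k L D).obj ((dForget k L D).obj X)
  let ε : P ⟶ X := (dAdj k L D).counit.app X
  obtain ⟨K, i, δ, hT⟩ := distinguished_cocone_triangle₁ ε
  have hs : (dAdj k L D).unit.app ((dForget k L D).obj X) ≫ (dForget k L D).map ε = 𝟙 _ :=
    (dAdj k L D).right_triangle_components X
  obtain ⟨σ⟩ := nonempty_relSplitting_of_section hT _ hs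
  have hε : dActMap k L ((dLift k L D).obj X) = (dLift k L D).map ε := dActMap_dLift X
  let σ' : Adjunction.RelSplitting (forget k L (DerivedCategory D)) ((dLift k L D).map i)
    (dActMap k L ((dLift k L D).obj X)) := hε ▸ σ
  have hPb : TStructure.t.bounded P := bounded_dFree ((bounded_dForget_iff X).2 hX)
  have hKb : TStructure.t.bounded K := (bounded_dForget_iff K).1
    (bounded_of_retract ((bounded_dForget_iff P).2 hPb) ((dForget k L D).map i) σ.r σ.f_r)
  -- The cohomology of `K` consists of the syzygies of the cohomology of `X`, which are relatively
  -- projective by the bound `1`.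
  have hK : (dAdj k L D).RelProj K := relProj_of_relProj_homology hD K hKb fun n => by
    have h1 : (freeAdjunction k L D).RelPD 0 ((homologyL k L D n).obj ((dLift k L D).obj K)) :=
      relPD_homology_of_splitting σ' ((hX' n).of_iso (homologyLiftIso X n))
    exact Adjunction.RelPD.of_iso (n := 0) h1 (homologyLiftIso K n).symm
  obtain ⟨g, hg⟩ := exists_dLift_map_of_relProj (Y := Y)
    ((dAdj k L D).relProj_obj ((dForget k L D).obj X)) ((dLift k L D).map ε ≫ h)
  have hg' : (dLift k L D).map g = (dLift k L D).map ε ≫ h := hg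
  -- The underlying morphism vanishes because `g` lifts `ε ≫ h`; relative projectivity of `K` turns
  -- this into vanishing of `i ≫ g` itself, so that `g` factors through `X`.
  have hig : i ≫ g = 0 := dForget_map_injective_of_relProj hK (by
    have h1 : (dLift k L D).map (i ≫ g) = 0 := by
      rw [Functor.map_comp, hg', ← Category.assoc]
      exact (congrArg (fun t => t ≫ h) σ.w).trans zero_comp
    have h2 : (dForget k L D).map (i ≫ g) = 0 := congrArg Hom.hom h1
    rw [h2, CategoryTheory.Functor.map_zero])
  obtain ⟨f, hf⟩ : ∃ f : X ⟶ Y, g = ε ≫ f := Triangle.yoneda_exact₂ _ hT g hig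
  refine ⟨f, hom_ext ?_⟩
  have h1 : (dForget k L D).map ε ≫ (dForget k L D).map f = (dForget k L D).map ε ≫ h.hom := by
    rw [← Functor.map_comp, ← hf]
    exact congrArg Hom.hom hg'
  have h2 := congrArg (fun t => (dAdj k L D).unit.app ((dForget k L D).obj X) ≫ t) h1
  refine Eq.trans ?_ (h2.trans ?_)
  · rw [← Category.assoc]
    exact ((congrArg (fun t => t ≫ _) hs).trans (Category.id_comp _)).symm
  · rw [← Category.assoc]
    exact (congrArg (fun t => t ≫ h.hom) hs).trans (Category.id_comp _)

/-- Objects with cohomology of relative projective dimension `≤ 2` are in the essential image of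
`dLift`. -/
lemma exists_dLift_iso_of_relPD (hD : IsHereditary D) {d : ℕ} (hd : d ≤ 2)
    (Z : BObj k L (DerivedCategory D)) (hZ : TStructure.t.bounded Z.obj)
    (h : ∀ n, (freeAdjunction k L D).RelPD d ((homologyL k L D n).obj Z)) :
    ∃ X : DerivedCategory (BObj k L D), Nonempty ((dLift k L D).obj X ≅ Z) := by
  induction d generalizing Z with
  | zero =>
    obtain ⟨X, -, hX⟩ := exists_relProj_dLift_iso hD Z hZ h
    exact ⟨X, hX⟩
  | succ d ih =>
    obtain ⟨K, i, ⟨σ⟩⟩ := exists_dSyzygy Z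
    let P := (dFree k L D).obj Z.obj
    have hPb : TStructure.t.bounded ((dForget k L D).obj P) :=
      (bounded_dForget_iff P).2 (bounded_dFree hZ)
    have hK : ∀ n, (freeAdjunction k L D).RelPD d ((homologyL k L D n).obj K) := fun n =>
      relPD_homology_of_splitting σ (h n)
    have hKb : TStructure.t.bounded K.obj := bounded_of_retract hPb i.hom σ.r σ.f_r
    obtain ⟨Y, ⟨e⟩⟩ := ih (by lia) K hKb hK
    have hYb : TStructure.t.bounded Y := (bounded_dForget_iff Y).1
      (ObjectProperty.prop_of_iso _ ((forget k L (DerivedCategory D)).mapIso e.symm) hKb)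
    -- The bound `2` enters here: `d + 1 ≤ 2` gives `d ≤ 1` for the kernel, as fullness requires to
    -- lift its inclusion into `L ⊗ Z`.
    obtain ⟨j, hj⟩ := exists_dLift_map_of_relPD_one hD (Y := P) hYb (fun n =>
      (((hK n).of_iso ((homologyL k L D n).mapIso e)).of_iso (homologyLiftIso Y n).symm).mono
        (by lia)) (e.hom ≫ i)
    -- The triangle splits after forgetting the action, so the cone of the lifted inclusion and `Z`
    -- are both cokernels of the same split inclusion.
    obtain ⟨X, p, δ, hT⟩ := distinguished_cocone_triangle j
    have hj' : (dForget k L D).map j = e.hom.hom ≫ i.hom := congrArg Hom.hom hj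
    let r : (dForget k L D).obj P ⟶ (dForget k L D).obj Y := σ.r ≫ e.inv.hom
    obtain ⟨σ'⟩ := nonempty_relSplitting_of_retraction hT r (by
      have h1 : i.hom ≫ σ.r = 𝟙 _ := σ.f_r
      have h2 : e.hom.hom ≫ e.inv.hom = 𝟙 _ := congrArg Hom.hom e.hom_inv_id
      rw [hj']
      refine (Category.assoc _ _ _).trans (Eq.trans ?_ h2)
      refine congrArg (fun t => e.hom.hom ≫ t) ?_
      exact (Category.assoc _ _ _).symm.trans ((congrArg (fun t => t ≫ e.inv.hom) h1).trans
        (Category.id_comp _)))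
    exact ⟨X, nonempty_iso_of_relSplitting σ' σ e hj.symm⟩

end

end BObj

/-! ### Effaceability of `Ext` -/

namespace DerivedCategory

variable {A : Type u} [Category.{v} A] [Abelian A]

/-- The morphism is a roof through a complex `X'` in degrees at most `0`. All of `X'.X 0` consists
of cycles and maps onto `H^0(X') ≅ X`; take `M = X'.X 0`. Its map to `K` lands in degree `0`, where
`K` vanishes. -/
lemma exists_epi_single_comp_eq_zero {X : A} {K : CochainComplex A ℤ} (hK : IsZero (K.X 0))
    (f : Q.obj ((HomologicalComplex.single A (ComplexShape.up ℤ) 0).obj X) ⟶ Q.obj K) :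
    ∃ (M : A) (p : M ⟶ X), Epi p ∧
      Q.map ((HomologicalComplex.single A (ComplexShape.up ℤ) 0).map p) ≫ f = 0 := by
  have : CochainComplex.IsStrictlyLE
      ((HomologicalComplex.single A (ComplexShape.up ℤ) 0).obj X) 0 :=
    inferInstanceAs (((CochainComplex.singleFunctor A 0).obj X).IsStrictlyLE 0)
  obtain ⟨X', hX', s, hs, g, rfl⟩ := right_fac_of_isStrictlyLE f 0
  have hd : X'.d 0 1 = 0 := (X'.isZero_of_isStrictlyLE 0 1 (by lia)).eq_of_tgt _ _
  let j : (HomologicalComplex.single A (ComplexShape.up ℤ) 0).obj (X'.X 0) ⟶ X' :=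
    HomologicalComplex.mkHomFromSingle (𝟙 (X'.X 0)) (fun i hi => by
      obtain rfl : 1 = i := by simpa using hi
      rw [hd, comp_zero])
  have hjg : j ≫ g = 0 := HomologicalComplex.from_single_hom_ext (hK.eq_of_tgt _ _)
  obtain ⟨p, hp⟩ := (HomologicalComplex.single A (ComplexShape.up ℤ) 0).map_surjective (j ≫ s)
  refine ⟨X'.X 0, p, ?_, ?_⟩
  · have hqs : QuasiIso s := (isIso_Q_map_iff_quasiIso A s).1 hs
    have h1 : IsIso (X'.iCycles 0) :=
      HomologicalComplex.isIso_iCycles X' 0 1 (by simp) hd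
    have h2 : IsIso (((HomologicalComplex.single A (ComplexShape.up ℤ) 0).obj (X'.X 0)).iCycles 0) :=
      HomologicalComplex.isIso_iCycles _ 0 1 (by simp) rfl
    have h3 : IsIso (j.f 0) := by
      rw [HomologicalComplex.mkHomFromSingle_f]
      infer_instance
    have h4 : IsIso (HomologicalComplex.cyclesMap j 0) := by
      have h5 : IsIso (HomologicalComplex.cyclesMap j 0 ≫ X'.iCycles 0) := by
        rw [HomologicalComplex.cyclesMap_i]
        infer_instance
      exact IsIso.of_isIso_comp_right _ (X'.iCycles 0)
    have h5 : Epi (HomologicalComplex.homologyMap j 0) := by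
      have h6 : Epi (HomologicalComplex.homologyπ _ 0 ≫ HomologicalComplex.homologyMap j 0) := by
        rw [HomologicalComplex.homologyπ_naturality]
        infer_instance
      exact epi_of_epi (HomologicalComplex.homologyπ _ 0) _
    have h6 : Epi (HomologicalComplex.homologyMap
        ((HomologicalComplex.single A (ComplexShape.up ℤ) 0).map p) 0) := by
      rw [hp, HomologicalComplex.homologyMap_comp]
      infer_instance
    let σ : ∀ B : A, ((HomologicalComplex.single A (ComplexShape.up ℤ) 0).obj B).homology 0 ≅ B :=
      (HomologicalComplex.homologyFunctorSingleIso A (ComplexShape.up ℤ) 0).app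
    have h7 : HomologicalComplex.homologyMap
        ((HomologicalComplex.single A (ComplexShape.up ℤ) 0).map p) 0 ≫ (σ X).hom =
        (σ (X'.X 0)).hom ≫ p :=
      (HomologicalComplex.homologyFunctorSingleIso A (ComplexShape.up ℤ) 0).hom.naturality p
    have h8 : Epi ((σ (X'.X 0)).hom ≫ p) := by
      rw [← h7]
      infer_instance
    exact epi_of_epi (σ (X'.X 0)).hom p
  · rw [hp, Functor.map_comp, Category.assoc, IsIso.hom_inv_id_assoc, ← Functor.map_comp, hjg,
      Functor.map_zero]

end DerivedCategory

namespace CategoryTheory.Abelian.Ext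

open _root_.DerivedCategory

/-- The class is a morphism from `X` to the shift of `Y` by `n + 1`, a complex with zero term in
degree `0`. -/
lemma exists_epi_comp_eq_zero {A : Type u} [Category.{v} A] [Abelian A] [HasExt.{w} A] {X Y : A}
    {n : ℕ} (y : Ext X Y (n + 1)) :
    ∃ (M : A) (p : M ⟶ X), Epi p ∧ (mk₀ p).comp y (zero_add (n + 1)) = 0 := by
  let i : ℤ := ((n + 1 : ℕ) : ℤ)
  let e := (Q.commShiftIso (C := CochainComplex A ℤ) (D := DerivedCategory A) i).app
    ((HomologicalComplex.single A (ComplexShape.up ℤ) 0).obj Y)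
  let f : Q.obj ((HomologicalComplex.single A (ComplexShape.up ℤ) 0).obj X) ⟶
    (Q.obj ((HomologicalComplex.single A (ComplexShape.up ℤ) 0).obj Y))⟦i⟧ := y.hom
  let K : CochainComplex A ℤ :=
    (shiftFunctor (CochainComplex A ℤ) i).obj
      ((HomologicalComplex.single A (ComplexShape.up ℤ) 0).obj Y)
  have hK : IsZero (K.X 0) := by
    simp only [K, CochainComplex.shiftFunctor_obj_X']
    exact HomologicalComplex.isZero_single_obj_X (ComplexShape.up ℤ) 0 Y (0 + i) (by lia)
  obtain ⟨M, p, hp, h⟩ := exists_epi_single_comp_eq_zero hK (f ≫ e.inv)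
  refine ⟨M, p, hp, ?_⟩
  ext
  rw [comp_hom, mk₀_hom, ShiftedHom.mk₀_comp]
  have h' : Q.map ((HomologicalComplex.single A (ComplexShape.up ℤ) 0).map p) ≫ f = 0 := by
    rw [← cancel_mono e.inv, Limits.zero_comp, Category.assoc]
    exact h
  exact h'.trans (zero_hom (X := M) (Y := Y) (n := n + 1)).symm

end CategoryTheory.Abelian.Ext

/-! ### `Ext`-groups under fully faithful exact functors -/

namespace CategoryTheory.Functor

section

variable {E : Type u} [Category.{v} E] [Abelian E] {A : Type u'} [Category.{v'} A] [Abelian A]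
  (F : E ⥤ A)

/-- Every epimorphism onto an object of the subcategory is refined by an epimorphism of the
subcategory. -/
def RefinesEpis : Prop :=
  ∀ (N : E) (M : A) (p : M ⟶ F.obj N), Epi p → ∃ (N' : E) (f : F.obj N' ⟶ M), Epi (f ≫ p)

variable {F} [PreservesFiniteColimits F]

open Abelian in
-- A class is effaced by an epimorphism of `A`; refining that epimorphism by one with source in `E`
-- keeps the class effaced.
lemma RefinesEpis.exists_epi_comp_eq_zero [F.Full] [F.Faithful] (hF : F.RefinesEpis)
    [HasExt.{w} A] {X : E} {Y : A} {n : ℕ} (y : Ext (F.obj X) Y (n + 1)) :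
    ∃ (X' : E) (q : X' ⟶ X), Epi q ∧ (Ext.mk₀ (F.map q)).comp y (zero_add (n + 1)) = 0 := by
  obtain ⟨M, p, hp, h⟩ := y.exists_epi_comp_eq_zero
  obtain ⟨X', f, hf⟩ := hF X M p hp
  obtain ⟨q, hq⟩ := F.map_surjective (f ≫ p)
  refine ⟨X', q, F.epi_of_epi_map (by rw [hq]; exact hf), ?_⟩
  rw [hq, ← Ext.mk₀_comp_mk₀_assoc, h, Ext.comp_zero]

variable [F.Additive] [PreservesFiniteLimits F]

open Abelian in
/-- A fully faithful exact functor which refines epimorphisms induces bijections of `Ext`-groups. -/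
lemma RefinesEpis.mapExt_bijective [F.Full] [F.Faithful] (hF : F.RefinesEpis)
    [HasExt.{max u v} E] [HasExt.{max u' v'} A] (X Y : E) (n : ℕ) : Function.Bijective (F.mapExtAddHom X Y n) := by
  induction n generalizing X with
  | zero =>
    rw [F.mapExtAddHom_coe, Ext.mapExactFunctor₀]
    exact Ext.homEquiv₀.symm.bijective.comp
      (Function.Bijective.comp ⟨F.map_injective, F.map_surjective⟩ Ext.homEquiv₀.bijective)
  | succ n hn =>
    have hker : ∀ {X' : E} (q : X' ⟶ X) [Epi q],
        (ShortComplex.mk _ _ (kernel.condition q)).ShortExact := fun q _ =>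
      { exact := ShortComplex.exact_kernel q }
    refine ⟨(injective_iff_map_eq_zero _).2 fun x hx => ?_, fun y => ?_⟩
    -- Dimension shifting along the kernel of an effacing epimorphism `q`. Injectivity in degree `n
    -- + 1` uses both halves of the statement in degree `n`: the preimage of `F z` is lifted by
    -- surjectivity for `X'`, then identified by injectivity for the kernel.
    · obtain ⟨X', q, hq, h⟩ := x.exists_epi_comp_eq_zero
      have hS := hker q
      obtain ⟨z, rfl⟩ := Ext.contravariant_sequence_exact₃ hS Y x h (add_comm 1 n)
      rw [F.mapExtAddHom_apply, Ext.mapExactFunctor_comp, Ext.mapExactFunctor_extClass] at hx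
      obtain ⟨a, ha⟩ := Ext.contravariant_sequence_exact₁ (hS.map_of_exact F) (F.obj Y) _ _ hx
      obtain ⟨b, rfl⟩ := (hn X').2 a
      have hz : z = (Ext.mk₀ (kernel.ι q)).comp b (zero_add n) := (hn _).1 (by
        rw [F.mapExtAddHom_apply, F.mapExtAddHom_apply, Ext.mapExactFunctor_comp,
          Ext.mapExactFunctor_mk₀]
        exact ha.symm)
      rw [hz]
      exact hS.extClass_comp_assoc b
    · obtain ⟨X', q, hq, h⟩ := hF.exists_epi_comp_eq_zero y
      have hS := hker q
      obtain ⟨z, rfl⟩ := Ext.contravariant_sequence_exact₃ (hS.map_of_exact F) (F.obj Y) y h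
        (add_comm 1 n)
      obtain ⟨a, rfl⟩ := (hn _).2 z
      refine ⟨hS.extClass.comp a (add_comm 1 n), ?_⟩
      rw [F.mapExtAddHom_apply, Ext.mapExactFunctor_comp, Ext.mapExactFunctor_extClass]
      rfl

end

/-! ### Dévissage for triangulated functors -/

section

variable {T : Type u} [Category.{v} T] {T' : Type u'} [Category.{v'} T'] (G : T ⥤ T')

/-- The functor `G` induces a bijection from the morphisms `X ⟶ Y`. -/
def MapBijective (X Y : T) : Prop := Function.Bijective (G.map : (X ⟶ Y) → _)

variable {G}

lemma MapBijective.of_iso {X Y X' Y' : T} (h : G.MapBijective X Y) (e : X ≅ X') (e' : Y ≅ Y') :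
    G.MapBijective X' Y' := by
  refine ⟨fun f g hfg => ?_, fun φ => ?_⟩
  · have := h.1 (a₁ := e.hom ≫ f ≫ e'.inv) (a₂ := e.hom ≫ g ≫ e'.inv) (by simp [hfg])
    simpa using this
  · obtain ⟨f, hf⟩ := h.2 (G.map e.hom ≫ φ ≫ G.map e'.inv)
    refine ⟨e.inv ≫ f ≫ e'.hom, ?_⟩
    rw [G.map_comp, G.map_comp, hf]
    simp only [Category.assoc, ← G.map_comp, Iso.inv_hom_id, G.map_id, Category.comp_id]
    rw [← Category.assoc, ← G.map_comp, Iso.inv_hom_id, G.map_id, Category.id_comp]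

variable [HasShift T ℤ] [HasShift T' ℤ] [G.CommShift ℤ]

lemma MapBijective.shift {X Y : T} (h : G.MapBijective X Y) (a : ℤ) :
    G.MapBijective (X⟦a⟧) (Y⟦a⟧) := by
  have key : ∀ f : X ⟶ Y, G.map (f⟦a⟧') =
      (G.commShiftIso a).hom.app X ≫ (G.map f)⟦a⟧' ≫ (G.commShiftIso a).inv.app Y := fun f => by
    have := (G.commShiftIso a).hom.naturality f
    dsimp at this
    rw [← reassoc_of% this]
    simp
  refine ⟨fun f g hfg => ?_, fun φ => ?_⟩
  · obtain ⟨f, rfl⟩ := (shiftFunctor T a).map_surjective f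
    obtain ⟨g, rfl⟩ := (shiftFunctor T a).map_surjective g
    rw [key, key, cancel_epi, cancel_mono] at hfg
    rw [h.1 ((shiftFunctor T' a).map_injective hfg)]
  · obtain ⟨ψ, hψ⟩ := (shiftFunctor T' a).map_surjective
      ((G.commShiftIso a).inv.app X ≫ φ ≫ (G.commShiftIso a).hom.app Y)
    obtain ⟨f, rfl⟩ := h.2 ψ
    refine ⟨f⟦a⟧', ?_⟩
    rw [key, hψ]
    simp

lemma MapBijective.shift_right {X Y : T} {a b : ℤ} (hab : a + b = 0)
    (h : G.MapBijective (X⟦a⟧) Y) : G.MapBijective X (Y⟦b⟧) :=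
  (h.shift b).of_iso ((shiftFunctorCompIsoId T a b hab).app X) (Iso.refl _)

lemma MapBijective.shift_left {X Y : T} {a b : ℤ} (hab : a + b = 0)
    (h : G.MapBijective X (Y⟦a⟧)) : G.MapBijective (X⟦b⟧) Y :=
  (h.shift b).of_iso (Iso.refl _) ((shiftFunctorCompIsoId T a b hab).app Y)

open Pretriangulated

variable [Preadditive T] [HasZeroObject T] [∀ n : ℤ, (shiftFunctor T n).Additive]
  [Pretriangulated T] [Preadditive T'] [HasZeroObject T'] [∀ n : ℤ, (shiftFunctor T' n).Additive]
  [Pretriangulated T'] [G.IsTriangulated]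

/-- The five lemma for `Hom(X, -)`; the four hypotheses are the neighbours of `Δ.obj₂` in the long
exact sequence. -/
lemma MapBijective.of_triangle_right {Δ : Triangle T} (hΔ : Δ ∈ distTriang T) {X : T}
    (h₁ : G.MapBijective X Δ.obj₁) (h₁' : G.MapBijective X (Δ.obj₁⟦(1 : ℤ)⟧))
    (h₃ : G.MapBijective X Δ.obj₃) (h₃' : G.MapBijective X (Δ.obj₃⟦(-1 : ℤ)⟧)) :
    G.MapBijective X Δ.obj₂ := by
  have hz : ∀ {Z : T} (_ : G.MapBijective X Z) {f : X ⟶ Z}, G.map f = 0 → f = 0 :=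
    fun h f hf => h.1 (by rw [hf, G.map_zero])
  have hGΔ := G.map_distinguished Δ hΔ
  have hGΔ' := G.map_distinguished Δ.invRotate (inv_rot_of_distTriang Δ hΔ)
  refine ⟨fun f g hfg => ?_, fun φ => ?_⟩
  · rw [← sub_eq_zero]
    have h0 : G.map (f - g) = 0 := by rw [G.map_sub, hfg, sub_self]
    obtain ⟨α, hα⟩ := Triangle.coyoneda_exact₂ Δ hΔ (f - g)
      (hz h₃ (by rw [G.map_comp, h0, zero_comp]))
    obtain ⟨γ, hγ⟩ : ∃ γ : G.obj X ⟶ G.obj (Δ.obj₃⟦(-1 : ℤ)⟧),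
        G.map α = γ ≫ G.map Δ.invRotate.mor₁ :=
      Triangle.coyoneda_exact₂ _ hGΔ' (G.map α) (by
        have h1 : G.map α ≫ G.map Δ.mor₁ = 0 := by rw [← G.map_comp, ← hα, h0]
        exact h1)
    obtain ⟨γ, rfl⟩ := h₃'.2 γ
    have h2 : α = γ ≫ Δ.invRotate.mor₁ := h₁.1 (by rw [hγ]; exact (G.map_comp _ _).symm)
    have h3 : Δ.invRotate.mor₁ ≫ Δ.mor₁ = 0 :=
      comp_distTriang_mor_zero₁₂ _ (inv_rot_of_distTriang Δ hΔ)
    rw [hα, h2]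
    exact (Category.assoc _ _ _).trans ((congrArg (fun t => γ ≫ t) h3).trans comp_zero)
  · obtain ⟨β, hβ⟩ := h₃.2 (φ ≫ G.map Δ.mor₂)
    obtain ⟨β', hβ'⟩ := Triangle.coyoneda_exact₃ Δ hΔ β (hz h₁' (by
      rw [G.map_comp, hβ, Category.assoc, ← G.map_comp, comp_distTriang_mor_zero₂₃ _ hΔ,
        G.map_zero, comp_zero]))
    obtain ⟨ψ, hψ⟩ : ∃ ψ : G.obj X ⟶ G.obj Δ.obj₁, φ - G.map β' = ψ ≫ G.map Δ.mor₁ :=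
      Triangle.coyoneda_exact₂ _ hGΔ (φ - G.map β') (by
        have h1 : (φ - G.map β') ≫ G.map Δ.mor₂ = 0 := by
          rw [Preadditive.sub_comp, ← hβ, hβ', G.map_comp, sub_self]
        exact h1)
    obtain ⟨α, rfl⟩ := h₁.2 ψ
    exact ⟨α ≫ Δ.mor₁ + β', by rw [G.map_add, G.map_comp, ← hψ, sub_add_cancel]⟩

/-- The five lemma for the contravariant functor `Hom(-, Y)`. -/
lemma MapBijective.of_triangle_left {Δ : Triangle T} (hΔ : Δ ∈ distTriang T) {Y : T}
    (h₁ : G.MapBijective Δ.obj₁ Y) (h₁' : G.MapBijective (Δ.obj₁⟦(1 : ℤ)⟧) Y)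
    (h₃ : G.MapBijective Δ.obj₃ Y) (h₃' : G.MapBijective (Δ.obj₃⟦(-1 : ℤ)⟧) Y) :
    G.MapBijective Δ.obj₂ Y := by
  have hz : ∀ {Z : T} (_ : G.MapBijective Z Y) {f : Z ⟶ Y}, G.map f = 0 → f = 0 :=
    fun h f hf => h.1 (by rw [hf, G.map_zero])
  have hΔ' := inv_rot_of_distTriang Δ hΔ
  have hΔ'' := rot_of_distTriang Δ hΔ
  have hGΔ := G.map_distinguished Δ hΔ
  have hGΔ'' := G.map_distinguished Δ.rotate hΔ''
  refine ⟨fun f g hfg => ?_, fun φ => ?_⟩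
  · rw [← sub_eq_zero]
    have h0 : G.map (f - g) = 0 := by rw [G.map_sub, hfg, sub_self]
    obtain ⟨α, hα⟩ := Triangle.yoneda_exact₂ Δ hΔ (f - g)
      (hz h₁ (by rw [G.map_comp, h0, comp_zero]))
    obtain ⟨γ, hγ⟩ : ∃ γ : G.obj (Δ.obj₁⟦(1 : ℤ)⟧) ⟶ G.obj Y, G.map α = G.map Δ.mor₃ ≫ γ :=
      Triangle.yoneda_exact₂ _ hGΔ'' (G.map α) (by
        have h1 : G.map Δ.mor₂ ≫ G.map α = 0 := by rw [← G.map_comp, ← hα, h0]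
        exact h1)
    obtain ⟨γ, rfl⟩ := h₁'.2 γ
    have h2 : α = Δ.mor₃ ≫ γ := h₃.1 (by rw [hγ, G.map_comp])
    rw [hα, h2, ← Category.assoc, comp_distTriang_mor_zero₂₃ _ hΔ, zero_comp]
  · obtain ⟨β, hβ⟩ := h₁.2 (G.map Δ.mor₁ ≫ φ)
    obtain ⟨β', hβ'⟩ : ∃ β' : Δ.obj₂ ⟶ Y, β = Δ.mor₁ ≫ β' :=
      Triangle.yoneda_exact₂ Δ.invRotate hΔ' β (by
        have h3 : Δ.invRotate.mor₁ ≫ Δ.mor₁ = 0 := comp_distTriang_mor_zero₁₂ _ hΔ'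
        refine hz h₃' ?_
        refine (G.map_comp _ _).trans ?_
        refine (congrArg (fun t => G.map Δ.invRotate.mor₁ ≫ t) hβ).trans ?_
        refine (Category.assoc _ _ _).symm.trans ?_
        refine (congrArg (fun t => t ≫ φ) ((G.map_comp _ _).symm.trans
          ((congrArg G.map h3).trans (G.map_zero _ _)))).trans zero_comp)
    obtain ⟨ψ, hψ⟩ : ∃ ψ : G.obj Δ.obj₃ ⟶ G.obj Y, φ - G.map β' = G.map Δ.mor₂ ≫ ψ :=
      Triangle.yoneda_exact₂ _ hGΔ (φ - G.map β') (by
        have h1 : G.map Δ.mor₁ ≫ (φ - G.map β') = 0 := by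
          rw [Preadditive.comp_sub, ← hβ, hβ', G.map_comp, sub_self]
        exact h1)
    obtain ⟨α, rfl⟩ := h₃.2 ψ
    exact ⟨Δ.mor₂ ≫ α + β', by rw [G.map_add, G.map_comp, ← hψ, sub_add_cancel]⟩

end

end CategoryTheory.Functor

/-! ### Fully faithful exact functors and bounded derived categories -/

namespace CategoryTheory.Functor

open _root_.DerivedCategory Pretriangulated ZeroObject

lemma MapBijective.of_subsingleton {T : Type u} [Category.{v} T] {T' : Type u'} [Category.{v'} T']
    {G : T ⥤ T'} {X Y : T} [Nonempty (X ⟶ Y)] [Subsingleton (X ⟶ Y)]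
    [Subsingleton (G.obj X ⟶ G.obj Y)] : G.MapBijective X Y :=
  ⟨Function.injective_of_subsingleton _, fun _ => ⟨Classical.arbitrary _, Subsingleton.elim _ _⟩⟩

variable {E : Type u} [Category.{v} E] [Abelian E] {A : Type u'} [Category.{v'} A] [Abelian A]
  {F : E ⥤ A} [F.Additive] [PreservesFiniteLimits F] [PreservesFiniteColimits F]

lemma isGE_mapDerivedCategory (X : DerivedCategory E) (n : ℤ) [hX : X.IsGE n] :
    (F.mapDerivedCategory.obj X).IsGE n :=
  (isGE_iff _ _).2 fun i hi => (F.map_isZero ((isGE_iff _ _).1 hX i hi)).of_iso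
    ((mapDerivedHomologyIso F i).app X)

lemma isLE_mapDerivedCategory (X : DerivedCategory E) (n : ℤ) [hX : X.IsLE n] :
    (F.mapDerivedCategory.obj X).IsLE n :=
  (isLE_iff _ _).2 fun i hi => (F.map_isZero ((isLE_iff _ _).1 hX i hi)).of_iso
    ((mapDerivedHomologyIso F i).app X)

lemma mapBijective_of_isLE_of_isGE (X Y : DerivedCategory E) (n m : ℤ) (hnm : n < m) [X.IsLE n]
    [Y.IsGE m] : F.mapDerivedCategory.MapBijective X Y := by
  have := isLE_mapDerivedCategory (F := F) X n
  have := isGE_mapDerivedCategory (F := F) Y m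
  have h1 : Subsingleton (X ⟶ Y) :=
    ⟨fun f g => (TStructure.t.zero_of_isLE_of_isGE f n m hnm inferInstance inferInstance).trans
      (TStructure.t.zero_of_isLE_of_isGE g n m hnm inferInstance inferInstance).symm⟩
  have h2 : Subsingleton (F.mapDerivedCategory.obj X ⟶ F.mapDerivedCategory.obj Y) :=
    ⟨fun f g => (TStructure.t.zero_of_isLE_of_isGE f n m hnm inferInstance inferInstance).trans
      (TStructure.t.zero_of_isLE_of_isGE g n m hnm inferInstance inferInstance).symm⟩
  exact MapBijective.of_subsingleton

variable [F.Full] [F.Faithful]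

/-- Under the identification of these morphism groups with `Ext`-groups, the functor acts as the
comparison map on `Ext`. -/
lemma RefinesEpis.mapBijective_single_zero (hF : F.RefinesEpis) (V W : E) (i : ℕ) :
    F.mapDerivedCategory.MapBijective ((singleFunctor E 0).obj V)
      (((singleFunctor E 0).obj W)⟦(i : ℤ)⟧) := by
  have : HasExt.{max u v} E := HasExt.standard E
  have : HasExt.{max u' v'} A := HasExt.standard A
  have h := hF.mapExt_bijective V W i
  let α := F.mapDerivedCategorySingleFunctor 0
  let e : ((F.mapDerivedCategory.obj ((singleFunctor E 0).obj V)) ⟶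
      F.mapDerivedCategory.obj (((singleFunctor E 0).obj W)⟦(i : ℤ)⟧)) ≃
      ShiftedHom ((singleFunctor A 0).obj (F.obj V)) ((singleFunctor A 0).obj (F.obj W)) (i : ℤ) :=
    Iso.homCongr (α.app V) ((F.mapDerivedCategory.commShiftIso (i : ℤ)).app _ ≪≫
      (shiftFunctor _ (i : ℤ)).mapIso (α.app W))
  have key : ∀ x : Abelian.Ext.{max u v} V W i,
      e (F.mapDerivedCategory.map x.hom) = (x.mapExactFunctor F : Abelian.Ext.{max u' v'} _ _ _).hom := by
    intro x
    rw [Abelian.Ext.mapExactFunctor_hom]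
    simp only [e, Iso.homCongr_apply]
    refine congrArg (fun t => α.inv.app V ≫ t) ?_
    exact (Category.assoc _ _ _).symm
  have h1 : (F.mapDerivedCategory.map : (_ ⟶ ((singleFunctor E 0).obj W)⟦(i : ℤ)⟧) → _) =
      e.symm ∘ (Abelian.Ext.homEquiv (X := F.obj V) (Y := F.obj W) (n := i)) ∘
        (F.mapExtAddHom V W i) ∘ (Abelian.Ext.homEquiv (X := V) (Y := W) (n := i)).symm := by
    funext f
    obtain ⟨x, rfl⟩ := (Abelian.Ext.homEquiv.{max u v} (X := V) (Y := W) (n := i)).surjective f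
    simp only [Function.comp_apply, Equiv.symm_apply_apply]
    rw [Equiv.eq_symm_apply]
    exact key x
  unfold MapBijective
  rw [h1]
  exact e.symm.bijective.comp ((Equiv.bijective _).comp (h.comp (Equiv.bijective _)))

lemma RefinesEpis.mapBijective_of_concentrated (hF : F.RefinesEpis) (X Y : DerivedCategory E)
    (n m : ℤ) [X.IsGE n] [X.IsLE n] [Y.IsGE m] [Y.IsLE m] :
    F.mapDerivedCategory.MapBijective X Y := by
  rcases lt_or_ge n m with hnm | hnm
  · exact mapBijective_of_isLE_of_isGE X Y n m hnm
  · obtain ⟨i, hi⟩ := Int.eq_ofNat_of_zero_le (show 0 ≤ n - m by lia)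
    obtain ⟨V, ⟨e⟩⟩ := exists_iso_singleFunctor_obj_of_isGE_of_isLE X n
    obtain ⟨W, ⟨e'⟩⟩ := exists_iso_singleFunctor_obj_of_isGE_of_isLE Y m
    have h := hF.mapBijective_single_zero V W i
    let α := ((singleFunctors E).shiftIso n 0 n (by lia)).app V
    let β := ((singleFunctors E).shiftIso n (m - n) m (by lia)).app W
    let γ := ((singleFunctors E).shiftIso (i : ℤ) (m - n) 0 (by lia)).app W
    have h2 : F.mapDerivedCategory.MapBijective (X⟦n⟧) (Y⟦n⟧) :=
      h.of_iso (α.symm ≪≫ (shiftFunctor _ n).mapIso e.symm)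
        (γ ≪≫ β.symm ≪≫ (shiftFunctor _ n).mapIso e'.symm)
    exact (h2.shift (-n)).of_iso ((shiftFunctorCompIsoId _ n (-n) (by lia)).app X)
      ((shiftFunctorCompIsoId _ n (-n) (by lia)).app Y)

lemma RefinesEpis.mapBijective_of_concentrated_left (hF : F.RefinesEpis) (Y : DerivedCategory E)
    (hY : TStructure.t.bounded Y) (X : DerivedCategory E) (n : ℤ) [X.IsGE n] [X.IsLE n] :
    F.mapDerivedCategory.MapBijective X Y := by
  -- Quantifying over every `X` concentrated in one degree makes the property stable under shifts,
  -- which the five lemma needs.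
  let P : ObjectProperty (DerivedCategory E) := fun Y =>
    ∀ (X : DerivedCategory E) (n : ℤ), X.IsGE n → X.IsLE n → F.mapDerivedCategory.MapBijective X Y
  have : P.IsClosedUnderIsomorphisms :=
    ⟨fun e h X n h1 h2 => (h X n h1 h2).of_iso (Iso.refl _) e⟩
  have hshift : ∀ {Y : DerivedCategory E}, P Y → ∀ (X : DerivedCategory E) (n a b : ℤ),
      a + b = 0 → X.IsGE n → X.IsLE n → F.mapDerivedCategory.MapBijective X (Y⟦b⟧) :=
    fun h X n a b hab h1 h2 => MapBijective.shift_right hab (h (X⟦a⟧) (n - a)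
      (TStructure.t.isGE_shift X n a _ (by lia)) (TStructure.t.isLE_shift X n a _ (by lia)))
  refine bounded_induction P (fun Y hY X n _ _ => ?_) (fun Δ hΔ h₁ h₃ X n hn hn' => ?_) Y hY
    (fun m X n _ _ => hF.mapBijective_of_concentrated X _ n m) X n inferInstance inferInstance
  · have : Y.IsGE (n + 1) := (isGE_iff _ _).2 fun i _ => (homologyFunctor E i).map_isZero hY
    exact mapBijective_of_isLE_of_isGE X Y n (n + 1) (by lia)
  · exact MapBijective.of_triangle_right hΔ (h₁ X n hn hn')
      (hshift h₁ X n (-1) 1 (by lia) hn hn') (h₃ X n hn hn')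
      (hshift h₃ X n 1 (-1) (by lia) hn hn')

lemma RefinesEpis.mapBijective (hF : F.RefinesEpis) (X Y : DerivedCategory E)
    (hX : TStructure.t.bounded X) (hY : TStructure.t.bounded Y) :
    F.mapDerivedCategory.MapBijective X Y := by
  let P : ObjectProperty (DerivedCategory E) := fun X =>
    ∀ Y : DerivedCategory E, TStructure.t.bounded Y → F.mapDerivedCategory.MapBijective X Y
  have : P.IsClosedUnderIsomorphisms :=
    ⟨fun e h Y hY => (h Y hY).of_iso e (Iso.refl _)⟩
  have hshift : ∀ {X : DerivedCategory E}, P X → ∀ (Y : DerivedCategory E) (a b : ℤ),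
      a + b = 0 → TStructure.t.bounded Y → F.mapDerivedCategory.MapBijective (X⟦b⟧) Y :=
    fun h Y a b hab hY => MapBijective.shift_left hab (h (Y⟦a⟧) (by
      obtain ⟨c, d, hc, hd⟩ := (bounded_iff Y).1 hY
      exact (bounded_iff _).2 ⟨c - a, d - a, TStructure.t.isGE_shift Y c a _ (by lia),
        TStructure.t.isLE_shift Y d a _ (by lia)⟩))
  refine bounded_induction P (fun X hX Y hY => ?_) (fun Δ hΔ h₁ h₃ Y hY => ?_) X hX
    (fun m Y hY => hF.mapBijective_of_concentrated_left Y hY _ m) Y hY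
  · obtain ⟨c, d, hc, hd⟩ := (bounded_iff Y).1 hY
    have : X.IsLE (c - 1) := (isLE_iff _ _).2 fun i _ => (homologyFunctor E i).map_isZero hX
    exact mapBijective_of_isLE_of_isGE X Y (c - 1) c (by lia)
  · exact MapBijective.of_triangle_left hΔ (h₁ Y hY) (hshift h₁ Y (-1) 1 (by lia) hY)
      (h₃ Y hY) (hshift h₃ Y 1 (-1) (by lia) hY)

/-- A bounded complex whose cohomology objects are in the essential image of `F` is in the
essential image of the derived functor. -/
lemma RefinesEpis.exists_iso (hF : F.RefinesEpis) (Z : DerivedCategory A)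
    (hZ : TStructure.t.bounded Z) (h : ∀ n, F.essImage ((homologyFunctor A n).obj Z)) :
    ∃ X : DerivedCategory E, TStructure.t.bounded X ∧ Nonempty (F.mapDerivedCategory.obj X ≅ Z) := by
  let P : ObjectProperty (DerivedCategory A) := fun Z =>
    ∃ X : DerivedCategory E, TStructure.t.bounded X ∧ Nonempty (F.mapDerivedCategory.obj X ≅ Z)
  have : P.IsClosedUnderIsomorphisms :=
    ⟨fun e ⟨X, hX, ⟨e'⟩⟩ => ⟨X, hX, ⟨e' ≪≫ e⟩⟩⟩
  refine bounded_induction P (fun Z hZ => ?_) (fun Δ hΔ h₁ h₃ => ?_) Z hZ (fun n => ?_)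
  · let X : DerivedCategory E := (singleFunctor E 0).obj (0 : E)
    have hX : IsZero X := (singleFunctor E 0).map_isZero (isZero_zero E)
    exact ⟨X, (bounded_iff _).2 ⟨0, 0, inferInstance, inferInstance⟩,
      ⟨(F.mapDerivedCategory.map_isZero hX).iso hZ⟩⟩
  · obtain ⟨X₁, hX₁, ⟨e₁⟩⟩ := h₁
    obtain ⟨X₃, hX₃, ⟨e₃⟩⟩ := h₃
    have hX₁' : TStructure.t.bounded (X₁⟦(1 : ℤ)⟧) := TStructure.t.bounded.le_shift 1 _ hX₁
    let σ := (F.mapDerivedCategory.commShiftIso (1 : ℤ)).app X₁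
    -- The connecting morphism of the given triangle lifts by fullness; completing its lift to a
    -- triangle yields the required object.
    obtain ⟨δ, hδ⟩ := (hF.mapBijective X₃ (X₁⟦(1 : ℤ)⟧) hX₃ hX₁').2
      (e₃.hom ≫ Δ.mor₃ ≫ e₁.inv⟦(1 : ℤ)⟧' ≫ σ.inv)
    obtain ⟨X₂, f, g, hT⟩ := distinguished_cocone_triangle₂ δ
    have hX₂ : TStructure.t.bounded X₂ :=
      TStructure.t.bounded.ext_of_isTriangulatedClosed₂ _ hT hX₁ hX₃
    refine ⟨X₂, hX₂, ⟨Triangle.π₂.mapIso (isoTriangleOfIso₁₃ _ _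
      (F.mapDerivedCategory.map_distinguished _ hT) hΔ e₁ e₃ ?_)⟩⟩
    change (F.mapDerivedCategory.map δ ≫ σ.hom) ≫ e₁.hom⟦(1 : ℤ)⟧' = _
    rw [hδ]
    simp only [Category.assoc, ← Functor.map_comp, Iso.inv_hom_id,
      CategoryTheory.Functor.map_id, Category.comp_id]
    rfl
  · obtain ⟨V, ⟨e⟩⟩ := h n
    exact ⟨(singleFunctor E n).obj V, (bounded_iff _).2 ⟨n, n, inferInstance, inferInstance⟩,
      ⟨(F.mapDerivedCategorySingleFunctor n).app V ≪≫ (singleFunctor A n).mapIso e⟩⟩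

end CategoryTheory.Functor

/-! ### Finitely presented objects refine epimorphisms -/

/-- The cokernels of the finite partial sums form a filtered system. The map from `N` to their
colimit is zero, because the maps `G i ⟶ M` are jointly epimorphic; `N` being finitely presented, it
already vanishes at a finite stage. -/
lemma exists_finset_epi_of_isSeparating {A : Type u} [Category.{w} A] [Abelian A]
    [HasFiniteBiproducts A] [HasFilteredColimitsOfSize.{w, w} A] {ι : Type w} {G : ι → A}
    (hG : (ObjectProperty.ofObj G).IsSeparating) {M N : A} (hN : IsFinitelyPresentable.{w} N)
    (p : M ⟶ N) [Epi p] :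
    ∃ s : Finset (Σ i, G i ⟶ M), Epi (biproduct.desc (fun x : s => x.1.2 ≫ p)) := by
  classical
  let d (s : Finset (Σ i, G i ⟶ M)) : (⨁ fun x : s => G x.1.1) ⟶ N :=
    biproduct.desc (fun x : s => x.1.2 ≫ p)
  have hd : ∀ s (T : A) (g : N ⟶ T), d s ≫ g = 0 ↔ ∀ x ∈ s, x.2 ≫ p ≫ g = 0 := by
    intro s T g
    refine ⟨fun h x hx => ?_, fun h => biproduct.hom_ext' _ _ fun x => ?_⟩
    · have := congrArg (fun t => biproduct.ι (fun x : s => G x.1.1) ⟨x, hx⟩ ≫ t) h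
      simpa [d] using this
    · simpa [d] using h x.1 x.2
  let D : Finset (Σ i, G i ⟶ M) ⥤ A :=
    { obj := fun s => cokernel (d s)
      map := fun {s t} hst => cokernel.desc _ (cokernel.π (d t)) ((hd s _ _).2 fun x hx =>
        (hd t _ _).1 (cokernel.condition _) x (leOfHom hst hx))
      map_id := fun s => by rw [← cancel_epi (cokernel.π _)]; simp
      map_comp := fun f g => by rw [← cancel_epi (cokernel.π _)]; simp }
  have hD : ∀ {s t} (hst : s ⟶ t), cokernel.π (d s) ≫ D.map hst = cokernel.π (d t) :=
    fun hst => cokernel.π_desc _ _ _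
  have h0 : cokernel.π (d ∅) ≫ colimit.ι D ∅ = 0 := by
    have h1 : ∀ s, cokernel.π (d ∅) ≫ colimit.ι D ∅ = cokernel.π (d s) ≫ colimit.ι D s :=
      fun s => by rw [← colimit.w D (homOfLE (Finset.empty_subset s)), ← Category.assoc, hD]
    rw [← cancel_epi p, comp_zero]
    refine hG _ _ ?_
    rintro _ ⟨i⟩ f
    rw [h1 {⟨i, f⟩}, comp_zero]
    exact (hd {⟨i, f⟩} _ _).1 (by rw [cokernel.condition_assoc, zero_comp]) ⟨i, f⟩ (by simp)
  obtain ⟨s, u, v, hu⟩ := IsFinitelyPresentable.exists_eq_of_isColimit (colimit.isColimit D)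
    (cokernel.π (d ∅)) (0 : N ⟶ D.obj ∅) (h0.trans zero_comp.symm)
  rw [hD, zero_comp] at hu
  exact ⟨s, Preadditive.epi_of_cokernel_zero hu⟩

lemma refinesEpis_isFinitelyPresentable {A : Type u} [Category.{w} A] [Abelian A]
    [HasFilteredColimitsOfSize.{w, w} A] {ι : Type w} {G : ι → A}
    (hG : (ObjectProperty.ofObj G).IsSeparating) (hG' : ∀ i, IsFinitelyPresentable.{w} (G i)) :
    (ObjectProperty.isFinitelyPresentable.{w} A).ι.RefinesEpis := by
  intro N M p hp
  have : HasFiniteBiproducts A := Abelian.hasFiniteBiproducts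
  obtain ⟨s, hs⟩ := exists_finset_epi_of_isSeparating hG N.property p
  have h : ObjectProperty.isFinitelyPresentable.{w} A (⨁ fun x : s => G x.1.1) :=
    ObjectProperty.prop_of_iso _ (biproduct.isoProduct _).symm
      (ObjectProperty.prop_product _ fun x => hG' x.1.1)
  let f : (⨁ fun x : s => G x.1.1) ⟶ M := biproduct.desc fun x : s => x.1.2
  have hf : f ≫ p = biproduct.desc (fun x : s => x.1.2 ≫ p) :=
    biproduct.hom_ext' _ _ fun x => by rw [biproduct.ι_desc_assoc, biproduct.ι_desc]
  exact ⟨⟨_, h⟩, f, hf ▸ hs⟩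

lemma refinesEpis_baseExt (k : Type w) [Field k] (L : Type w) [Field L] [Algebra k L]
    (C : Type u) [Category.{v} C] [EssentiallySmall.{w} C] [Abelian C] [Linear k C] :
    (ObjectProperty.isFinitelyPresentable.{w} (IndBase k L C)).ι.RefinesEpis :=
  have : HasFilteredColimitsOfSize.{w, w} (IndBase k L C) := ⟨fun _ _ _ => inferInstance⟩
  refinesEpis_isFinitelyPresentable (freeFamily_isSeparating k L C)
    fun c => freeFamily_le k L C _ ⟨c⟩

/-! ### The forgetful functor as a composition -/

section

variable {A : Type*} [Category* A] [Abelian A] {A' : Type*} [Category* A'] [Abelian A']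
  {A'' : Type*} [Category* A''] [Abelian A'']

open DerivedCategory

/-- The functors induced on derived categories by exact functors are compatible with
composition. -/
noncomputable def mapDerivedCompIso (F : A ⥤ A') [F.Additive] [PreservesFiniteLimits F]
    [PreservesFiniteColimits F] (G : A' ⥤ A'') [G.Additive] [PreservesFiniteLimits G]
    [PreservesFiniteColimits G] :
    (F ⋙ G).mapDerivedCategory ≅ F.mapDerivedCategory ⋙ G.mapDerivedCategory :=
  letI : Localization.Lifting Q (HomologicalComplex.quasiIso A (ComplexShape.up ℤ))
      (F.mapHomologicalComplex (ComplexShape.up ℤ) ⋙ G.mapHomologicalComplex (ComplexShape.up ℤ) ⋙ Q)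
      (F.mapDerivedCategory ⋙ G.mapDerivedCategory) :=
    ⟨Functor.isoWhiskerRight F.mapDerivedCategoryFactors G.mapDerivedCategory ≪≫
      Functor.isoWhiskerLeft (F.mapHomologicalComplex (ComplexShape.up ℤ))
        G.mapDerivedCategoryFactors⟩
  letI : Localization.Lifting Q (HomologicalComplex.quasiIso A (ComplexShape.up ℤ))
      ((F ⋙ G).mapHomologicalComplex (ComplexShape.up ℤ) ⋙ Q) (F ⋙ G).mapDerivedCategory :=
    ⟨(F ⋙ G).mapDerivedCategoryFactors⟩
  Localization.liftNatIso Q (HomologicalComplex.quasiIso A (ComplexShape.up ℤ))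
    ((F ⋙ G).mapHomologicalComplex (ComplexShape.up ℤ) ⋙ Q)
    (F.mapHomologicalComplex (ComplexShape.up ℤ) ⋙ G.mapHomologicalComplex (ComplexShape.up ℤ) ⋙ Q)
    _ _ (Iso.refl _)

end

/-! ### The three properties of `[F]` -/

section

open DerivedCategory

variable {k : Type w} [Field k] {L : Type w} [Field L] [Algebra k L]
  {C : Type u} [Category.{v} C] [EssentiallySmall.{w} C] [Abelian C] [Linear k C]

lemma exists_hasEssDimLE_of_essDim_le {d : ℕ} (h : essDim.{w} k C ≤ d) :
    ∃ e ≤ d, HasEssDimLE.{w} k C e := by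
  by_contra! hc
  have h1 : ((d + 1 : ℕ) : ℕ∞) ≤ essDim.{w} k C := le_iInf₂ fun e he =>
    Nat.cast_le.2 (by by_contra hlt; exact hc e (by lia) he)
  have h2 := Nat.cast_le.1 (h1.trans h)
  lia

lemma relPD_of_essDim_le [CharZero k] (hE2 : SatisfiesE2.{w} k C) {d : ℕ} (h : essDim.{w} k C ≤ d)
    (V : BaseExt k L C) : (BObj.freeAdjunction k L (IndCat.{w} C)).RelPD d V.obj := by
  obtain ⟨e, he, hd⟩ := exists_hasEssDimLE_of_essDim_le h
  exact (relPD_of_hasEssDimLE hE2 hd V).mono he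

variable [SatisfiesE1.{w} k C]

/-- The functor `D(C_[L]) ⥤ D((Ind C)_L)`. -/
noncomputable abbrev dBaseι (k : Type w) [Field k] (L : Type w) [Field L] [Algebra k L]
    (C : Type u) [Category.{v} C] [EssentiallySmall.{w} C] [Abelian C] [Linear k C]
    [SatisfiesE1.{w} k C] : DerivedCategory (BaseExt k L C) ⥤ DerivedCategory (IndBase k L C) :=
  (ObjectProperty.isFinitelyPresentable.{w} (IndBase k L C)).ι.mapDerivedCategory

/-- The factorization of the forgetful functor through `D((Ind C)_L)`. -/
noncomputable def forgetFactors (X : DerivedCategory (BaseExt k L C)) :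
    (forgetBase k L C).mapDerivedCategory.obj X ≅
      (BObj.dForget k L (IndCat.{w} C)).obj ((dBaseι k L C).obj X) :=
  (mapDerivedCompIso (ObjectProperty.isFinitelyPresentable.{w} (IndBase k L C)).ι
    (BObj.forget k L (IndCat.{w} C))).app X

lemma forgetFactors_naturality {X Y : DerivedCategory (BaseExt k L C)} (f : X ⟶ Y) :
    (forgetBase k L C).mapDerivedCategory.map f ≫ (forgetFactors Y).hom = (forgetFactors X).hom ≫
      (BObj.dForget k L (IndCat.{w} C)).map ((dBaseι k L C).map f) :=
  (mapDerivedCompIso (ObjectProperty.isFinitelyPresentable.{w} (IndBase k L C)).ι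
    (BObj.forget k L (IndCat.{w} C))).hom.naturality f

/-- The factorization through `D((Ind C)_L)` respects the action of `L`, so `dLift` can stand in for
the derived forgetful functor. -/
lemma forgetFactors_smul (X : DerivedCategory (BaseExt k L C)) (b : L) :
    (forgetBase k L C).mapDerivedCategory.map (b • 𝟙 X) ≫ (forgetFactors X).hom =
      (forgetFactors X).hom ≫
        ((BObj.dLift k L (IndCat.{w} C)).obj ((dBaseι k L C).obj X)).act b := by
  rw [forgetFactors_naturality, Functor.map_smul, CategoryTheory.Functor.map_id]
  rfl

lemma bounded_dBaseι {X : DerivedCategory (BaseExt k L C)} (hX : TStructure.t.bounded X) :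
    TStructure.t.bounded ((dBaseι k L C).obj X) :=
  bounded_mapDerivedCategory _ ⟨X, hX⟩

lemma exists_homology_dBaseι_iso (X : DerivedCategory (BaseExt k L C)) (n : ℤ) :
    ∃ V : BaseExt k L C,
      Nonempty (V.obj ≅ (homologyFunctor (IndBase k L C) n).obj ((dBaseι k L C).obj X)) :=
  ⟨_, ⟨((mapDerivedHomologyIso
    (ObjectProperty.isFinitelyPresentable.{w} (IndBase k L C)).ι n).app X).symm⟩⟩

variable [CharZero k]

lemma relPD_homology_dBaseι (hE2 : SatisfiesE2.{w} k C) {d : ℕ} (h : essDim.{w} k C ≤ d)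
    (X : DerivedCategory (BaseExt k L C)) (n : ℤ) :
    (BObj.freeAdjunction k L (IndCat.{w} C)).RelPD d
      ((homologyFunctor (IndBase k L C) n).obj ((dBaseι k L C).obj X)) := by
  obtain ⟨V, ⟨e⟩⟩ := exists_homology_dBaseι_iso X n
  exact (relPD_of_essDim_le hE2 h V).of_iso e.symm

/-- A morphism is lifted in two stages: along `dLift`, because the cohomology has relative dimension
at most `1`, then along the fully faithful inclusion of finitely presented objects. -/
lemma full_bracketF (hE2 : SatisfiesE2.{w} k C) (hered : IsHereditary (IndCat.{w} C))
    (h : essDim.{w} k C ≤ 1) : (bracketF k L C).Full where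
  map_surjective {X Y} g := by
    let γ : (forgetBase k L C).mapDerivedCategory.obj X.obj ⟶
      (forgetBase k L C).mapDerivedCategory.obj Y.obj := g.hom.hom.hom
    have hγ : ∀ b : L, (forgetBase k L C).mapDerivedCategory.map (b • 𝟙 X.obj) ≫ γ =
        γ ≫ (forgetBase k L C).mapDerivedCategory.map (b • 𝟙 Y.obj) := fun b =>
      congrArg (fun t => t.hom) (g.hom.comm b)
    let φ : (BObj.dLift k L (IndCat.{w} C)).obj ((dBaseι k L C).obj X.obj) ⟶
        (BObj.dLift k L (IndCat.{w} C)).obj ((dBaseι k L C).obj Y.obj) :=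
      { hom := (forgetFactors X.obj).inv ≫ γ ≫ (forgetFactors Y.obj).hom
        comm := fun b => by
          rw [← cancel_epi (forgetFactors X.obj).hom, ← Category.assoc, ← forgetFactors_smul]
          simp only [Category.assoc, Iso.hom_inv_id_assoc]
          rw [← forgetFactors_smul, reassoc_of% (hγ b)] }
    obtain ⟨f', hf'⟩ := BObj.exists_dLift_map_of_relPD_one hered (bounded_dBaseι X.property)
      (relPD_homology_dBaseι hE2 (d := 1) h X.obj) φ
    obtain ⟨f, rfl⟩ := ((refinesEpis_baseExt k L C).mapBijective X.obj Y.obj X.property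
      Y.property).2 f'
    refine ⟨ObjectProperty.homMk f, ?_⟩
    have h1 : (BObj.dForget k L (IndCat.{w} C)).map ((dBaseι k L C).map f) =
        (forgetFactors X.obj).inv ≫ γ ≫ (forgetFactors Y.obj).hom := congrArg BObj.Hom.hom hf'
    have h2 : (forgetBase k L C).mapDerivedCategory.map f = γ := by
      rw [← cancel_mono (forgetFactors Y.obj).hom, forgetFactors_naturality, h1,
        Iso.hom_inv_id_assoc]
    exact ObjectProperty.hom_ext _ (BObj.hom_ext (ObjectProperty.hom_ext _ h2))

/-- In essential dimension `0` every source is relatively projective, so its morphisms are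
determined by the underlying ones. -/
lemma faithful_bracketF (hE2 : SatisfiesE2.{w} k C) (hered : IsHereditary (IndCat.{w} C))
    (h : essDim.{w} k C ≤ 0) : (bracketF k L C).Faithful where
  map_injective {X Y f g} hfg := by
    have h1 : (forgetBase k L C).mapDerivedCategory.map f.hom =
        (forgetBase k L C).mapDerivedCategory.map g.hom := congrArg (fun t => t.hom.hom.hom) hfg
    have h2 : (BObj.dForget k L (IndCat.{w} C)).map ((dBaseι k L C).map f.hom) =
        (BObj.dForget k L (IndCat.{w} C)).map ((dBaseι k L C).map g.hom) := by
      rw [← cancel_epi (forgetFactors X.obj).hom, ← forgetFactors_naturality, h1,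
        forgetFactors_naturality]
    have h3 := BObj.dForget_map_injective_of_relProj
      (BObj.relProj_of_relProj_homology hered _ (bounded_dBaseι X.property)
        (relPD_homology_dBaseι hE2 (d := 0) h X.obj)) h2
    exact ObjectProperty.hom_ext _ (((refinesEpis_baseExt k L C).mapBijective X.obj Y.obj
      X.property Y.property).1 h3)

lemma essSurj_bracketF (hE2 : SatisfiesE2.{w} k C) (hered : IsHereditary (IndCat.{w} C))
    (h : essDim.{w} k C ≤ 2) : (bracketF k L C).EssSurj where
  mem_essImage Z := by
    let Z' : BObj k L (DerivedCategory (IndCat.{w} C)) := (BObj.map L Bounded.ι).obj Z.obj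
    have hZ' : ∀ n, ObjectProperty.isFinitelyPresentable.{w} (IndBase k L C)
        ((BObj.homologyL k L (IndCat.{w} C) n).obj Z') := fun n => Z.property n
    obtain ⟨X, ⟨e⟩⟩ := BObj.exists_dLift_iso_of_relPD hered (d := 2) le_rfl Z' Z.obj.obj.property
      fun n => relPD_of_essDim_le hE2 h ⟨_, hZ' n⟩
    have eobj : (BObj.dForget k L (IndCat.{w} C)).obj X ≅ Z.obj.obj.obj :=
      (BObj.forget k L (DerivedCategory (IndCat.{w} C))).mapIso e
    have hX : TStructure.t.bounded X := (BObj.bounded_dForget_iff X).1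
      (ObjectProperty.prop_of_iso _ eobj.symm Z.obj.obj.property)
    -- The cohomology of the lift `X` is that of `Z` with its action of `L`, hence finitely
    -- presented.
    obtain ⟨W, hW, ⟨e'⟩⟩ := (refinesEpis_baseExt k L C).exists_iso X hX fun n =>
      ⟨⟨_, hZ' n⟩, ⟨(BObj.homologyL k L (IndCat.{w} C) n).mapIso e.symm ≪≫
        BObj.homologyLiftIso X n⟩⟩
    let ε : (BObj.dLift k L (IndCat.{w} C)).obj ((dBaseι k L C).obj W) ≅ Z' :=
      (BObj.dLift k L (IndCat.{w} C)).mapIso e' ≪≫ e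
    let ε' : (forgetBase k L C).mapDerivedCategory.obj W ≅ Z.obj.obj.obj :=
      forgetFactors W ≪≫ (BObj.forget k L (DerivedCategory (IndCat.{w} C))).mapIso ε
    refine ⟨⟨W, hW⟩, ⟨ObjectProperty.isoMk _ (BObj.isoMk (ObjectProperty.isoMk _ ε') fun b => ?_)⟩⟩
    refine ObjectProperty.hom_ext _ ?_
    have h1 : (forgetBase k L C).mapDerivedCategory.map (b • 𝟙 W) ≫ (forgetFactors W).hom ≫
        ε.hom.hom = ((forgetFactors W).hom ≫ ε.hom.hom) ≫ Z'.act b := by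
      rw [← Category.assoc, forgetFactors_smul, Category.assoc, Category.assoc, ε.hom.comm]
    exact h1

end

theorem theorem5p2p3 {k : Type w} [Field k] [IsAlgClosed k] [CharZero k]
    {C : Type u} [Category.{v} C] [EssentiallySmall.{w} C] [Abelian C] [Linear k C]
    [SatisfiesE1.{w} k C] (hE2 : SatisfiesE2.{w} k C) (hered : IsHereditary (IndCat.{w} C))
    (L : Type w) [Field L] [Algebra k L] :
    (essDim.{w} k C ≤ 2 → (bracketF k L C).EssSurj) ∧
    (essDim.{w} k C ≤ 1 → (bracketF k L C).EssSurj ∧ (bracketF k L C).Full) ∧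
    (essDim.{w} k C = 0 → (bracketF k L C).IsEquivalence) := by
  refine ⟨essSurj_bracketF hE2 hered, fun h => ⟨essSurj_bracketF hE2 hered
    (h.trans one_le_two), full_bracketF hE2 hered h⟩, fun h => ?_⟩
  exact
    { faithful := faithful_bracketF hE2 hered h.le
      full := full_bracketF hE2 hered (h.le.trans zero_le_one)
      essSurj := essSurj_bracketF hE2 hered (h.le.trans zero_le_two) }
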